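/- A \emph{directed rooted tree} is a finite digraph $T=(V,E)$ with a vertex (the root) that has no parent, such that every other vertex has exactly one parent and every vertex is reachable from the root. Write $n=|V|$, and suppose that every vertex has degree (indegree plus outdegree) at most $d$. The set $V$ and the bound $d$ are known; $E$ is hidden, and is accessible only through \emph{path queries}: for $i,j\in V$, $Q(i,j)=1$ if there is a directed path with at least one edge from $i$ to $j$, and $Q(i,j)=0$ otherwise. The order relation used for sorting is: $i$ is less than $j$ if $Q(i,j)=1$, and greater otherwise. Consider the following randomized algorithm, called on a vertex set $W$ with $|W|=w$, initially $W=V$. If $w=1$, return $\emptyset$. Otherwise repeat the following \emph{round} until it finds an even separator. 1. Pick $i,j\in W$ independently and uniformly at random. Recover the multidirectional path $x_1,\dots,x_P$ between them (the unique simple path between them in the underlying undirected tree), with the position $c$ of its lowest common ancestor. If $i=j$ it is the single node $i$. If $Q(i,j)=1$ it consists of $i$, the nodes $k\in W\setminus\{i,j\}$ with $Q(i,k)=Q(k,j)=1$ sorted (by merge sort), and $j$, and $c=1$; similarly, starting from $j$, if $Q(j,i)=1$. Otherwise, sort the nodes $k\in W\setminus\{i\}$ with $Q(k,i)=1$, let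 $m$ be the last one with $Q(m,j)=1$ (the lowest common ancestor of $i$ and $j$), recover as before the directed paths from $m$ to $i$ and from $m$ to $j$, and join them into a path from $i$ through $m$ to $j$. 2. For each $k\in W$ not on the path, find by binary search, on each of the two directed paths $x_c,x_{c-1},\dots,x_1$ and $x_c,\dots,x_P$, the last node $x$ with $Q(x,k)=1$ (or $x_c$ if there is none). Put $k$ in the bag of the node found on the first path if this is not $x_c$, and otherwise in the bag of the node found on the second path. Each $x_r$ is in its own bag. 3. For $r=1,\dots,P-1$ let $s_r$ be the total size of the bags of $x_1,\dots,x_r$. The even separator found by the round is the directed edge between $x_r$ and $x_{r+1}$ (directed away from $x_c$) for the first $r$ with $\frac{w-1}{d}\le s_r\le\frac{(d-1)w+1}{d}$, if there is such an $r$. Once an even separator $(u,v)$ is found, let $W_2$ consist of $v$ and all $k\in W\setminus\{v\}$ with $Q(v,k)=1$, let $W_1=W\setminus W_2$, call the algorithm on $W_1$ and on $W_2$ to obtain $E_1$ and $E_2$, and return $E_1\cup E_2\cup\{(u,v)\}$. \textbf{Theorem.} There is an absolute constant $C>0$ such that for every $n\ge1$, every $d$ and every directed rooted tree $T=(V,E)$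 with $n$ nodes and node degree at most $d$: (a) with probability $1$ the algorithm terminates and outputs exactly $E$; (b) the expected number of path queries is at most $C\,d\,n\log^2 n$, and so is the expected running time, that is, the expected total number of path queries, random draws and elementary operations (such as iterations of loops and accesses to array entries); (c) for every $\delta\in(0,1)$, with probability at least $1-\delta$ the algorithm terminates after at most $C\,\frac1\delta\,d\,n\log^2 n$ path queries, and the same holds for the running time. -/

import Mathlib

open scoped ENNReal

namespace TreeReconstruction

/-! ### Directed rooted trees and path queries -/

section Graphs

variable {V : Type}

/-- `T` is a directed rooted tree: some vertex (the root) has no parent, every other vertex has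
exactly one parent, and every vertex is reachable from the root along directed edges. -/
def IsRootedTree (T : Digraph V) : Prop :=
  ∃ r : V, (∀ u, ¬ T.Adj u r) ∧ (∀ v, v ≠ r → ∃! u, T.Adj u v) ∧
    ∀ v, Relation.ReflTransGen T.Adj r v

/-- The degree of a vertex: indegree plus outdegree. -/
noncomputable def degree (T : Digraph V) (v : V) : ℕ :=
  {u | T.Adj u v}.ncard + {w | T.Adj v w}.ncard

open scoped Classical in
/-- The path query: is there a directed path (with at least one edge) from `i` to `j`? -/
noncomputable def pathQuery (T : Digraph V) (i j : V) : Bool :=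
  decide (Relation.TransGen T.Adj i j)

open scoped Classical in
/-- The edge set of a digraph on a finite vertex set, as a finite set of ordered pairs. -/
noncomputable def edgeSet [Fintype V] (T : Digraph V) : Finset (V × V) :=
  Finset.univ.filter fun e => T.Adj e.1 e.2

end Graphs

/-! ### Randomized query programs and their cost -/

/-- Randomized programs that know the graph only through an oracle answering path queries.
`ret` returns a value, `query i j` asks the oracle for the bit `Q(i,j)`, `draw m` picks an element
of `{0, ..., m}` uniformly at random (independently of all other draws), `tick` performs one
elementary operation, and `abort` stops without an output. -/
inductive Prog (V : Type) (α : Type) : Type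
  | ret (a : α) : Prog V α
  | query (i j : V) (k : Bool → Prog V α) : Prog V α
  | draw (m : ℕ) (k : Fin (m + 1) → Prog V α) : Prog V α
  | tick (p : Prog V α) : Prog V α
  | abort : Prog V α

/-- The resources used by a run: the number of path queries, and the running time, i.e. the total
number of path queries, random draws and elementary operations. -/
structure Cost where
  queries : ℕ
  time : ℕ

namespace Prog

variable {V α β : Type}

/-- Sequential composition. -/
def bind : Prog V α → (α → Prog V β) → Prog V β
  | ret a, g => g a
  | query i j k, g => query i j fun b => (k b).bind g
  | draw m k, g => draw m fun x => (k x).bind g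
  | tick p, g => tick (p.bind g)
  | abort, _ => abort

instance : Monad (Prog V) where
  pure := ret
  bind := bind

/-- Ask the oracle one path query. -/
def ask (i j : V) : Prog V Bool := query i j ret

/-- Draw from `{0, ..., m}` uniformly at random. -/
def pick (m : ℕ) : Prog V (Fin (m + 1)) := draw m ret

/-- Charge `n` elementary operations. -/
def ticks : ℕ → Prog V Unit
  | 0 => ret ()
  | n + 1 => tick (ticks n)

/-- Add to the cost of a (possibly failed) run. -/
def charge (q t : ℕ) : Option (α × Cost) → Option (α × Cost) :=
  Option.map fun x => (x.1, ⟨x.2.queries + q, x.2.time + t⟩)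

/-- The law of the output of a program, together with its cost, when the oracle is `Q`;
`none` records a run that aborts. -/
noncomputable def run (Q : V → V → Bool) : Prog V α → PMF (Option (α × Cost))
  | ret a => PMF.pure (some (a, ⟨0, 0⟩))
  | query i j k => (run Q (k (Q i j))).map (charge 1 1)
  | draw m k => (PMF.uniformOfFintype (Fin (m + 1))).bind fun x => (run Q (k x)).map (charge 0 1)
  | tick p => (run Q p).map (charge 0 1)
  | abort => PMF.pure none

end Prog

/-! ### The algorithm -/

section Algorithm

variable {V : Type} [DecidableEq V]

/-- Merge two lists; `a` is "less than" `b` if `Q(a,b) = 1`, and "greater than" otherwise. -/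
def merge : List V → List V → Prog V (List V)
  | [], bs => pure bs
  | a :: as, [] => pure (a :: as)
  | a :: as, b :: bs => do
    Prog.ticks 1
    let less ← Prog.ask a b
    if less then
      let l ← merge as (b :: bs)
      pure (a :: l)
    else
      let l ← merge (a :: as) bs
      pure (b :: l)
termination_by as bs => as.length + bs.length

/-- Merge sort with respect to the path-query order. -/
def sortNodes : List V → Prog V (List V)
  | [] => pure []
  | [a] => pure [a]
  | a :: b :: l => do
    Prog.ticks (l.length + 2)
    let left ← sortNodes ((a :: b :: l).take ((l.length + 2) / 2))
    let right ← sortNodes ((a :: b :: l).drop ((l.length + 2) / 2))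
    merge left right
termination_by l => l.length
decreasing_by
  all_goals simp only [List.length_take, List.length_drop, List.length_cons]
  all_goals omega

/-- The nodes `k ∉ {a, b}` of a list with `Q(a,k) = Q(k,b) = 1`. -/
def nodesBetween (a b : V) : List V → Prog V (List V)
  | [] => pure []
  | k :: ks => do
    Prog.ticks 1
    if k = a ∨ k = b then
      nodesBetween a b ks
    else
      let fromA ← Prog.ask a k
      let toB ← Prog.ask k b
      let l ← nodesBetween a b ks
      if fromA && toB then pure (k :: l) else pure l

/-- The interior nodes, in order, of the directed path from `a` to a descendant `b`. -/
def interior (vs : List V) (a b : V) : Prog V (List V) := do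
  let l ← nodesBetween a b vs
  sortNodes l

/-- The nodes `k ≠ i` of a list with `Q(k,i) = 1`. -/
def ancestors (i : V) : List V → Prog V (List V)
  | [] => pure []
  | k :: ks => do
    Prog.ticks 1
    if k = i then
      ancestors i ks
    else
      let up ← Prog.ask k i
      let l ← ancestors i ks
      if up then pure (k :: l) else pure l

/-- Find path from root: the proper ancestors of `i`, sorted, so that the root comes first. -/
def findPathFromRoot (vs : List V) (i : V) : Prog V (List V) := do
  let l ← ancestors i vs
  sortNodes l

/-- The last node `k` of a list with `Q(k,j) = 1`; `best` is the last one found so far. -/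
def lastAncestor (j : V) : Option V → List V → Prog V (Option V)
  | best, [] => pure best
  | best, k :: ks => do
    Prog.ticks 1
    let up ← Prog.ask k j
    lastAncestor j (if up then some k else best) ks

/-- Find lowest common ancestor, of two nodes neither of which is an ancestor of the other. -/
def findLowestCommonAncestor (vs : List V) (i j : V) : Prog V (Option V) := do
  let pathFromRoot ← findPathFromRoot vs i
  lastAncestor j none pathFromRoot

/-- Reconstruct multidirectional path: the sequence of nodes of the multidirectional path between
`i` and `j` (listed from the ancestor if one of `i`, `j` is an ancestor of the other, and from `i`
otherwise), and the position (counted from `0`) of the lowest common ancestor in it. -/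
def reconstructPath (vs : List V) (i j : V) : Prog V (List V × ℕ) := do
  Prog.ticks vs.length
  if i = j then
    pure ([i], 0)
  else
    let down ← Prog.ask i j
    if down then
      let mid ← interior vs i j
      pure (i :: mid ++ [j], 0)
    else
      let up ← Prog.ask j i
      if up then
        let mid ← interior vs j i
        pure (j :: mid ++ [i], 0)
      else
        let lca ← findLowestCommonAncestor vs i j
        match lca with
        | none => Prog.abort
        | some m =>
          let left ← interior vs m i
          let right ← interior vs m j
          pure (i :: left.reverse ++ m :: right ++ [j], left.length + 1)

/-- Binary search for the last position `p` in `[l, r)` with `p = l` or `Q(path[p],k) = 1`,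
where access to an entry of the path is one elementary operation. -/
def bagSearch (path : List V) (k : V) (l r : ℕ) : Prog V ℕ :=
  if l + 1 < r then
    match path[(l + r) / 2]? with
    | none => pure l
    | some x => do
      Prog.ticks 1
      let up ← Prog.ask x k
      if up then bagSearch path k ((l + r) / 2) r else bagSearch path k l ((l + r) / 2)
  else pure l
termination_by r - l
decreasing_by all_goals omega

/-- Find bag: the position of the node of a directed path to whose bag the node `k` belongs. -/
def findBag (path : List V) (k : V) : Prog V ℕ := bagSearch path k 0 path.length

/-- Count the bags. `path` is the multidirectional path, `c` is the position of the lowest common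
ancestor, `pathLeft` and `pathRight` are the two directed paths starting there, and `size` is the
array of the current bag sizes. The test `k ∈ path` (a table look-up) and the update of one
array entry are elementary operations. -/
def countBags (path pathLeft pathRight : List V) (c : ℕ) :
    List V → List ℕ → Prog V (List ℕ)
  | [], size => pure size
  | k :: ks, size => do
    Prog.ticks 2
    if k ∈ path then
      countBags path pathLeft pathRight c ks size
    else
      let bl ← findBag pathLeft k
      let br ← findBag pathRight k
      let p := if bl = 0 then c + br else c - bl
      countBags path pathLeft pathRight c ks (size.modify p (· + 1))

/-- Look for the first even separator along a multidirectional path, in a tree with `n` nodes.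
`r` is the position of the first node of the list in the multidirectional path and `leftSize` is
the number of nodes in the bags before it. An edge is an even separator if the two parts it
separates have between `(n-1)/d` and `((d-1)n+1)/d` nodes. The edge is returned in its direction:
towards the lowest common ancestor's position `c` the path runs upwards, after it downwards. -/
def findSeparator (n d c : ℕ) : ℕ → ℕ → List V → List ℕ → Prog V (Option (V × V))
  | r, leftSize, x :: y :: xs, s :: ss => do
    Prog.ticks 1
    if n ≤ d * (leftSize + s) + 1 ∧ d * (leftSize + s) + n ≤ d * n + 1 then
      pure (some (if r < c then (y, x) else (x, y)))
    else
      findSeparator n d c (r + 1) (leftSize + s) (y :: xs) ss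
  | _, _, _, _ => pure none

/-- Split tree at an edge with head `j`: the pair of the list of the nodes `k ≠ j` with
`Q(j,k) = 0` and the list of the nodes `k ≠ j` with `Q(j,k) = 1`. -/
def splitNodes (j : V) : List V → Prog V (List V × List V)
  | [] => pure ([], [])
  | k :: ks => do
    Prog.ticks 1
    if k = j then
      splitNodes j ks
    else
      let below ← Prog.ask j k
      let p ← splitNodes j ks
      if below then pure (p.1, k :: p.2) else pure (k :: p.1, p.2)

/-- One round on the vertex set `a :: b :: l`: pick two nodes independently and uniformly at
random, recover the multidirectional path between them, count its bags, and look for an even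
separator in it. -/
def round (d : ℕ) (a b : V) (l : List V) : Prog V (Option (V × V)) := do
  let x ← Prog.pick (l.length + 1)
  let y ← Prog.pick (l.length + 1)
  let (path, c) ← reconstructPath (a :: b :: l) ((a :: b :: l).get x) ((a :: b :: l).get y)
  Prog.ticks (3 * path.length)
  let size ← countBags path (path.take (c + 1)).reverse (path.drop c) c (a :: b :: l)
    (List.replicate path.length 1)
  findSeparator (l.length + 2) d c 0 0 path size

/-- Reconstruct tree, on the vertex set given by a list. The first argument is a budget: a run in
which some chain of nested calls has more rounds than that is aborted (it makes the definition
a terminating one, and is removed in `reconstructionLaw`). A round that finds no even separator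
is followed by another one on the same vertex set; otherwise the tree is cut at the even
separator and the two parts are reconstructed recursively. -/
def reconstruct (d : ℕ) : ℕ → List V → Prog V (Finset (V × V))
  | 0, _ => Prog.abort
  | _ + 1, [] => pure ∅
  | _ + 1, [_] => pure ∅
  | budget + 1, a :: b :: l => do
    let sep ← round d a b l
    match sep with
    | none => reconstruct d budget (a :: b :: l)
    | some (i, j) =>
      let (vs₁, vs₂) ← splitNodes j (a :: b :: l)
      let e₁ ← reconstruct d budget vs₁
      let e₂ ← reconstruct d budget (j :: vs₂)
      Prog.ticks (l.length + 2)
      pure (insert (i, j) (e₁ ∪ e₂))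

end Algorithm

/-! ### The law of the algorithm without a budget -/

section Law

variable {β : Type}

theorem tsum_liminf_le_one (p : ℕ → PMF (Option β)) :
    ∑' b, Filter.liminf (fun m => p m (some b)) Filter.atTop ≤ 1 := by
  let _ : MeasurableSpace β := ⊤
  have h := MeasureTheory.lintegral_liminf_le (μ := MeasureTheory.Measure.count)
    (u := Filter.atTop) (f := fun m (b : β) => p m (some b)) (fun m => measurable_from_top)
  rw [MeasureTheory.lintegral_count' measurable_from_top] at h
  refine h.trans ?_
  have h1 : ∀ m, MeasureTheory.lintegral MeasureTheory.Measure.count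
      (fun b : β => p m (some b)) ≤ 1 := by
    intro m
    rw [MeasureTheory.lintegral_count' measurable_from_top, ← (p m).tsum_coe]
    exact ENNReal.tsum_comp_le_tsum_of_injective (Option.some_injective β) _
  refine (Filter.liminf_le_liminf (v := fun _ => (1 : ℝ≥0∞))
    (Filter.Eventually.of_forall h1)).trans ?_
  simp

/-- The limit of laws of runs with growing budgets. The mass at an outcome `some b` is the limit
of the masses there, and the remaining mass, the probability that an unbounded run never
produces an output, is put at `none`. -/
noncomputable def limitLaw (p : ℕ → PMF (Option β)) : PMF (Option β) :=
  ⟨fun o => match o with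
    | some b => Filter.liminf (fun m => p m (some b)) Filter.atTop
    | none => 1 - ∑' b, Filter.liminf (fun m => p m (some b)) Filter.atTop, by
    refine (Summable.hasSum_iff ENNReal.summable).2 ?_
    rw [ENNReal.tsum_eq_add_tsum_ite none]
    refine (congrArg (_ + ·) ?_).trans (tsub_add_cancel_of_le (tsum_liminf_le_one p))
    rw [← (Option.some_injective β).tsum_eq]
    · simp
    · intro o ho
      cases o with
      | none => simp at ho
      | some b => exact ⟨b, rfl⟩⟩

/-- The law of the edge set that the algorithm outputs, and of the cost of the run, when the
hidden tree is `T`; `none` stands for a run without an output. -/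
noncomputable def reconstructionLaw {n : ℕ} (d : ℕ) (T : Digraph (Fin n)) :
    PMF (Option (Finset (Fin n × Fin n) × Cost)) :=
  limitLaw fun budget => (reconstruct d budget (List.finRange n)).run (pathQuery T)

/-- The expectation of a cost, which is infinite on the runs without an output. -/
noncomputable def expectedCost (p : PMF (Option (β × Cost))) (f : Cost → ℕ) : ℝ≥0∞ :=
  ∑' o, p o * (match o with
    | some x => (f x.2 : ℝ≥0∞)
    | none => ⊤)

/-- The event that a run has an output and costs at most `B`. -/
def costAtMost (f : Cost → ℕ) (B : ℝ) : Set (Option (β × Cost)) :=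
  {o | ∃ x, o = some x ∧ (f x.2 : ℝ) ≤ B}

end Law

end TreeReconstruction

open TreeReconstruction

/-!
The vertices of a directed rooted tree, ordered by reachability, form a partial order with a least
element in which the elements below a given one are a chain (`IsTreeOrder`); edges are the pairs
`u ⋖ v`, and a path query asks whether `i < j`. The algorithm only ever works on sets `W` that
induce a subtree, and cutting `W` at an edge with head `v` splits it into `below W v` and
`above W v`.

*Rounds.* For `i, j ∈ W` the path that a round recovers consists of two saturated chains
starting at the lowest common ancestor (`IsFork`). The binary searches put every vertex into a bag
such that the number of vertices in the first `r` bags is the size of one side of the `r`-th edge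
of the path. Hence a round returns an even separator (`IsEvenCut`) or nothing, and it succeeds as
soon as `i` and `j` are separated by some even separator (`goodPairs`); its time is `O(w log w)`
where `w = |W|` (`exists_runs_roundAt`). Correctness of all outputs follows by induction on the
budget (`sat_reconstruct`).

*Expected time.* The expected number of rounds on `W` is at most `w² / |goodPairs d W|`. Up to
a factor `O(log n)` the expected time is therefore at most `cutCost d V`, where `cutCost d W` is
`w³ / |goodPairs d W|` plus the sum of the costs of the two parts of `W`, for the worst even
separator (`expTime_reconstruct_le`). A run that aborts is charged its budget, so the same bound
shows that the abortion probabilities tend to `0` (`expectedCost_limitLaw_le`). The tail bound is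
Markov's inequality.

*The amortized bound* `cutCost d W = O(d w log w)` (`cutCost_le_mul_log`). Let `v` be a centroid
of `W`. Call a branch at `v` big if it has at least `(w - 1) / d` vertices, and let `b` be the
number of vertices in big branches. The edge from `v` to a big branch is an even separator, so
`|goodPairs d W| ≥ b w / 2`. If `b ≥ w / 64`, a round succeeds with constant probability, and the
cost `O(w)` is paid for by the decrease of `d ∑ w log w` (`entropy_gain`), because both parts
have at least `(w - 1) / d` vertices. If `b` is smaller, a round may succeed with probability
of order `1 / d` only, and then a single cut need not pay for itself. In this case one follows
the part that contains `v` until it has lost an eighth of its vertices. Every cut on the way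
removes a piece from a big branch: either a branch far above the threshold shrinks, or
a branch near the threshold drops well below it, and since there are at most `d` branches with
average size near the threshold, the latter forces `b` to be large afterwards. So the costs on the
way form two harmonic sums, which are `O(d w log d)` in total; the function `potential` makes this
precise (`potential_drop`). On the other hand most of the lost vertices belonged to branches with
fewer than `w / d` vertices, so `∑ w log w` decreases by an amount of order `w log d` in the
meantime, which pays for these costs (`cutCost_le_chainBound`).
-/

namespace TreeReconstruction

/-! ### Deterministic runs, expected cost and outputs of query programs -/

namespace Prog

variable {V α β : Type}

/-- `Runs Q p a N`: when the oracle is `Q`, the program `p` makes no draw, returns `a`, and takes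
time at most `N`. -/
inductive Runs (Q : V → V → Bool) : Prog V α → α → ℕ → Prop
  | ret (a : α) (N : ℕ) : Runs Q (ret a) a N
  | query {i j : V} {k : Bool → Prog V α} {a : α} {N : ℕ} (h : Runs Q (k (Q i j)) a N) :
      Runs Q (query i j k) a (N + 1)
  | tick {p : Prog V α} {a : α} {N : ℕ} (h : Runs Q p a N) : Runs Q (tick p) a (N + 1)

theorem Runs.mono {Q : V → V → Bool} {p : Prog V α} {a : α} {N : ℕ} (h : Runs Q p a N) :
    ∀ {M : ℕ}, N ≤ M → Runs Q p a M := by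
  induction h with
  | ret a N => exact fun _ => .ret a _
  | query h ih =>
    intro M hM
    obtain ⟨M, rfl⟩ : ∃ M', M = M' + 1 := ⟨M - 1, by omega⟩
    exact .query (ih (by omega))
  | tick h ih =>
    intro M hM
    obtain ⟨M, rfl⟩ : ∃ M', M = M' + 1 := ⟨M - 1, by omega⟩
    exact .tick (ih (by omega))

theorem Runs.bind {Q : V → V → Bool} {p : Prog V α} {g : α → Prog V β} {a : α} {b : β} {N M : ℕ}
    (h : Runs Q p a N) (hg : Runs Q (g a) b M) : Runs Q (p >>= g) b (N + M) := by
  change Runs Q (p.bind g) b (N + M)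
  induction h with
  | ret a N => exact hg.mono (by omega)
  | query h ih => exact (Runs.query (ih hg)).mono (by omega)
  | tick h ih => exact (Runs.tick (ih hg)).mono (by omega)

theorem runs_pure (Q : V → V → Bool) (a : α) (N : ℕ) : Runs Q (pure a : Prog V α) a N :=
  .ret a N

theorem runs_ask (Q : V → V → Bool) (i j : V) : Runs Q (ask i j) (Q i j) 1 :=
  .query (.ret _ 0)

theorem runs_ticks (Q : V → V → Bool) (n : ℕ) : Runs Q (ticks n : Prog V Unit) () n := by
  induction n with
  | zero => exact .ret _ _
  | succ n ih => exact .tick ih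

/-- The expected value of `f` at the output plus the time of the run, where a run that aborts
contributes at least `A`. -/
noncomputable def expTime (Q : V → V → Bool) (A : ℝ≥0∞) : Prog V α → (α → ℝ≥0∞) → ℝ≥0∞
  | ret a, f => f a
  | query i j k, f => expTime Q A (k (Q i j)) f + 1
  | draw m k, f => (∑ x, expTime Q A (k x) f) / (m + 1 : ℕ) + 1
  | tick p, f => expTime Q A p f + 1
  | abort, _ => A

theorem expTime_bind (Q : V → V → Bool) (A : ℝ≥0∞) (p : Prog V α) (g : α → Prog V β)
    (f : β → ℝ≥0∞) :
    expTime Q A (p >>= g) f = expTime Q A p fun a => expTime Q A (g a) f := by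
  change expTime Q A (p.bind g) f = _
  induction p with
  | ret a => rfl
  | query i j k ih => simp only [Prog.bind, expTime, ih]
  | draw m k ih => simp only [Prog.bind, expTime, ih]
  | tick p ih => simp only [Prog.bind, expTime, ih]
  | abort => rfl

theorem expTime_pick (Q : V → V → Bool) (A : ℝ≥0∞) (m : ℕ) (f : Fin (m + 1) → ℝ≥0∞) :
    expTime Q A (pick m : Prog V _) f = (∑ x, f x) / (m + 1 : ℕ) + 1 := rfl

theorem expTime_le_of_runs {Q : V → V → Bool} {p : Prog V α} {a : α} {N : ℕ}
    (h : Runs Q p a N) (A : ℝ≥0∞) (f : α → ℝ≥0∞) : expTime Q A p f ≤ f a + N := by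
  induction h with
  | ret a N => exact le_self_add
  | query h ih => push_cast; rw [← add_assoc]; exact add_le_add_left (ih) 1
  | tick h ih => push_cast; rw [← add_assoc]; exact add_le_add_left (ih) 1

theorem expTime_mono (Q : V → V → Bool) (A : ℝ≥0∞) (p : Prog V α) {f g : α → ℝ≥0∞}
    (h : ∀ a, f a ≤ g a) : expTime Q A p f ≤ expTime Q A p g := by
  induction p with
  | ret a => exact h a
  | query i j k ih => exact add_le_add_left (ih _) 1
  | draw m k ih =>
    exact add_le_add_left (ENNReal.div_le_div_right (Finset.sum_le_sum fun x _ => ih x) _) 1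
  | tick p ih => exact add_le_add_left ih 1
  | abort => exact le_rfl

theorem sum_add_const_div (m : ℕ) (f : Fin (m + 1) → ℝ≥0∞) (c : ℝ≥0∞) :
    (∑ x, (f x + c)) / (m + 1 : ℕ) = (∑ x, f x) / (m + 1 : ℕ) + c := by
  rw [Finset.sum_add_distrib, ENNReal.add_div]
  congr 1
  simp only [Finset.sum_const, Finset.card_univ, Fintype.card_fin, nsmul_eq_mul]
  rw [mul_comm, mul_div_assoc, ENNReal.div_self (by simp) (by simp), mul_one]

theorem expTime_abort_succ_le (Q : V → V → Bool) (A : ℝ≥0∞) (p : Prog V α) (f : α → ℝ≥0∞) :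
    expTime Q (A + 1) p f ≤ expTime Q A p f + 1 := by
  induction p with
  | ret a => exact le_self_add
  | query i j k ih => exact add_le_add_left (ih _) 1
  | draw m k ih =>
    refine add_le_add_left ?_ 1
    refine (ENNReal.div_le_div_right (Finset.sum_le_sum fun x _ => ih x) _).trans ?_
    rw [sum_add_const_div]
    exact le_rfl
  | tick p ih => exact add_le_add_left ih 1
  | abort => exact le_rfl

theorem expTime_add_const_le (Q : V → V → Bool) (A : ℝ≥0∞) (p : Prog V α) (f : α → ℝ≥0∞)
    (c : ℝ≥0∞) : expTime Q A p (fun a => f a + c) ≤ expTime Q A p f + c := by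
  induction p with
  | ret a => exact le_rfl
  | query i j k ih => simp only [expTime]; rw [add_right_comm]; exact add_le_add_left (ih _) 1
  | draw m k ih =>
    simp only [expTime]; rw [add_right_comm]
    refine add_le_add_left ?_ 1
    refine (ENNReal.div_le_div_right (Finset.sum_le_sum fun x _ => ih x) _).trans ?_
    rw [sum_add_const_div]
  | tick p ih => simp only [expTime]; rw [add_right_comm]; exact add_le_add_left ih 1
  | abort => exact le_self_add

/-- The value of an outcome of a run that `expTime` averages. -/
noncomputable def outcomeValue (A : ℝ≥0∞) (f : α → ℝ≥0∞) : Option (α × Cost) → ℝ≥0∞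
  | some x => f x.1 + x.2.time
  | none => A

theorem tsum_pure_mul {γ : Type} (a : γ) (v : γ → ℝ≥0∞) :
    ∑' o, (PMF.pure a) o * v o = v a := by
  rw [tsum_eq_single a]
  · simp
  · intro b hb; simp [hb]

theorem tsum_bind_mul {γ γ' : Type} (p : PMF γ) (g : γ → PMF γ') (v : γ' → ℝ≥0∞) :
    ∑' o, (p.bind g) o * v o = ∑' a, p a * ∑' o, g a o * v o := by
  simp only [PMF.bind_apply, ← ENNReal.tsum_mul_right, ← ENNReal.tsum_mul_left]
  rw [ENNReal.tsum_comm]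
  simp only [mul_assoc]

theorem tsum_map_mul {γ γ' : Type} (p : PMF γ) (g : γ → γ') (v : γ' → ℝ≥0∞) :
    ∑' o, (p.map g) o * v o = ∑' a, p a * v (g a) := by
  rw [PMF.map, tsum_bind_mul]
  simp only [Function.comp, tsum_pure_mul]

theorem tsum_map_charge_le (p : PMF (Option (α × Cost))) (q : ℕ) (A : ℝ≥0∞) (f : α → ℝ≥0∞) :
    ∑' o, (p.map (charge q 1)) o * outcomeValue A f o ≤ (∑' o, p o * outcomeValue A f o) + 1 := by
  rw [tsum_map_mul]
  calc _ ≤ ∑' o, (p o * outcomeValue A f o + p o) := by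
        refine ENNReal.tsum_le_tsum fun o => ?_
        cases o with
        | none => exact le_self_add
        | some x =>
          simp only [charge, Option.map_some, outcomeValue]
          push_cast
          rw [← mul_add_one, ← add_assoc]
    _ = _ := by rw [ENNReal.tsum_add, p.tsum_coe]

/-- The recursively defined `expTime` dominates the expectation under the law of a run. -/
theorem tsum_run_le_expTime (Q : V → V → Bool) (A : ℝ≥0∞) (p : Prog V α) (f : α → ℝ≥0∞) :
    ∑' o, (p.run Q) o * outcomeValue A f o ≤ expTime Q A p f := by
  induction p with
  | ret a => simp only [run, tsum_pure_mul, outcomeValue, expTime]; simp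
  | query i j k ih => exact (tsum_map_charge_le _ _ _ _).trans (add_le_add_left (ih _) 1)
  | draw m k ih =>
    simp only [run, tsum_bind_mul, expTime]
    calc _ ≤ ∑' x, (PMF.uniformOfFintype (Fin (m + 1))) x * (expTime Q A (k x) f + 1) := by
          refine ENNReal.tsum_le_tsum fun x => mul_le_mul_right ?_ _
          exact (tsum_map_charge_le _ _ _ _).trans (add_le_add_left (ih _) 1)
      _ = _ := by
          rw [tsum_fintype, ← sum_add_const_div, ENNReal.div_eq_inv_mul, Finset.mul_sum]
          simp
  | tick p ih => exact (tsum_map_charge_le _ _ _ _).trans (add_le_add_left ih 1)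
  | abort => simp only [run, tsum_pure_mul, outcomeValue, expTime]; exact le_rfl

/-- Every output of `p`, whatever the draws, satisfies `post`. -/
def Sat (Q : V → V → Bool) (post : α → Prop) : Prog V α → Prop
  | ret a => post a
  | query i j k => Sat Q post (k (Q i j))
  | draw _ k => ∀ x, Sat Q post (k x)
  | tick p => Sat Q post p
  | abort => True

theorem Sat.bind {Q : V → V → Bool} {P : α → Prop} {R : β → Prop} {p : Prog V α}
    {g : α → Prog V β} (h : Sat Q P p) (hg : ∀ a, P a → Sat Q R (g a)) : Sat Q R (p >>= g) := by
  change Sat Q R (p.bind g)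
  induction p with
  | ret a => exact hg a h
  | query i j k ih => exact ih _ h
  | draw m k ih => exact fun x => ih x (h x)
  | tick p ih => exact ih h
  | abort => trivial

theorem Runs.sat {Q : V → V → Bool} {P : α → Prop} {p : Prog V α} {a : α} {N : ℕ}
    (h : Runs Q p a N) (ha : P a) : Sat Q P p := by
  induction h with
  | ret a N => exact ha
  | query h ih => exact ih ha
  | tick h ih => exact ih ha

theorem sat_pick (Q : V → V → Bool) (m : ℕ) : Sat Q (fun _ => True) (pick m : Prog V _) :=
  fun _ => trivial

theorem Sat.support {Q : V → V → Bool} {P : α → Prop} {p : Prog V α} (h : Sat Q P p) :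
    ∀ x ∈ (p.run Q).support, ∀ y, x = some y → P y.1 ∧ y.2.queries ≤ y.2.time := by
  have key : ∀ (q t : ℕ) (_ : q ≤ t) (r : PMF (Option (α × Cost))),
      (∀ x ∈ r.support, ∀ y, x = some y → P y.1 ∧ y.2.queries ≤ y.2.time) →
      ∀ x ∈ (r.map (charge q t)).support, ∀ y, x = some y → P y.1 ∧ y.2.queries ≤ y.2.time := by
    intro q t hqt r hr x hx y hy
    rw [PMF.support_map] at hx
    obtain ⟨z, hz, rfl⟩ := hx
    cases z with
    | none => simp [charge] at hy
    | some z =>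
      have := hr _ hz z rfl
      simp only [charge, Option.map_some, Option.some.injEq] at hy
      subst hy
      exact ⟨this.1, by simp only; omega⟩
  induction p with
  | ret a =>
    intro x hx y hy
    simp only [run, PMF.support_pure, Set.mem_singleton_iff] at hx
    subst hx
    cases hy
    exact ⟨h, le_rfl⟩
  | query i j k ih => exact key 1 1 le_rfl _ (ih _ h)
  | draw m k ih =>
    intro x hx
    simp only [run, PMF.mem_support_bind_iff] at hx
    obtain ⟨z, _, hz⟩ := hx
    exact key 0 1 zero_le_one _ (ih z (h z)) x hz
  | tick p ih => exact key 0 1 zero_le_one _ (ih h)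
  | abort =>
    intro x hx y hy
    simp only [run, PMF.support_pure, Set.mem_singleton_iff] at hx
    simp [hx] at hy

/-- `Refines p q`: the program `q` arises from `p` by replacing some of its aborts by programs. -/
inductive Refines : Prog V α → Prog V α → Prop
  | ret (a : α) : Refines (ret a) (ret a)
  | query (i j : V) {k k' : Bool → Prog V α} (h : ∀ b, Refines (k b) (k' b)) :
      Refines (query i j k) (query i j k')
  | draw (m : ℕ) {k k' : Fin (m + 1) → Prog V α} (h : ∀ x, Refines (k x) (k' x)) :
      Refines (draw m k) (draw m k')
  | tick {p q : Prog V α} (h : Refines p q) : Refines (tick p) (tick q)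
  | abort (p : Prog V α) : Refines abort p

theorem Refines.refl (p : Prog V α) : Refines p p := by
  induction p with
  | ret a => exact .ret a
  | query i j k ih => exact .query i j ih
  | draw m k ih => exact .draw m ih
  | tick p ih => exact .tick ih
  | abort => exact .abort _

theorem Refines.bind {p q : Prog V α} {g g' : α → Prog V β} (h : Refines p q)
    (hg : ∀ a, Refines (g a) (g' a)) : Refines (p >>= g) (q >>= g') := by
  change Refines (p.bind g) (q.bind g')
  induction h with
  | ret a => exact hg a
  | query i j h ih => exact .query i j ih
  | draw m h ih => exact .draw m ih
  | tick h ih => exact .tick ih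
  | abort p => exact .abort _

theorem map_charge_some_mono {p q : PMF (Option (α × Cost))} (h : ∀ y, p (some y) ≤ q (some y))
    (a b : ℕ) (y : α × Cost) : p.map (charge a b) (some y) ≤ q.map (charge a b) (some y) := by
  classical
  rw [PMF.map_apply, PMF.map_apply]
  refine ENNReal.tsum_le_tsum fun o => ?_
  cases o with
  | none => simp [charge]
  | some z => split_ifs <;> simp [h]

theorem Refines.run_le {p q : Prog V α} (h : Refines p q) (Q : V → V → Bool) :
    ∀ y, p.run Q (some y) ≤ q.run Q (some y) := by
  induction h with
  | ret a => exact fun _ => le_rfl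
  | query i j h ih => exact map_charge_some_mono (ih _) 1 1
  | draw m h ih =>
    intro y
    simp only [run, PMF.bind_apply]
    exact ENNReal.tsum_le_tsum fun x => mul_le_mul_right (map_charge_some_mono (ih x) 0 1 y) _
  | tick h ih => exact map_charge_some_mono ih 0 1
  | abort p => intro y; simp [run]

end Prog

/-! ### The limit law -/

section Limit

variable {β : Type}

theorem limitLaw_some {p : ℕ → PMF (Option β)} (hp : ∀ b, Monotone fun m => p m (some b)) (b : β) :
    limitLaw p (some b) = ⨆ m, p m (some b) :=
  (tendsto_atTop_iSup (hp b)).liminf_eq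

theorem limitLaw_none (p : ℕ → PMF (Option β)) :
    limitLaw p none = 1 - ∑' b, limitLaw p (some b) := rfl

theorem tsum_iSup_of_monotone {f : ℕ → β → ℝ≥0∞} (hf : ∀ b, Monotone fun m => f m b) :
    ∑' b, ⨆ m, f m b = ⨆ m, ∑' b, f m b := by
  let _ : MeasurableSpace β := ⊤
  have h := MeasureTheory.lintegral_iSup (μ := MeasureTheory.Measure.count) (f := f)
    (fun m => measurable_from_top) (fun m n hmn b => hf b hmn)
  rw [MeasureTheory.lintegral_count' measurable_from_top] at h
  simp only [MeasureTheory.lintegral_count' measurable_from_top] at h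
  exact h

theorem tsum_option {f : Option β → ℝ≥0∞} : ∑' o, f o = f none + ∑' b, f (some b) := by
  rw [ENNReal.tsum_eq_add_tsum_ite none]
  congr 1
  rw [← (Option.some_injective β).tsum_eq]
  · simp
  · intro o ho
    cases o with
    | none => simp at ho
    | some b => exact ⟨b, rfl⟩

/-- If an aborted run of budget `m` is charged `m` and the expected charges stay bounded, then
the abortion probabilities tend to `0`, so the limit law gives no mass to `none`, and the bound
passes to the limit. -/
theorem expectedCost_limitLaw_le {p : ℕ → PMF (Option (β × Cost))}
    (hp : ∀ b, Monotone fun m => p m (some b)) {M : ℝ≥0∞} (hM : M ≠ ⊤)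
    (h : ∀ m, p m none * m + ∑' x, p m (some x) * x.2.time ≤ M) :
    limitLaw p none = 0 ∧ expectedCost (limitLaw p) Cost.time ≤ M := by
  have hnone : limitLaw p none = 0 := by
    rw [limitLaw_none]
    simp only [limitLaw_some hp]
    rw [tsum_iSup_of_monotone hp, tsub_eq_zero_iff_le]
    refine ENNReal.le_of_forall_pos_le_add fun ε hε _ => ?_
    obtain ⟨m, hm⟩ := ENNReal.exists_nat_gt (ENNReal.div_ne_top hM (ENNReal.coe_pos.2 hε).ne')
    have h1 : p m none ≤ ε := by
      by_contra! hlt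
      have h2 := le_self_add.trans (h m)
      have h3 : M < ε * m := by
        rwa [ENNReal.div_lt_iff (Or.inl (ENNReal.coe_pos.2 hε).ne') (Or.inl ENNReal.coe_ne_top),
          mul_comm] at hm
      exact absurd ((mul_le_mul_left hlt.le (m : ℝ≥0∞)).trans h2) (not_le.2 h3)
    calc (1 : ℝ≥0∞) = p m none + ∑' b, p m (some b) := by rw [← tsum_option, (p m).tsum_coe]
      _ ≤ ε + ⨆ m, ∑' b, p m (some b) :=
        add_le_add h1 (le_iSup (fun m => ∑' b, p m (some b)) m)
      _ = _ := add_comm _ _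
  refine ⟨hnone, ?_⟩
  rw [expectedCost, tsum_option, hnone, zero_mul, zero_add]
  simp only [limitLaw_some hp, ENNReal.iSup_mul]
  rw [tsum_iSup_of_monotone (f := fun m (x : β × Cost) => p m (some x) * x.2.time)
    (fun b m n hmn => mul_le_mul_left (hp b hmn) _)]
  exact iSup_le fun m => le_add_self.trans (h m)

/-- Markov's inequality for the cost of a run. -/
theorem le_toOuterMeasure_costAtMost (p : PMF (Option (β × Cost))) (f : Cost → ℕ) {M δ : ℝ}
    (hM : 0 ≤ M) (hδ : 0 < δ) (h : expectedCost p f ≤ ENNReal.ofReal M) :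
    ENNReal.ofReal (1 - δ) ≤ p.toOuterMeasure (costAtMost f (1 / δ * M)) := by
  classical
  set S : Set (Option (β × Cost)) := costAtMost f (1 / δ * M) with hS
  have hcompl : p.toOuterMeasure Sᶜ ≤ ENNReal.ofReal δ := by
    rw [PMF.toOuterMeasure_apply]
    rcases hM.eq_or_lt with rfl | hM
    · rw [expectedCost, ENNReal.ofReal_zero, nonpos_iff_eq_zero, ENNReal.tsum_eq_zero] at h
      refine le_of_eq_of_le (ENNReal.tsum_eq_zero.2 fun o => ?_) zero_le
      by_cases ho : o ∈ Sᶜ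
      · rw [Set.indicator_of_mem ho]
        have := h o
        rcases mul_eq_zero.1 this with h0 | h0
        · exact h0
        · cases o with
          | none => simp at h0
          | some x =>
            refine absurd ⟨x, rfl, ?_⟩ ho
            simp only [Nat.cast_eq_zero] at h0
            simp [h0]
      · rw [Set.indicator_of_notMem ho]
    · have hB : 0 < 1 / δ * M := by positivity
      have : (∑' o, Sᶜ.indicator p o) * ENNReal.ofReal (1 / δ * M) ≤ ENNReal.ofReal M := by
        refine le_trans ?_ h
        rw [expectedCost, ← ENNReal.tsum_mul_right]
        refine ENNReal.tsum_le_tsum fun o => ?_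
        by_cases ho : o ∈ Sᶜ
        · rw [Set.indicator_of_mem ho]
          refine mul_le_mul_right ?_ _
          cases o with
          | none => exact le_top
          | some x =>
            have : ¬ (f x.2 : ℝ) ≤ 1 / δ * M := fun hle => ho ⟨x, rfl, hle⟩
            change _ ≤ ((f x.2 : ℕ) : ℝ≥0∞)
            rw [← ENNReal.ofReal_natCast]
            exact ENNReal.ofReal_le_ofReal (not_le.1 this).le
        · rw [Set.indicator_of_notMem ho]; simp
      rw [← ENNReal.le_div_iff_mul_le (Or.inl (by simpa using hB)) (Or.inl ENNReal.ofReal_ne_top),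
        ← ENNReal.ofReal_div_of_pos hB] at this
      refine this.trans_eq (congrArg _ ?_)
      field_simp
  have hsum : (1 : ℝ≥0∞) ≤ p.toOuterMeasure S + p.toOuterMeasure Sᶜ := by
    have := MeasureTheory.measure_union_le (μ := p.toOuterMeasure) S Sᶜ
    rw [Set.union_compl_self] at this
    refine le_trans ?_ this
    rw [(PMF.toOuterMeasure_apply_eq_one_iff p Set.univ).2 (Set.subset_univ _)]
  rw [ENNReal.ofReal_sub _ hδ.le, ENNReal.ofReal_one, tsub_le_iff_right]
  exact hsum.trans (add_le_add_right hcompl _)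

end Limit

/-! ### Rooted trees as orders -/

section Order

variable {V : Type} [PartialOrder V]

/-- The order of a rooted tree: there is a least element, and the elements below any given one
form a chain. The edges of the tree are the pairs `u ⋖ v`. -/
structure IsTreeOrder (V : Type) [PartialOrder V] : Prop where
  root : ∃ r : V, ∀ x, r ≤ x
  chain : ∀ {a b c : V}, a ≤ c → b ≤ c → a ≤ b ∨ b ≤ a

theorem IsTreeOrder.le_of_lt_of_covBy (hV : IsTreeOrder V) {a u v : V} (h : a < v) (huv : u ⋖ v) :
    a ≤ u := by
  rcases hV.chain h.le huv.le with h1 | h1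
  · exact h1
  · rcases h1.eq_or_lt with rfl | h2
    · exact le_rfl
    · exact absurd h (huv.2 h2)

theorem IsTreeOrder.covBy_unique (hV : IsTreeOrder V) {u u' v : V} (h : u ⋖ v) (h' : u' ⋖ v) :
    u = u' :=
  le_antisymm (hV.le_of_lt_of_covBy h.lt h') (hV.le_of_lt_of_covBy h'.lt h)

/-- `W` induces a subtree. -/
structure IsSubtree (W : Finset V) : Prop where
  root : ∃ r ∈ W, ∀ x ∈ W, r ≤ x
  convex : ∀ {a b k : V}, a ∈ W → b ∈ W → a ≤ k → k ≤ b → k ∈ W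

open scoped Classical in
/-- The edges inside `W`. -/
noncomputable def edgesIn (W : Finset V) : Finset (V × V) :=
  (W ×ˢ W).filter fun e => e.1 ⋖ e.2

@[simp] theorem mem_edgesIn {W : Finset V} {e : V × V} :
    e ∈ edgesIn W ↔ (e.1 ∈ W ∧ e.2 ∈ W) ∧ e.1 ⋖ e.2 := by
  simp [edgesIn]

theorem edgesIn_of_card_le_one {W : Finset V} (h : W.card ≤ 1) : edgesIn W = ∅ := by
  ext e
  simp only [mem_edgesIn, Finset.notMem_empty, iff_false, not_and]
  intro he hc
  exact hc.lt.ne (Finset.card_le_one.1 h _ he.1 _ he.2)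

open scoped Classical in
/-- The neighbours of `v` in the tree. -/
noncomputable def nbrs [Fintype V] (v : V) : Finset V := Finset.univ.filter fun x => x ⋖ v ∨ v ⋖ x

@[simp] theorem mem_nbrs [Fintype V] {v x : V} : x ∈ nbrs v ↔ x ⋖ v ∨ v ⋖ x := by simp [nbrs]

variable [DecidableLE V]

/-- The part of `W` below the edge with head `v`. -/
def below (W : Finset V) (v : V) : Finset V := W.filter (v ≤ ·)

/-- The part of `W` that remains when the part below the edge with head `v` is removed. -/
def above (W : Finset V) (v : V) : Finset V := W.filter (¬ v ≤ ·)

@[simp] theorem mem_below {W : Finset V} {v k : V} : k ∈ below W v ↔ k ∈ W ∧ v ≤ k :=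
  Finset.mem_filter

@[simp] theorem mem_above {W : Finset V} {v k : V} : k ∈ above W v ↔ k ∈ W ∧ ¬ v ≤ k :=
  Finset.mem_filter

theorem below_subset (W : Finset V) (v : V) : below W v ⊆ W := Finset.filter_subset _ _

theorem above_subset (W : Finset V) (v : V) : above W v ⊆ W := Finset.filter_subset _ _

theorem card_below_add_card_above (W : Finset V) (v : V) :
    (below W v).card + (above W v).card = W.card :=
  Finset.card_filter_add_card_filter_not _

/-- The even separators of the subtree `W`: edges of `W` both of whose sides have at least
`(|W| - 1) / d` vertices. -/
structure IsEvenCut (d : ℕ) (W : Finset V) (e : V × V) : Prop where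
  fst_mem : e.1 ∈ W
  snd_mem : e.2 ∈ W
  covBy : e.1 ⋖ e.2
  card_le_below : W.card ≤ d * (below W e.2).card + 1
  card_le_above : W.card ≤ d * (above W e.2).card + 1

theorem IsEvenCut.fst_mem_above {d : ℕ} {W : Finset V} {e : V × V} (h : IsEvenCut d W e) :
    e.1 ∈ above W e.2 := mem_above.2 ⟨h.fst_mem, h.covBy.lt.not_ge⟩

theorem IsEvenCut.snd_mem_below {d : ℕ} {W : Finset V} {e : V × V} (h : IsEvenCut d W e) :
    e.2 ∈ below W e.2 := mem_below.2 ⟨h.snd_mem, le_rfl⟩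

theorem IsEvenCut.card_below_lt {d : ℕ} {W : Finset V} {e : V × V} (h : IsEvenCut d W e) :
    (below W e.2).card < W.card := by
  have := Finset.card_pos.2 ⟨_, h.fst_mem_above⟩
  have := card_below_add_card_above W e.2
  omega

theorem IsEvenCut.card_above_lt {d : ℕ} {W : Finset V} {e : V × V} (h : IsEvenCut d W e) :
    (above W e.2).card < W.card := by
  have := Finset.card_pos.2 ⟨_, h.snd_mem_below⟩
  have := card_below_add_card_above W e.2
  omega

theorem IsSubtree.below {W : Finset V} (hW : IsSubtree W) {v : V} (hv : v ∈ W) :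
    IsSubtree (below W v) where
  root := ⟨v, mem_below.2 ⟨hv, le_rfl⟩, fun _ hx => (mem_below.1 hx).2⟩
  convex := fun ha hb hak hkb => mem_below.2 ⟨hW.convex (mem_below.1 ha).1 (mem_below.1 hb).1 hak hkb,
    (mem_below.1 ha).2.trans hak⟩

theorem IsSubtree.above {W : Finset V} (hW : IsSubtree W) {u v : V} (hu : u ∈ W) (huv : u ⋖ v) :
    IsSubtree (above W v) where
  root := by
    obtain ⟨r, hr, hle⟩ := hW.root
    exact ⟨r, mem_above.2 ⟨hr, fun h => huv.lt.not_ge (h.trans (hle u hu))⟩,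
      fun x hx => hle x (mem_above.1 hx).1⟩
  convex := fun ha hb hak hkb => mem_above.2 ⟨hW.convex (mem_above.1 ha).1 (mem_above.1 hb).1 hak hkb,
    fun h => (mem_above.1 hb).2 (h.trans hkb)⟩

/-- The edge that is cut is the only one between the two parts. -/
theorem edgesIn_eq_insert [DecidableEq V] (hV : IsTreeOrder V) {W : Finset V} {u v : V}
    (hu : u ∈ W) (hv : v ∈ W) (huv : u ⋖ v) :
    edgesIn W = insert (u, v) (edgesIn (above W v) ∪ edgesIn (below W v)) := by
  ext ⟨a, b⟩
  simp only [mem_edgesIn, Finset.mem_insert, Finset.mem_union, mem_above, mem_below, Prod.mk.injEq]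
  constructor
  · rintro ⟨⟨ha, hb⟩, hab⟩
    by_cases hvb : v ≤ b
    · by_cases hva : v ≤ a
      · exact Or.inr (Or.inr ⟨⟨⟨ha, hva⟩, hb, hvb⟩, hab⟩)
      · rcases hvb.eq_or_lt with rfl | hlt
        · exact Or.inl ⟨hV.covBy_unique hab huv, rfl⟩
        · exact absurd (hV.le_of_lt_of_covBy hlt hab) hva
    · exact Or.inr (Or.inl ⟨⟨⟨ha, fun h => hvb (h.trans hab.le)⟩, hb, hvb⟩, hab⟩)
  · rintro (⟨rfl, rfl⟩ | ⟨⟨⟨ha, _⟩, hb, _⟩, hab⟩ | ⟨⟨⟨ha, _⟩, hb, _⟩, hab⟩)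
    · exact ⟨⟨hu, hv⟩, huv⟩
    · exact ⟨⟨ha, hb⟩, hab⟩
    · exact ⟨⟨ha, hb⟩, hab⟩

open scoped Classical in
/-- The pairs of vertices of `W` that are separated by some even separator, that is, whose
multidirectional path contains one. -/
noncomputable def goodPairs (d : ℕ) (W : Finset V) : Finset (V × V) :=
  (W ×ˢ W).filter fun p => ∃ e, IsEvenCut d W e ∧ ¬ (e.2 ≤ p.1 ↔ e.2 ≤ p.2)

theorem mem_goodPairs {d : ℕ} {W : Finset V} {i j : V} :
    (i, j) ∈ goodPairs d W ↔
      (i ∈ W ∧ j ∈ W) ∧ ∃ e, IsEvenCut d W e ∧ ¬ (e.2 ≤ i ↔ e.2 ≤ j) := by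
  simp [goodPairs]

theorem card_goodPairs_le (d : ℕ) (W : Finset V) : (goodPairs d W).card ≤ W.card ^ 2 := by
  classical
  refine (Finset.card_filter_le _ _).trans ?_
  rw [Finset.card_product, sq]

/-! ### The branches at a vertex -/

/-- `k` lies in the branch at `v` through the neighbour `x`: the component of `x` in the tree
without `v`. -/
def InBranch (v x k : V) : Prop := if v ≤ x then x ≤ k else ¬ v ≤ k

open scoped Classical in
/-- The number of vertices of `W` in the branch at `v` through the neighbour `x`. -/
noncomputable def branchSize (W : Finset V) (v x : V) : ℕ := (W.filter (InBranch v x)).card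

theorem inBranch_of_lt {v x k : V} (h : v < x) : InBranch v x k ↔ x ≤ k := by
  simp [InBranch, h.le]

theorem inBranch_of_gt {v x k : V} (h : x < v) : InBranch v x k ↔ ¬ v ≤ k := by
  simp [InBranch, h.not_ge]

theorem branchSize_mono {W W' : Finset V} (h : W' ⊆ W) (v x : V) :
    branchSize W' v x ≤ branchSize W v x := by
  classical
  exact Finset.card_le_card (Finset.filter_subset_filter _ h)

theorem branchSize_of_lt (W : Finset V) {v x : V} (h : v < x) :
    branchSize W v x = (below W x).card := by
  classical
  simp only [branchSize, below, inBranch_of_lt h]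

theorem branchSize_of_gt (W : Finset V) {v x : V} (h : x < v) :
    branchSize W v x = (above W v).card := by
  classical
  simp only [branchSize, above, inBranch_of_gt h]

theorem branchSize_add_of_cut {W : Finset V} (y v z : V) :
    branchSize (below W y) v z + branchSize (above W y) v z = branchSize W v z := by
  classical
  simp only [branchSize, below, above]
  rw [Finset.filter_comm, Finset.filter_comm (s := W) (p := fun x => ¬ y ≤ x)]
  exact Finset.card_filter_add_card_filter_not _

theorem branchSize_of_forall {Y : Finset V} {v x : V} (h : ∀ k ∈ Y, InBranch v x k) :
    branchSize Y v x = Y.card := by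
  classical
  rw [branchSize, Finset.filter_true_of_mem h]

variable [Fintype V]

theorem exists_inBranch (hV : IsTreeOrder V) {v k : V} (h : k ≠ v) :
    ∃ x ∈ nbrs v, InBranch v x k := by
  by_cases hk : v ≤ k
  · obtain ⟨x, hx, hxk⟩ := exists_covBy_le_of_lt (lt_of_le_of_ne hk h.symm)
    exact ⟨x, mem_nbrs.2 (Or.inr hx), (inBranch_of_lt hx.lt).2 hxk⟩
  · obtain ⟨r, hr⟩ := hV.root
    have hrv : r < v := lt_of_le_of_ne (hr v) fun h => hk (h ▸ hr k)
    obtain ⟨x, _, hx⟩ := exists_le_covBy_of_lt hrv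
    exact ⟨x, mem_nbrs.2 (Or.inl hx), (inBranch_of_gt hx.lt).2 hk⟩

theorem not_inBranch_self {v x : V} (hx : x ∈ nbrs v) : ¬ InBranch v x v := by
  rcases mem_nbrs.1 hx with hx | hx
  · simp [inBranch_of_gt hx.lt]
  · simpa [inBranch_of_lt hx.lt] using hx.lt.not_ge

theorem inBranch_unique (hV : IsTreeOrder V) {v x y k : V} (hx : x ∈ nbrs v) (hy : y ∈ nbrs v)
    (hxk : InBranch v x k) (hyk : InBranch v y k) : x = y := by
  rcases mem_nbrs.1 hx with hx | hx <;> rcases mem_nbrs.1 hy with hy | hy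
  · exact hV.covBy_unique hx hy
  · rw [inBranch_of_gt hx.lt] at hxk
    rw [inBranch_of_lt hy.lt] at hyk
    exact absurd (hy.le.trans hyk) hxk
  · rw [inBranch_of_lt hx.lt] at hxk
    rw [inBranch_of_gt hy.lt] at hyk
    exact absurd (hx.le.trans hxk) hyk
  · rw [inBranch_of_lt hx.lt] at hxk
    rw [inBranch_of_lt hy.lt] at hyk
    rcases hV.chain hxk hyk with h | h
    · rcases h.eq_or_lt with h | h
      · exact h
      · exact absurd h (hy.2 hx.lt)
    · rcases h.eq_or_lt with h | h
      · exact h.symm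
      · exact absurd h (hx.2 hy.lt)

/-- The branches at `v` partition the other vertices. -/
theorem sum_branchSize (hV : IsTreeOrder V) {W : Finset V} {v : V} (hv : v ∈ W) :
    ∑ x ∈ nbrs v, branchSize W v x + 1 = W.card := by
  classical
  rw [← Finset.card_erase_add_one hv]
  congr 1
  simp only [branchSize]
  rw [← Finset.card_biUnion]
  · congr 1
    ext k
    simp only [Finset.mem_biUnion, Finset.mem_filter, Finset.mem_erase]
    constructor
    · rintro ⟨x, hx, hk, hxk⟩
      exact ⟨fun h => not_inBranch_self hx (h ▸ hxk), hk⟩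
    · rintro ⟨hkv, hk⟩
      obtain ⟨x, hx, hxk⟩ := exists_inBranch hV hkv
      exact ⟨x, hx, hk, hxk⟩
  · intro x hx y hy hxy
    refine Finset.disjoint_left.2 fun k hk hk' => hxy ?_
    exact inBranch_unique hV hx hy (Finset.mem_filter.1 hk).2 (Finset.mem_filter.1 hk').2

/-- Every subtree has a centroid: a vertex all of whose branches have at most half the vertices. -/
theorem IsSubtree.exists_centroid {W : Finset V} (hW : IsSubtree W) :
    ∃ v ∈ W, ∀ x ∈ nbrs v, 2 * branchSize W v x ≤ W.card := by
  classical
  obtain ⟨r, hr, hle⟩ := hW.root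
  have hne : (W.filter fun v => W.card ≤ 2 * (TreeReconstruction.below W v).card).Nonempty := by
    refine ⟨r, Finset.mem_filter.2 ⟨hr, ?_⟩⟩
    have : TreeReconstruction.below W r = W := Finset.filter_true_of_mem hle
    rw [this]; omega
  -- a deepest vertex with at least half of the vertices below it
  obtain ⟨v, hv⟩ := Finset.exists_maximal hne
  obtain ⟨hvW, hvc⟩ := Finset.mem_filter.1 hv.prop
  refine ⟨v, hvW, fun x hx => ?_⟩
  rcases mem_nbrs.1 hx with hx | hx
  · rw [branchSize_of_gt _ hx.lt]
    have := card_below_add_card_above W v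
    omega
  · rw [branchSize_of_lt _ hx.lt]
    by_contra! hlt
    have hpos : 0 < (TreeReconstruction.below W x).card := by omega
    obtain ⟨k, hk⟩ := Finset.card_pos.1 hpos
    rw [mem_below] at hk
    have hxW : x ∈ W := hW.convex hvW hk.1 hx.le hk.2
    exact hx.lt.not_ge (hv.le_of_ge (Finset.mem_filter.2 ⟨hxW, by omega⟩) hx.le)

/-- A branch at `v` of at least `(|W| - 1) / d` and at most `|W| / 2` vertices is cut off by an
even separator. -/
theorem IsSubtree.exists_isEvenCut_of_branch (hV : IsTreeOrder V) {W : Finset V}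
    (hW : IsSubtree W) (h2 : 2 ≤ W.card) {d : ℕ} {v x : V} (hv : v ∈ W) (hx : x ∈ nbrs v)
    (hbig : W.card ≤ d * branchSize W v x + 1) (hhalf : 2 * branchSize W v x ≤ W.card) :
    ∃ e, IsEvenCut d W e ∧ ∀ i j, InBranch v x i → ¬ InBranch v x j → ¬ (e.2 ≤ i ↔ e.2 ≤ j) := by
  have hpos : 0 < branchSize W v x := by
    rcases Nat.eq_zero_or_pos (branchSize W v x) with h | h
    · rw [h] at hbig; omega
    · exact h
  rcases mem_nbrs.1 hx with hx | hx
  · rw [branchSize_of_gt _ hx.lt] at hbig hhalf hpos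
    obtain ⟨k, hk⟩ := Finset.card_pos.1 hpos
    rw [mem_above] at hk
    obtain ⟨r, hr, hle⟩ := hW.root
    have hrv : r < v := lt_of_le_of_ne (hle v hv) fun h => hk.2 (h ▸ hle k hk.1)
    have hxW : x ∈ W := hW.convex hr hv (hV.le_of_lt_of_covBy hrv hx) hx.le
    have hsum := card_below_add_card_above W v
    refine ⟨(x, v), ⟨hxW, hv, hx, ?_, hbig⟩, fun i j hi hj => ?_⟩
    · refine hbig.trans (Nat.add_le_add_right (Nat.mul_le_mul_left d ?_) 1)
      simp only; omega
    · rw [inBranch_of_gt hx.lt] at hi hj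
      tauto
  · rw [branchSize_of_lt _ hx.lt] at hbig hhalf hpos
    obtain ⟨k, hk⟩ := Finset.card_pos.1 hpos
    rw [mem_below] at hk
    have hxW : x ∈ W := hW.convex hv hk.1 hx.le hk.2
    have hsum := card_below_add_card_above W x
    refine ⟨(v, x), ⟨hv, hxW, hx, hbig, ?_⟩, fun i j hi hj => ?_⟩
    · refine hbig.trans (Nat.add_le_add_right (Nat.mul_le_mul_left d ?_) 1)
      simp only; omega
    · rw [inBranch_of_lt hx.lt] at hi hj
      tauto

/-- The neighbours of `v` through which the branch has at least `(|W| - 1) / d` vertices. -/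
noncomputable def bigNbrs (d : ℕ) (W : Finset V) (v : V) : Finset V :=
  (nbrs v).filter fun x => W.card ≤ d * branchSize W v x + 1

/-- The number of vertices of `W` in big branches at `v`. -/
noncomputable def bigMass (d : ℕ) (W : Finset V) (v : V) : ℕ :=
  ∑ x ∈ bigNbrs d W v, branchSize W v x

/-- The first vertex lies in a big branch at the centroid and the second one outside of it: all
these pairs are separated by an even separator. -/
theorem IsSubtree.bigMass_mul_card_le (hV : IsTreeOrder V) {W : Finset V}
    (hW : IsSubtree W) (h2 : 2 ≤ W.card) {d : ℕ} {v : V} (hv : v ∈ W)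
    (hhalf : ∀ x ∈ nbrs v, 2 * branchSize W v x ≤ W.card) :
    bigMass d W v * W.card ≤ 2 * (goodPairs d W).card := by
  classical
  have hsub : (bigNbrs d W v).biUnion (fun x => W.filter (InBranch v x) ×ˢ
      W.filter (fun k => ¬ InBranch v x k)) ⊆ goodPairs d W := by
    intro p hp
    obtain ⟨x, hx, hp⟩ := Finset.mem_biUnion.1 hp
    obtain ⟨hx, hbig⟩ := Finset.mem_filter.1 hx
    obtain ⟨h1, h2'⟩ := Finset.mem_product.1 hp
    rw [Finset.mem_filter] at h1 h2'
    obtain ⟨e, he, hsep⟩ := hW.exists_isEvenCut_of_branch hV h2 hv hx hbig (hhalf x hx)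
    exact mem_goodPairs.2 ⟨⟨h1.1, h2'.1⟩, e, he, hsep _ _ h1.2 h2'.2⟩
  have hcard := Finset.card_le_card hsub
  rw [Finset.card_biUnion] at hcard
  · refine le_trans ?_ (Nat.mul_le_mul_left 2 hcard)
    rw [bigMass, Finset.sum_mul, Finset.mul_sum]
    refine Finset.sum_le_sum fun x hx => ?_
    have hx' := hhalf x (Finset.mem_filter.1 hx).1
    rw [Finset.card_product]
    have hsum := Finset.card_filter_add_card_filter_not (s := W) (InBranch v x)
    change branchSize W v x + _ = _ at hsum
    change _ ≤ 2 * (branchSize W v x * _)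
    have : W.card ≤ 2 * (W.filter fun k => ¬ InBranch v x k).card := by omega
    nlinarith [Nat.mul_le_mul_left (branchSize W v x) this]
  · intro x hx y hy hxy
    refine Finset.disjoint_left.2 fun p hp hp' => hxy ?_
    have h1 := (Finset.mem_filter.1 (Finset.mem_product.1 hp).1).2
    have h2 := (Finset.mem_filter.1 (Finset.mem_product.1 hp').1).2
    exact inBranch_unique hV (Finset.mem_filter.1 hx).1 (Finset.mem_filter.1 hy).1 h1 h2

/-- Pigeonhole: one of the at most `d` branches at `v` has at least `(|W| - 1) / d` vertices. -/
theorem exists_mem_bigNbrs (hV : IsTreeOrder V) {W : Finset V} (h2 : 2 ≤ W.card) {d : ℕ} {v : V}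
    (hv : v ∈ W) (hd : (nbrs v).card ≤ d) : ∃ x, x ∈ bigNbrs d W v := by
  by_contra! h
  have hsum := sum_branchSize hV hv
  have hlt : ∀ x ∈ nbrs v, d * branchSize W v x + 1 < W.card := by
    intro x hx
    have := h x
    simp only [bigNbrs, Finset.mem_filter, not_and, not_le] at this
    exact this hx
  have hne : (nbrs v).Nonempty := by
    rw [Finset.nonempty_iff_ne_empty]
    intro h0
    rw [h0] at hsum
    simp at hsum
    omega
  have h1 : ∑ x ∈ nbrs v, d * branchSize W v x < ∑ _x ∈ nbrs v, (W.card - 1) :=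
    Finset.sum_lt_sum_of_nonempty hne fun x hx => by have := hlt x hx; omega
  rw [← Finset.mul_sum, Finset.sum_const, smul_eq_mul] at h1
  have h3 : ∑ x ∈ nbrs v, branchSize W v x = W.card - 1 := by omega
  rw [h3] at h1
  exact absurd (Nat.mul_le_mul_right (W.card - 1) hd) (not_le.2 h1)

/-- Of the two sides of an edge, one contains `v` and the other one lies in a single branch
at `v`. -/
theorem exists_branch_of_cut (hV : IsTreeOrder V) {W : Finset V} {v : V} (hv : v ∈ W) {u y : V}
    (huy : u ⋖ y) : ∃ x ∈ nbrs v,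
      (v ∈ above W y ∧ ∀ k ∈ below W y, InBranch v x k) ∨
      (v ∈ below W y ∧ ∀ k ∈ above W y, InBranch v x k) := by
  -- the part without `v` lies in the branch of the endpoint of the edge that it contains
  by_cases hyv : y ≤ v
  · obtain ⟨x, hx, hxu⟩ := exists_inBranch hV (v := v) (k := u) (huy.lt.trans_le hyv).ne
    have hxv : x < v := by
      rcases mem_nbrs.1 hx with hx | hx
      · exact hx.lt
      · rw [inBranch_of_lt hx.lt] at hxu
        exact absurd ((hxu.trans_lt huy.lt).trans_le hyv) hx.lt.not_gt
    refine ⟨x, hx, Or.inr ⟨mem_below.2 ⟨hv, hyv⟩, fun k hk => ?_⟩⟩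
    rw [inBranch_of_gt hxv]
    exact fun h => (mem_above.1 hk).2 (hyv.trans h)
  · obtain ⟨x, hx, hxy⟩ := exists_inBranch hV (v := v) (k := y) (fun h => hyv h.le)
    refine ⟨x, hx, Or.inl ⟨mem_above.2 ⟨hv, hyv⟩, fun k hk => ?_⟩⟩
    have hyk := (mem_below.1 hk).2
    rcases mem_nbrs.1 hx with hx | hx
    · rw [inBranch_of_gt hx.lt] at hxy ⊢
      intro hvk
      rcases hV.chain hyk hvk with h | h
      · exact hyv h
      · exact hxy h
    · rw [inBranch_of_lt hx.lt] at hxy ⊢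
      exact hxy.trans hyk

theorem branchSize_of_forall_of_ne (hV : IsTreeOrder V) {Y : Finset V} {v x z : V}
    (hx : x ∈ nbrs v) (hz : z ∈ nbrs v) (hzx : z ≠ x) (h : ∀ k ∈ Y, InBranch v x k) :
    branchSize Y v z = 0 := by
  classical
  rw [branchSize, Finset.card_eq_zero, Finset.filter_eq_empty_iff]
  exact fun k hk hzk => hzx (inBranch_unique hV hz hx hzk (h k hk))

end Order

/-! ### The order of a directed rooted tree -/

section Digraph

open Relation

variable {V : Type} {T : Digraph V}

theorem IsRootedTree.adj_unique (hT : IsRootedTree T) {u u' v : V} (h : T.Adj u v)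
    (h' : T.Adj u' v) : u = u' := by
  obtain ⟨r, hr, hp, _⟩ := hT
  have hv : v ≠ r := fun e => hr u (e ▸ h)
  exact (hp v hv).unique h h'

theorem IsRootedTree.not_transGen_self (hT : IsRootedTree T) (v : V) :
    ¬ TransGen T.Adj v v := by
  obtain ⟨r, hr, _, hreach⟩ := id hT
  have := hreach v
  induction this with
  | refl =>
    intro h
    obtain ⟨u, _, hu⟩ := TransGen.tail'_iff.1 h
    exact hr u hu
  | tail _ hbc ih =>
    intro h
    obtain ⟨u, hcu, huc⟩ := TransGen.tail'_iff.1 h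
    rw [hT.adj_unique huc hbc] at hcu
    exact ih (TransGen.head' hbc hcu)

/-- The vertices of a directed rooted tree, ordered by reachability. -/
abbrev IsRootedTree.partialOrder (hT : IsRootedTree T) : PartialOrder V where
  le := ReflTransGen T.Adj
  le_refl _ := ReflTransGen.refl
  le_trans _ _ _ := ReflTransGen.trans
  le_antisymm a b hab hba := by
    rcases reflTransGen_iff_eq_or_transGen.1 hab with h | h
    · exact h.symm
    · exact absurd (h.trans_left hba) (hT.not_transGen_self a)

theorem IsRootedTree.lt_iff (hT : IsRootedTree T) {a b : V} :
    hT.partialOrder.lt a b ↔ TransGen T.Adj a b := by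
  let _ := hT.partialOrder
  change a < b ↔ _
  rw [lt_iff_le_and_ne]
  change ReflTransGen T.Adj a b ∧ _ ↔ _
  constructor
  · rintro ⟨h, hne⟩
    rcases reflTransGen_iff_eq_or_transGen.1 h with h | h
    · exact absurd h.symm hne
    · exact h
  · intro h
    exact ⟨h.to_reflTransGen, fun e => hT.not_transGen_self a (by rwa [← e] at h)⟩

theorem IsRootedTree.isTreeOrder (hT : IsRootedTree T) : @IsTreeOrder V hT.partialOrder := by
  let _ := hT.partialOrder
  refine ⟨?_, ?_⟩
  · obtain ⟨r, _, _, h⟩ := hT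
    exact ⟨r, h⟩
  · intro a b c hac hbc
    have hU : Relator.RightUnique (Function.swap T.Adj) := fun _ _ _ h h' => hT.adj_unique h h'
    have h := ReflTransGen.total_of_right_unique hU (reflTransGen_swap.2 hac)
      (reflTransGen_swap.2 hbc)
    exact h.symm.imp reflTransGen_swap.1 reflTransGen_swap.1

theorem IsRootedTree.covBy_iff (hT : IsRootedTree T) {u v : V} :
    @CovBy V hT.partialOrder.toLT u v ↔ T.Adj u v := by
  let _ := hT.partialOrder
  change u ⋖ v ↔ _
  constructor
  · intro h
    obtain ⟨p, hup, hpv⟩ := TransGen.tail'_iff.1 (hT.lt_iff.1 h.lt)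
    rcases reflTransGen_iff_eq_or_transGen.1 hup with h' | h'
    · rwa [← h']
    · exact absurd (hT.lt_iff.2 (TransGen.single hpv)) (h.2 (hT.lt_iff.2 h'))
  · intro h
    refine ⟨hT.lt_iff.2 (TransGen.single h), fun k huk hkv => ?_⟩
    obtain ⟨p, hkp, hpv⟩ := TransGen.tail'_iff.1 (hT.lt_iff.1 hkv)
    rw [hT.adj_unique hpv h] at hkp
    exact absurd hkp (not_le_of_gt huk)

theorem IsRootedTree.card_nbrs_le [Fintype V] (hT : IsRootedTree T) (v : V) :
    (@nbrs V hT.partialOrder _ v).card ≤ degree T v := by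
  classical
  let _ := hT.partialOrder
  have : (nbrs v : Set V) = {u | T.Adj u v} ∪ {w | T.Adj v w} := by
    ext x
    simp only [Finset.mem_coe, mem_nbrs, Set.mem_union, Set.mem_ofPred_eq]
    exact or_congr hT.covBy_iff hT.covBy_iff
  rw [← Set.ncard_coe_finset, this]
  exact Set.ncard_union_le _ _

end Digraph

/-! ### A potential for cutting branches, and entropy -/

section Potential

variable {ι : Type}

/-- The total excess of the sizes `s` over the threshold `t`. -/
noncomputable def excess (N : Finset ι) (t : ℝ) (s : ι → ℝ) : ℝ := ∑ x ∈ N, max (s x - t) 0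

/-- The total deficit of the sizes `s` below the threshold `t`. -/
noncomputable def deficit (N : Finset ι) (t : ℝ) (s : ι → ℝ) : ℝ := ∑ x ∈ N, max (t - s x) 0

theorem excess_nonneg (N : Finset ι) (t : ℝ) (s : ι → ℝ) : 0 ≤ excess N t s :=
  Finset.sum_nonneg fun _ _ => le_max_right _ _

theorem deficit_nonneg (N : Finset ι) (t : ℝ) (s : ι → ℝ) : 0 ≤ deficit N t s :=
  Finset.sum_nonneg fun _ _ => le_max_right _ _

theorem excess_le_sum_filter (N : Finset ι) {θ t : ℝ} (hθ : 0 ≤ θ) (ht : θ ≤ t) (s : ι → ℝ) :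
    excess N t s ≤ ∑ x ∈ N with θ ≤ s x, s x := by
  rw [excess, Finset.sum_filter]
  refine Finset.sum_le_sum fun x _ => ?_
  split_ifs with h
  · exact max_le (by linarith) (by linarith)
  · exact max_le (by linarith) le_rfl

/-- If at most `d` sizes have average at least `θ`, the deficit of the sizes below a threshold
`t ≤ θ` is made up for by the sizes above `θ`. -/
theorem deficit_le_sum_filter (N : Finset ι) {d θ t : ℝ} (hθ : 0 ≤ θ) (ht : t ≤ θ) (s : ι → ℝ)
    (hN : (N.card : ℝ) ≤ d) (hsum : ∑ x ∈ N, s x = d * θ) :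
    deficit N t s ≤ ∑ x ∈ N with θ ≤ s x, s x := by
  have h1 : ∑ x ∈ N, (s x + max (t - s x) 0) ≤ ∑ x ∈ N, (θ + if θ ≤ s x then s x else 0) := by
    refine Finset.sum_le_sum fun x _ => ?_
    split_ifs with h
    · rw [max_eq_right (by linarith)]; linarith
    · rcases max_cases (t - s x) 0 with h' | h' <;> rw [h'.1] <;> linarith
  rw [Finset.sum_add_distrib, Finset.sum_add_distrib, Finset.sum_const, nsmul_eq_mul,
    ← Finset.sum_filter] at h1
  have h2 : (N.card : ℝ) * θ ≤ d * θ := mul_le_mul_of_nonneg_right hN hθ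
  rw [deficit]
  linarith

theorem excess_le_sum (N : Finset ι) {t : ℝ} (ht : 0 ≤ t) (s : ι → ℝ) (hs : ∀ x ∈ N, 0 ≤ s x) :
    excess N t s ≤ ∑ x ∈ N, s x :=
  Finset.sum_le_sum fun x hx => max_le (by linarith) (hs x hx)

theorem deficit_le (N : Finset ι) {t : ℝ} (ht : 0 ≤ t) (s : ι → ℝ) (hs : ∀ x ∈ N, 0 ≤ s x) :
    deficit N t s ≤ N.card * t := by
  rw [← nsmul_eq_mul]
  exact Finset.sum_le_card_nsmul _ _ _ fun x hx => max_le (by linarith [hs x hx]) ht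

/-- The potential that pays for the rounds during which the big branches at a fixed vertex are
cut down: it decreases when a branch far above the threshold `t` is cut, and also when a
branch near the threshold drops well below it. The deficit is measured from `3t/4`, because `t` is
the threshold for the initial set, and the threshold decreases as the set shrinks. -/
noncomputable def potential (N : Finset ι) (t : ℝ) (s : ι → ℝ) : ℝ :=
  Real.log (t + excess N t s) - Real.log (t + deficit N (3 / 4 * t) s)

theorem log_sub_log_ge {a b c : ℝ} (hb : 0 < b) (h : b + c ≤ a) (hc : 0 ≤ c) :
    c / a ≤ Real.log a - Real.log b := by
  have ha : 0 < a := by linarith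
  have := Real.log_le_sub_one_of_pos (div_pos hb ha)
  rw [Real.log_div hb.ne' ha.ne'] at this
  have h2 : c / a ≤ 1 - b / a := by
    rw [le_sub_iff_add_le, ← add_div, div_le_one ha]; linarith
  linarith

/-- Cutting a piece of size `y ≥ 3t/4` off a branch `x` decreases the potential by at least
`t / (16 b)`, where `b` is the mass of the big branches. -/
theorem potential_drop (N : Finset ι) {t b y : ℝ} (ht : 0 < t) {s s' : ι → ℝ} {x : ι} (hx : x ∈ N)
    (hs' : s' x = s x - y) (hne : ∀ z ∈ N, z ≠ x → s' z = s z) (hy : 3 / 4 * t ≤ y)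
    (hnn : 0 ≤ s' x) (hb : 3 / 4 * t ≤ b) (hbR : excess N t s ≤ b)
    (hbQ : deficit N (3 / 4 * t) s ≤ b) :
    t / (16 * b) ≤ potential N t s - potential N t s' := by
  classical
  have hR := excess_nonneg N t s
  have hR' := excess_nonneg N t s'
  have hQ := deficit_nonneg N (3 / 4 * t) s
  have hQ' := deficit_nonneg N (3 / 4 * t) s'
  have eR : excess N t s - excess N t s' = max (s x - t) 0 - max (s x - y - t) 0 := by
    rw [excess, excess, ← Finset.sum_sub_distrib, Finset.sum_eq_single_of_mem x hx, hs']
    intro z hz hzx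
    rw [hne z hz hzx, sub_self]
  have eQ : deficit N (3 / 4 * t) s' - deficit N (3 / 4 * t) s =
      max (3 / 4 * t - (s x - y)) 0 - max (3 / 4 * t - s x) 0 := by
    rw [deficit, deficit, ← Finset.sum_sub_distrib, Finset.sum_eq_single_of_mem x hx, hs']
    intro z hz hzx
    rw [hne z hz hzx, sub_self]
  rw [hs'] at hnn
  have hb0 : 0 < b := by linarith
  set R := excess N t s
  set R' := excess N t s'
  set Q := deficit N (3 / 4 * t) s
  set Q' := deficit N (3 / 4 * t) s'
  have hRR : R' ≤ R := by
    have : max (s x - y - t) 0 ≤ max (s x - t) 0 := max_le_max (by linarith) le_rfl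
    linarith
  have hQQ : Q ≤ Q' := by
    have : max (3 / 4 * t - s x) 0 ≤ max (3 / 4 * t - (s x - y)) 0 := max_le_max (by linarith) le_rfl
    linarith
  have hlogR : Real.log (t + R') ≤ Real.log (t + R) := Real.log_le_log (by linarith) (by linarith)
  have hlogQ : Real.log (t + Q) ≤ Real.log (t + Q') := Real.log_le_log (by linarith) (by linarith)
  have hfrac : ∀ D : ℝ, 0 < D → D ≤ 4 * b → t / (16 * b) ≤ (t / 4) / D := by
    intro D hD hDb
    rw [div_le_div_iff₀ (by linarith) hD]
    nlinarith
  unfold potential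
  -- a branch of size at least `5t/4` lowers the excess, a smaller one drops below `t/2`, which
  -- raises the deficit
  by_cases hcase : 5 / 4 * t ≤ s x
  · have h1 : R' + t / 4 ≤ R := by
      have : max (s x - y - t) 0 + t / 4 ≤ max (s x - t) 0 := by
        rw [max_eq_left (by linarith : (0 : ℝ) ≤ s x - t)]
        rcases max_cases (s x - y - t) 0 with h' | h' <;> rw [h'.1] <;> linarith
      linarith
    have h2 := log_sub_log_ge (a := t + R) (b := t + R') (c := t / 4) (by linarith) (by linarith)
      (by linarith)
    have h3 := hfrac (t + R) (by linarith) (by linarith)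
    linarith
  · have hsx : 3 / 4 * t ≤ s x := by linarith
    rw [max_eq_right (by linarith : 3 / 4 * t - s x ≤ 0),
      max_eq_left (by linarith : 0 ≤ 3 / 4 * t - (s x - y))] at eQ
    have h2 := log_sub_log_ge (a := t + Q') (b := t + Q) (c := t / 4) (by linarith) (by linarith)
      (by linarith)
    have h3 := hfrac (t + Q') (by linarith) (by linarith)
    linarith

theorem log_mul_one_add {t d : ℝ} (ht : 0 < t) (hd : 0 ≤ d) :
    Real.log (t + d * t) = Real.log t + Real.log (1 + d) := by
  rw [← Real.log_mul ht.ne' (by linarith)]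
  ring_nf

theorem potential_le (N : Finset ι) {t d : ℝ} (ht : 0 < t) (hd : 0 ≤ d) {s : ι → ℝ}
    (hs : ∀ x ∈ N, 0 ≤ s x) (hsum : ∑ x ∈ N, s x ≤ d * t) :
    potential N t s ≤ Real.log (1 + d) := by
  have h1 := excess_le_sum N ht.le s hs
  have h2 : Real.log (t + excess N t s) ≤ Real.log (t + d * t) :=
    Real.log_le_log (by linarith [excess_nonneg N t s]) (by linarith)
  have h3 : Real.log t ≤ Real.log (t + deficit N (3 / 4 * t) s) :=
    Real.log_le_log ht (by linarith [deficit_nonneg N (3 / 4 * t) s])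
  rw [log_mul_one_add ht hd] at h2
  unfold potential
  linarith

theorem neg_log_le_potential (N : Finset ι) {t d : ℝ} (ht : 0 < t) (hd : (N.card : ℝ) ≤ d)
    {s : ι → ℝ} (hs : ∀ x ∈ N, 0 ≤ s x) : - Real.log (1 + d) ≤ potential N t s := by
  have h0 : (0 : ℝ) ≤ N.card := Nat.cast_nonneg _
  have h1 := deficit_le N (by linarith : 0 ≤ 3 / 4 * t) s hs
  have h4 : (N.card : ℝ) * (3 / 4 * t) ≤ d * t := by nlinarith
  have h2 : Real.log (t + deficit N (3 / 4 * t) s) ≤ Real.log (t + d * t) :=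
    Real.log_le_log (by linarith [deficit_nonneg N (3 / 4 * t) s]) (by linarith)
  have h3 : Real.log t ≤ Real.log (t + excess N t s) :=
    Real.log_le_log ht (by linarith [excess_nonneg N t s])
  rw [log_mul_one_add ht (by linarith)] at h2
  unfold potential
  linarith

/-- A cut into two parts of at least `(x + y - 1) / d` each decreases `∑ x log x` by an amount of
order `(x + y) / d`. -/
theorem entropy_gain {x y d : ℝ} (hx : 1 ≤ x) (hy : 1 ≤ y) (hdx : x + y ≤ d * x + 1)
    (hdy : x + y ≤ d * y + 1) :
    128 * (x + y) + 3000 * d * (x * Real.log x) + 3000 * d * (y * Real.log y) ≤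
      3000 * d * ((x + y) * Real.log (x + y)) := by
  wlog hxy : x ≤ y generalizing x y
  · have := this hy hx (by linarith) (by linarith) (by linarith)
    rw [add_comm y x] at this
    linarith
  have hd : 0 ≤ d := by
    by_contra! h
    nlinarith
  have h1 : Real.log y ≤ Real.log (x + y) := Real.log_le_log (by linarith) (by linarith)
  have h2 : Real.log x + Real.log 2 ≤ Real.log (x + y) := by
    rw [← Real.log_mul (by linarith) two_ne_zero]
    exact Real.log_le_log (by linarith) (by linarith)
  have h3 := Real.log_two_gt_d9
  have h4 : y * Real.log y ≤ y * Real.log (x + y) := mul_le_mul_of_nonneg_left h1 (by linarith)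
  have h5 : x * (Real.log x + 1 / 2) ≤ x * Real.log (x + y) :=
    mul_le_mul_of_nonneg_left (by linarith) (by linarith)
  have h6 : x * Real.log x + y * Real.log y + x / 2 ≤ (x + y) * Real.log (x + y) := by linarith
  have h7 := mul_le_mul_of_nonneg_left h6 hd
  have h8 : (x + y) / 2 ≤ d * x := by linarith
  nlinarith

end Potential

/-! ### The total cost of cutting a tree at even separators -/

section CutCost

variable {V : Type} [PartialOrder V] [DecidableLE V]

/-- The total cost of cutting `W` into single vertices, at the worst choice of even separators:
a set of `w` vertices costs `w` for each of the expected number `w² / |goodPairs d W|` of rounds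
that find an even separator. -/
noncomputable def cutCost (d : ℕ) (W : Finset V) : ℝ≥0∞ :=
  if 2 ≤ W.card then
    (W.card : ℝ≥0∞) ^ 3 / (goodPairs d W).card +
      ⨆ e : {e : V × V // IsEvenCut d W e},
        (cutCost d (below W e.1.2) + cutCost d (above W e.1.2))
  else 0
termination_by W.card
decreasing_by
  · exact e.2.card_below_lt
  · exact e.2.card_above_lt

theorem cutCost_of_card_le_one {d : ℕ} {W : Finset V} (h : W.card ≤ 1) : cutCost d W = 0 := by
  rw [cutCost, if_neg (by omega)]

theorem cutCost_add_le {d : ℕ} {W : Finset V} (h2 : 2 ≤ W.card) {e : V × V}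
    (he : IsEvenCut d W e) :
    (W.card : ℝ≥0∞) ^ 3 / (goodPairs d W).card +
      (cutCost d (below W e.2) + cutCost d (above W e.2)) ≤ cutCost d W := by
  rw [cutCost.eq_1 d W, if_pos h2]
  exact add_le_add_right (le_iSup (fun e : {e : V × V // IsEvenCut d W e} =>
    cutCost d (below W e.1.2) + cutCost d (above W e.1.2)) ⟨e, he⟩) _

theorem cutCost_le {d : ℕ} {W : Finset V} (h2 : 2 ≤ W.card) {κ c : ℝ} (hκ : 0 ≤ κ)
    (hgood : (W.card : ℝ) ^ 3 ≤ κ * (goodPairs d W).card)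
    (h : ∀ e, IsEvenCut d W e → ∃ a b : ℝ, 0 ≤ a ∧ 0 ≤ b ∧
      cutCost d (below W e.2) ≤ ENNReal.ofReal a ∧ cutCost d (above W e.2) ≤ ENNReal.ofReal b ∧
      κ + a + b ≤ c) : cutCost d W ≤ ENNReal.ofReal c := by
  have hw : (2 : ℝ) ≤ W.card := by exact_mod_cast h2
  have hpos : 0 < (goodPairs d W).card := by
    rcases Nat.eq_zero_or_pos (goodPairs d W).card with h0 | h0
    · rw [h0] at hgood
      have : (0 : ℝ) < (W.card : ℝ) ^ 3 := by positivity
      simp at hgood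
      linarith
    · exact h0
  have hκc : κ ≤ c := by
    obtain ⟨⟨i, j⟩, hij⟩ := Finset.card_pos.1 hpos
    obtain ⟨_, e, he, _⟩ := mem_goodPairs.1 hij
    obtain ⟨a, b, ha, hb, _, _, h⟩ := h e he
    linarith
  rw [cutCost, if_pos h2]
  have h1 : (W.card : ℝ≥0∞) ^ 3 / (goodPairs d W).card ≤ ENNReal.ofReal κ := by
    refine ENNReal.div_le_of_le_mul ?_
    rw [← ENNReal.ofReal_natCast, ← ENNReal.ofReal_natCast, ← ENNReal.ofReal_pow (by positivity),
      ← ENNReal.ofReal_mul hκ]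
    exact ENNReal.ofReal_le_ofReal hgood
  have h3 : ⨆ e : {e : V × V // IsEvenCut d W e},
      (cutCost d (below W e.1.2) + cutCost d (above W e.1.2)) ≤ ENNReal.ofReal (c - κ) := by
    refine iSup_le fun e => ?_
    obtain ⟨a, b, ha, hb, h1, h2, h⟩ := h e.1 e.2
    refine (add_le_add h1 h2).trans ?_
    rw [← ENNReal.ofReal_add ha hb]
    exact ENNReal.ofReal_le_ofReal (by linarith)
  refine (add_le_add h1 h3).trans ?_
  rw [← ENNReal.ofReal_add hκ (by linarith)]
  exact ENNReal.ofReal_le_ofReal (by linarith)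

variable [Fintype V]

theorem sum_branchSize_real (hV : IsTreeOrder V) {W : Finset V} {v : V} (hv : v ∈ W) :
    ∑ x ∈ nbrs v, (branchSize W v x : ℝ) = W.card - 1 := by
  have := sum_branchSize hV hv
  rw [← this]; push_cast; ring

/-- The mass of `W` in the branches at `v` that are small with respect to `W₀`. -/
noncomputable def smallMass (d : ℕ) (W₀ W : Finset V) (v : V) : ℕ :=
  ∑ x ∈ nbrs v with ¬ W₀.card ≤ d * branchSize W₀ v x + 1, branchSize W v x

theorem smallMass_add_bigMass (hV : IsTreeOrder V) (d : ℕ) {W : Finset V} {v : V} (hv : v ∈ W) :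
    smallMass d W W v + bigMass d W v + 1 = W.card := by
  rw [smallMass, bigMass, bigNbrs, add_comm (∑ x ∈ _, _), Finset.sum_filter_add_sum_filter_not,
    sum_branchSize hV hv]

theorem smallMass_le_card (hV : IsTreeOrder V) (d : ℕ) (W₀ : Finset V) {W : Finset V} {v : V}
    (hv : v ∈ W) : smallMass d W₀ W v ≤ W.card := by
  have : smallMass d W₀ W v ≤ ∑ x ∈ nbrs v, branchSize W v x :=
    Finset.sum_le_sum_of_subset (Finset.filter_subset _ _)
  have := sum_branchSize hV hv
  omega

/-- The mass of the big branches in terms of real thresholds. -/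
theorem bigMass_eq_sum_filter {d : ℕ} (hd : 0 < d) (W : Finset V) (v : V) :
    (bigMass d W v : ℝ) =
      ∑ x ∈ nbrs v with ((W.card : ℝ) - 1) / d ≤ (branchSize W v x : ℝ),
        (branchSize W v x : ℝ) := by
  rw [bigMass, bigNbrs, Nat.cast_sum]
  refine Finset.sum_congr (Finset.filter_congr fun x _ => ?_) fun _ _ => rfl
  rw [div_le_iff₀ (by exact_mod_cast hd), sub_le_iff_le_add, mul_comm]
  exact_mod_cast Iff.rfl

/-- The bound on `cutCost d W` for the subtrees `W` that contain the centroid `v` of `W₀`: the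
potential pays for the rounds spent on such sets, and each piece cut off a small branch lowers
the remaining cost, because its vertices leave a set of at least `d` times its size. The term
`7 / 8 * W₀.card` makes the bound hold once fewer than that many vertices are left. -/
noncomputable def chainBound (d : ℕ) (W₀ W : Finset V) (v : V) : ℝ :=
  64 * d * W₀.card *
      (potential (nbrs v) ((W₀.card - 1) / d) (fun x => (branchSize W v x : ℝ)) +
        Real.log (1 + d)) +
    3000 * d * (W.card * Real.log W₀.card -
      Real.log d * (smallMass d W₀ W v - 7 / 8 * W₀.card))

/-- The effect of cutting a piece `Y` off `W` inside the branch at `v` through `x`. -/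
theorem chainBound_cut (hV : IsTreeOrder V) {d : ℕ} (hdeg : ∀ v : V, (nbrs v).card ≤ d)
    {W₀ W Y W' : Finset V} {v x : V} (hv : v ∈ W) (hWW₀ : W ⊆ W₀) (hw₀ : 65 ≤ W₀.card)
    (hlarge : 7 * W₀.card < 8 * W.card) (hd : 2 ≤ d)
    (hx : x ∈ nbrs v) (hY : ∀ k ∈ Y, InBranch v x k) (hYcard : W.card ≤ d * Y.card + 1)
    (hsize : ∀ z, branchSize Y v z + branchSize W' v z = branchSize W v z)
    (hcard : Y.card + W'.card = W.card) :
    2 * (W.card : ℝ) ^ 2 / bigMass d W v + 3000 * d * (Y.card * Real.log Y.card) +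
      chainBound d W₀ W' v ≤ chainBound d W₀ W v := by
  classical
  have hv₀ := hWW₀ hv
  set w₀ : ℝ := ((W₀.card : ℕ) : ℝ) with hw₀def
  set w : ℝ := ((W.card : ℕ) : ℝ) with hwdef
  set y : ℝ := ((Y.card : ℕ) : ℝ) with hydef
  have hdR : (2 : ℝ) ≤ d := by exact_mod_cast hd
  have hd0 : (0 : ℝ) < d := by linarith
  have hw₀R : 65 ≤ w₀ := by rw [hw₀def]; exact_mod_cast hw₀
  have hlargeR : 7 * w₀ < 8 * w := by rw [hw₀def, hwdef]; exact_mod_cast hlarge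
  have hww₀ : w ≤ w₀ := by rw [hw₀def, hwdef]; exact_mod_cast Finset.card_le_card hWW₀
  have hYR : w ≤ d * y + 1 := by rw [hydef, hwdef]; exact_mod_cast hYcard
  set t : ℝ := (w₀ - 1) / d with ht
  set θ : ℝ := (w - 1) / d with hθ
  have htd : d * t = w₀ - 1 := by rw [ht]; field_simp
  have hθd : d * θ = w - 1 := by rw [hθ]; field_simp
  have ht0 : 0 < t := by rw [ht]; apply div_pos <;> linarith
  have hθt : θ ≤ t := by
    rw [hθ, ht]; exact div_le_div_of_nonneg_right (by linarith) hd0.le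
  have htθ : 3 / 4 * t ≤ θ := by
    refine le_of_mul_le_mul_left ?_ hd0
    linarith
  have hyθ : θ ≤ y := by
    refine le_of_mul_le_mul_left ?_ hd0
    linarith
  have hYx : branchSize Y v x = Y.card := branchSize_of_forall hY
  have hYz : ∀ z ∈ nbrs v, z ≠ x → branchSize Y v z = 0 := fun z hz hzx =>
    branchSize_of_forall_of_ne hV hx hz hzx hY
  have hsum := sum_branchSize_real hV hv
  rw [← hwdef, ← hθd] at hsum
  have hN : ((nbrs v).card : ℝ) ≤ d := by exact_mod_cast hdeg v
  have hb := bigMass_eq_sum_filter (d := d) (by omega) W v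
  rw [← hwdef, ← hθ] at hb
  set b : ℝ := ((bigMass d W v : ℕ) : ℝ) with hbdef
  have hsx : θ ≤ branchSize W v x := by
    have : (Y.card : ℝ) ≤ branchSize W v x := by
      rw [← hYx]
      have := hsize x
      exact_mod_cast (by omega : branchSize Y v x ≤ branchSize W v x)
    linarith
  have hθ0 : 0 ≤ θ := by linarith
  have hbθ : θ ≤ b := by
    rw [hb]
    refine hsx.trans (Finset.single_le_sum (f := fun x => (branchSize W v x : ℝ))
      (fun z _ => Nat.cast_nonneg _) (Finset.mem_filter.2 ⟨hx, hsx⟩))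
  have hbR : excess (nbrs v) t (fun x => (branchSize W v x : ℝ)) ≤ b := by
    rw [hb]; exact excess_le_sum_filter _ hθ0 hθt _
  have hbQ : deficit (nbrs v) (3 / 4 * t) (fun x => (branchSize W v x : ℝ)) ≤ b := by
    rw [hb]; exact deficit_le_sum_filter _ hθ0 htθ _ hN hsum
  have hb0 : 0 < b := by linarith
  have hdrop := potential_drop (nbrs v) (t := t) (b := b) (y := y) ht0
    (s := fun x => (branchSize W v x : ℝ)) (s' := fun x => (branchSize W' v x : ℝ)) hx
    (by
      have := hsize x
      rw [hYx] at this
      simp only [hydef]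
      rw [← this]; push_cast; ring)
    (by
      intro z hz hzx
      have := hsize z
      rw [hYz z hz hzx, zero_add] at this
      simp only [this])
    (by linarith) (Nat.cast_nonneg _) (by linarith) hbR hbQ
  -- the potential pays for the rounds
  have hpay : 2 * w ^ 2 / b ≤ 64 * d * w₀ *
      (potential (nbrs v) t (fun x => (branchSize W v x : ℝ)) -
        potential (nbrs v) t (fun x => (branchSize W' v x : ℝ))) := by
    refine le_trans ?_ (mul_le_mul_of_nonneg_left hdrop (by positivity))
    have : 64 * d * w₀ * (t / (16 * b)) = 4 * w₀ * (d * t) / b := by field_simp; norm_num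
    rw [this, htd]
    refine div_le_div_of_nonneg_right ?_ hb0.le
    nlinarith
  -- the entropy of the piece that is cut off
  have hy1 : 1 ≤ y := by
    have : 0 < y := by linarith
    rw [hydef] at this ⊢
    exact_mod_cast (Nat.cast_pos.1 this)
  have hyw : y ≤ w := by
    rw [hydef, hwdef]; exact_mod_cast (by omega : Y.card ≤ W.card)
  have hent : y * Real.log y ≤ y * Real.log w₀ -
      Real.log d * ((smallMass d W₀ W v : ℝ) - smallMass d W₀ W' v) := by
    have hdiff : (smallMass d W₀ W v : ℝ) - smallMass d W₀ W' v =
        ∑ z ∈ nbrs v with ¬ W₀.card ≤ d * branchSize W₀ v z + 1, (branchSize Y v z : ℝ) := by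
      rw [smallMass, smallMass, Nat.cast_sum, Nat.cast_sum, ← Finset.sum_sub_distrib]
      refine Finset.sum_congr rfl fun z _ => ?_
      rw [← hsize z]; push_cast; ring
    rw [hdiff]
    by_cases hxs : x ∈ (nbrs v).filter fun z => ¬ W₀.card ≤ d * branchSize W₀ v z + 1
    · rw [Finset.sum_eq_single_of_mem x hxs, hYx, ← hydef]
      · have hsmall : d * branchSize W₀ v x + 1 < W₀.card := by
          exact not_le.1 (Finset.mem_filter.1 hxs).2
        have hle : Y.card ≤ branchSize W₀ v x := by
          rw [← hYx]
          exact (by have := hsize x; omega : branchSize Y v x ≤ branchSize W v x).trans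
            (branchSize_mono hWW₀ v x)
        have hdy : (d : ℝ) * y ≤ w₀ := by
          rw [hydef, hw₀def]
          have := Nat.mul_le_mul_left d hle
          exact_mod_cast (by omega : d * Y.card ≤ W₀.card)
        have hlog : Real.log d + Real.log y ≤ Real.log w₀ := by
          rw [← Real.log_mul hd0.ne' (by linarith)]
          exact Real.log_le_log (by positivity) hdy
        nlinarith
      · intro z hz hzx
        rw [hYz z (Finset.mem_filter.1 hz).1 hzx, Nat.cast_zero]
    · rw [Finset.sum_eq_zero, mul_zero, sub_zero]
      · exact mul_le_mul_of_nonneg_left (Real.log_le_log (by linarith) (by linarith)) (by linarith)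
      · intro z hz
        rw [hYz z (Finset.mem_filter.1 hz).1 (fun h => hxs (h ▸ hz)), Nat.cast_zero]
  have hcardR : y + (W'.card : ℝ) = w := by rw [hydef, hwdef]; exact_mod_cast hcard
  have hent' := mul_le_mul_of_nonneg_left hent (by positivity : (0 : ℝ) ≤ 3000 * d)
  unfold chainBound
  rw [← hw₀def, ← ht]
  have e1 : (W'.card : ℝ) = w - y := by linarith
  rw [← hwdef, e1]
  linarith

theorem cutCost_le_chainBound (hV : IsTreeOrder V) {d : ℕ} (hdeg : ∀ v : V, (nbrs v).card ≤ d)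
    {W₀ : Finset V} {v : V} (hw₀ : 65 ≤ W₀.card) (hd2 : 4 ≤ d) (hdw₀ : d ≤ W₀.card)
    (hhalf : ∀ x ∈ nbrs v, 4 * branchSize W₀ v x ≤ W₀.card)
    (ih : ∀ W : Finset V, IsSubtree W → W.card < W₀.card →
      cutCost d W ≤ ENNReal.ofReal (3000 * d * (W.card * Real.log W.card))) :
    ∀ W : Finset V, IsSubtree W → v ∈ W → W ⊆ W₀ →
      cutCost d W ≤ ENNReal.ofReal (chainBound d W₀ W v) := by
  have hd0 : (0 : ℝ) < d := by exact_mod_cast (by omega : 0 < d)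
  have hlogd : 0 ≤ Real.log d := Real.log_natCast_nonneg d
  have hw₀R : (65 : ℝ) ≤ W₀.card := by exact_mod_cast hw₀
  have hpot : ∀ W : Finset V, 0 ≤
      64 * d * W₀.card *
      (potential (nbrs v) (((W₀.card : ℝ) - 1) / d) (fun x => (branchSize W v x : ℝ)) +
        Real.log (1 + d)) := by
    intro W
    have := neg_log_le_potential (nbrs v) (t := ((W₀.card : ℝ) - 1) / d) (d := d)
      (div_pos (by linarith) hd0) (by exact_mod_cast hdeg v)
      (s := fun x => (branchSize W v x : ℝ)) (fun x _ => Nat.cast_nonneg _)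
    exact mul_nonneg (by positivity) (by linarith)
  have hnonneg : ∀ W : Finset V, v ∈ W → 0 ≤ chainBound d W₀ W v := by
    intro W hv
    refine add_nonneg (hpot W) (mul_nonneg (by positivity) ?_)
    have h1 : (smallMass d W₀ W v : ℝ) ≤ W.card := by exact_mod_cast smallMass_le_card hV d W₀ hv
    have h2 : Real.log d ≤ Real.log W₀.card := Real.log_le_log hd0 (by exact_mod_cast hdw₀)
    have h3 : Real.log d * smallMass d W₀ W v ≤ Real.log W₀.card * W.card :=
      mul_le_mul h2 h1 (Nat.cast_nonneg _) (by linarith)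
    nlinarith [mul_nonneg hlogd (by linarith : (0 : ℝ) ≤ 7 / 8 * W₀.card)]
  intro W
  induction hn : W.card using Nat.strong_induction_on generalizing W with
  | _ n ihn =>
  intro hW hv hWW₀
  subst hn
  have hcardle := Finset.card_le_card hWW₀
  by_cases hlarge : 7 * W₀.card < 8 * W.card
  · obtain ⟨x₀, hx₀⟩ := exists_mem_bigNbrs hV (by omega : 2 ≤ W.card) hv (hdeg v)
    have hx₀' := Finset.mem_filter.1 hx₀
    have hbpos : 0 < bigMass d W v := by
      have h1 : branchSize W v x₀ ≤ bigMass d W v :=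
        Finset.single_le_sum (f := fun x => branchSize W v x) (fun _ _ => Nat.zero_le _) hx₀
      rcases Nat.eq_zero_or_pos (branchSize W v x₀) with h | h
      · rw [h] at hx₀'; omega
      · omega
    have hbposR : (0 : ℝ) < bigMass d W v := by exact_mod_cast hbpos
    have hgood := hW.bigMass_mul_card_le hV (by omega) (d := d) hv (fun x hx => by
      have := hhalf x hx
      have := branchSize_mono hWW₀ v x
      omega)
    have hgoodR : (bigMass d W v : ℝ) * W.card ≤ 2 * (goodPairs d W).card := by
      exact_mod_cast hgood
    refine cutCost_le (κ := 2 * (W.card : ℝ) ^ 2 / bigMass d W v) (by omega) (by positivity) ?_ ?_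
    · rw [div_mul_eq_mul_div, le_div_iff₀ hbposR]
      nlinarith [mul_le_mul_of_nonneg_left hgoodR (sq_nonneg (W.card : ℝ))]
    · intro e he
      obtain ⟨x, hx, hcase⟩ := exists_branch_of_cut hV hv he.covBy
      have hsum := card_below_add_card_above W e.2
      have hnn : ∀ Y : Finset V, (0 : ℝ) ≤ 3000 * d * (Y.card * Real.log Y.card) := fun Y =>
        mul_nonneg (by positivity) (mul_nonneg (by positivity) (Real.log_natCast_nonneg _))
      have hlt1 := he.card_below_lt
      have hlt2 := he.card_above_lt
      have hW1 := hW.below he.snd_mem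
      have hW2 := hW.above he.fst_mem he.covBy
      rcases hcase with ⟨hva, hY⟩ | ⟨hvb, hY⟩
      · refine ⟨_, _, hnn _, hnonneg _ hva, ih _ hW1 (by omega),
          ihn _ hlt2 _ rfl hW2 hva ((above_subset _ _).trans hWW₀), ?_⟩
        exact chainBound_cut hV hdeg hv hWW₀ hw₀ hlarge (by omega) hx hY he.card_le_below
          (branchSize_add_of_cut e.2 v) hsum
      · refine ⟨_, _, hnonneg _ hvb, hnn _,
          ihn _ hlt1 _ rfl hW1 hvb ((below_subset _ _).trans hWW₀), ih _ hW2 (by omega), ?_⟩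
        rw [add_right_comm]
        exact chainBound_cut hV hdeg hv hWW₀ hw₀ hlarge (by omega) hx hY he.card_le_above
          (fun z => by rw [add_comm, branchSize_add_of_cut]) (by omega)
  · -- the part with `v` has become small: the potential is no longer needed
    refine (ih W hW (by omega)).trans (ENNReal.ofReal_le_ofReal ?_)
    have hwpos : 0 < W.card := Finset.card_pos.2 ⟨v, hv⟩
    have h1 : (smallMass d W₀ W v : ℝ) ≤ W.card := by exact_mod_cast smallMass_le_card hV d W₀ hv
    have h2 : Real.log W.card ≤ Real.log W₀.card :=
      Real.log_le_log (by exact_mod_cast hwpos) (by exact_mod_cast hcardle)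
    have h3 : (8 : ℝ) * W.card ≤ 7 * W₀.card := by exact_mod_cast not_lt.1 hlarge
    have h4 : Real.log d * ((smallMass d W₀ W v : ℝ) - 7 / 8 * W₀.card) ≤ 0 :=
      mul_nonpos_of_nonneg_of_nonpos hlogd (by linarith)
    have h5 : (W.card : ℝ) * Real.log W.card ≤ W.card * Real.log W₀.card :=
      mul_le_mul_of_nonneg_left h2 (Nat.cast_nonneg _)
    refine le_trans (mul_le_mul_of_nonneg_left ?_ (by positivity)) (le_add_of_nonneg_left (hpot W))
    linarith

/-- The amortized bound for cutting a tree into single vertices at even separators. -/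
theorem cutCost_le_mul_log (hV : IsTreeOrder V) {d : ℕ} (hdeg : ∀ v : V, (nbrs v).card ≤ d)
    (W : Finset V) (hW : IsSubtree W) :
    cutCost d W ≤ ENNReal.ofReal (3000 * d * (W.card * Real.log W.card)) := by
  classical
  induction hn : W.card using Nat.strong_induction_on generalizing W with
  | _ n ihn =>
  subst hn
  rcases Nat.lt_or_ge W.card 2 with h2 | h2
  · rw [cutCost_of_card_le_one (by omega)]; exact zero_le
  obtain ⟨v, hv, hhalf⟩ := hW.exists_centroid
  have hgood := hW.bigMass_mul_card_le hV h2 (d := d) hv hhalf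
  have hgoodR : (bigMass d W v : ℝ) * W.card ≤ 2 * (goodPairs d W).card := by
    exact_mod_cast hgood
  by_cases hhigh : W.card ≤ 64 * bigMass d W v
  · -- a constant fraction of the pairs is good, and the entropy pays for the rounds
    have hhighR : (W.card : ℝ) ≤ 64 * bigMass d W v := by exact_mod_cast hhigh
    refine cutCost_le (κ := 128 * W.card) h2 (by positivity) ?_ ?_
    · have h1 : (W.card : ℝ) * W.card ≤ 128 * (goodPairs d W).card := by nlinarith
      nlinarith
    · intro e he
      have hsum := card_below_add_card_above W e.2
      have hlt1 := he.card_below_lt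
      have hlt2 := he.card_above_lt
      have hnn : ∀ Y : Finset V, (0 : ℝ) ≤ 3000 * d * (Y.card * Real.log Y.card) := fun Y =>
        mul_nonneg (by positivity) (mul_nonneg (by positivity) (Real.log_natCast_nonneg _))
      refine ⟨_, _, hnn _, hnn _, ihn _ hlt1 _ (hW.below he.snd_mem) rfl,
        ihn _ hlt2 _ (hW.above he.fst_mem he.covBy) rfl, ?_⟩
      have hsumR : ((below W e.2).card : ℝ) + (above W e.2).card = W.card := by
        exact_mod_cast hsum
      rw [← hsumR]
      refine entropy_gain ?_ ?_ ?_ ?_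
      · exact_mod_cast Finset.card_pos.2 ⟨_, he.snd_mem_below⟩
      · exact_mod_cast Finset.card_pos.2 ⟨_, he.fst_mem_above⟩
      · rw [hsumR]; exact_mod_cast he.card_le_below
      · rw [hsumR]; exact_mod_cast he.card_le_above
  · rw [not_le] at hhigh
    -- the big branches have little mass, so there are many branches of about `|W| / d` vertices
    obtain ⟨x₀, hx₀⟩ := exists_mem_bigNbrs hV h2 hv (hdeg v)
    have hx₀' := Finset.mem_filter.1 hx₀
    have hb1 : ∀ x ∈ bigNbrs d W v, branchSize W v x ≤ bigMass d W v := fun x hx =>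
      Finset.single_le_sum (f := fun x => branchSize W v x) (fun _ _ => Nat.zero_le _) hx
    have hb := hb1 x₀ hx₀
    have hdb : W.card ≤ d * bigMass d W v + 1 :=
      hx₀'.2.trans (Nat.add_le_add_right (Nat.mul_le_mul_left d hb) 1)
    have hbpos : 1 ≤ bigMass d W v := by
      rcases Nat.eq_zero_or_pos (bigMass d W v) with h | h
      · rw [h] at hdb; omega
      · exact h
    have hd32 : 32 ≤ d := by
      by_contra! h
      have : d * bigMass d W v ≤ 31 * bigMass d W v := Nat.mul_le_mul_right _ (by omega)
      omega
    have hsb := smallMass_add_bigMass hV d hv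
    have hdw : d ≤ W.card := by
      by_contra! h
      have : smallMass d W W v = 0 := by
        rw [smallMass]
        refine Finset.sum_eq_zero fun x hx => ?_
        by_contra h0
        refine (Finset.mem_filter.1 hx).2 ?_
        have := Nat.le_mul_of_pos_right d (Nat.pos_of_ne_zero h0)
        omega
      omega
    have hquarter : ∀ x ∈ nbrs v, 4 * branchSize W v x ≤ W.card := by
      intro x hx
      by_cases hxb : x ∈ bigNbrs d W v
      · have := hb1 x hxb
        omega
      · have h1 : d * branchSize W v x + 1 < W.card := by
          simp only [bigNbrs, Finset.mem_filter, not_and, not_le] at hxb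
          exact hxb hx
        have := Nat.mul_le_mul_right (branchSize W v x) hd32
        omega
    refine (cutCost_le_chainBound hV hdeg (by omega) (by omega) hdw hquarter
      (fun W' hW' hlt => ihn _ hlt W' hW' rfl) W hW hv subset_rfl).trans
      (ENNReal.ofReal_le_ofReal ?_)
    have hd32R : (32 : ℝ) ≤ d := by exact_mod_cast hd32
    have hw : (65 : ℝ) ≤ W.card := by exact_mod_cast (by omega : 65 ≤ W.card)
    have htd : (d : ℝ) * ((W.card - 1) / d) = W.card - 1 := by field_simp
    have hpot := potential_le (nbrs v) (t := ((W.card : ℝ) - 1) / d) (d := d)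
      (div_pos (by linarith) (by linarith)) (by linarith)
      (s := fun x => (branchSize W v x : ℝ)) (fun x _ => Nat.cast_nonneg _)
      (by rw [sum_branchSize_real hV hv, htd])
    have hlog : Real.log (1 + d) ≤ 2 * Real.log d := by
      rw [← Real.log_rpow (by linarith) 2]
      refine Real.log_le_log (by linarith) ?_
      rw [Real.rpow_two]
      nlinarith
    have hlogd : 0 ≤ Real.log d := Real.log_natCast_nonneg d
    have hsbR : (smallMass d W W v : ℝ) + bigMass d W v + 1 = W.card := by exact_mod_cast hsb
    have hhighR : 64 * (bigMass d W v : ℝ) < W.card := by exact_mod_cast hhigh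
    -- all but a thirty-second of the vertices are in small branches, and only an eighth may leave
    have hgain : 3 / 32 * (W.card : ℝ) ≤ smallMass d W W v - 7 / 8 * W.card := by linarith
    have h1 : Real.log d * (3 / 32 * (W.card : ℝ)) ≤
        Real.log d * (smallMass d W W v - 7 / 8 * W.card) :=
      mul_le_mul_of_nonneg_left hgain hlogd
    have h2 : 64 * (d : ℝ) * W.card * (potential (nbrs v) (((W.card : ℝ) - 1) / d)
        (fun x => (branchSize W v x : ℝ)) + Real.log (1 + d)) ≤
        64 * (d : ℝ) * W.card * (4 * Real.log d) :=
      mul_le_mul_of_nonneg_left (by linarith) (by positivity)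
    have h3 := mul_le_mul_of_nonneg_left h1 (by positivity : (0 : ℝ) ≤ 3000 * d)
    have h4 : (0 : ℝ) ≤ d * W.card * Real.log d := by positivity
    unfold chainBound
    nlinarith

end CutCost

/-! ### Sorting and filtering with path queries -/

open Prog

theorem runs_splitNodes {V : Type} [DecidableEq V] {Q : V → V → Bool} (j : V) (vs : List V) :
    Runs Q (splitNodes j vs) (vs.filter fun k => k ≠ j ∧ Q j k = false,
      vs.filter fun k => k ≠ j ∧ Q j k = true) (2 * vs.length) := by
  induction vs with
  | nil => rw [splitNodes]; exact runs_pure _ _ _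
  | cons k ks ih =>
    rw [splitNodes]
    refine ((runs_ticks Q 1).bind (M := 2 * ks.length + 1) ?_).mono
      (by simp only [List.length_cons]; omega)
    by_cases h : k = j
    · rw [if_pos h, List.filter_cons_of_neg (by simp [h]), List.filter_cons_of_neg (by simp [h])]
      exact ih.mono (by omega)
    · rw [if_neg h]
      refine ((runs_ask Q j k).bind (ih.bind (M := 0) ?_)).mono (by omega)
      rw [List.filter_cons, List.filter_cons]
      by_cases hjk : Q j k = true
      · rw [if_pos hjk, if_neg (by simp [hjk]), if_pos (by simp [hjk, h])]
        exact runs_pure _ _ _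
      · rw [if_neg hjk, if_pos (by simp [hjk, h]), if_neg (by simp [hjk])]
        exact runs_pure _ _ _

section Subroutines

variable {V : Type} [PartialOrder V] {Q : V → V → Bool}

/-- The output is sorted only if all elements are comparable: an element counts
as greater than every element that it is incomparable to. -/
theorem exists_runs_merge (hQ : ∀ i j, Q i j = true ↔ i < j) (as bs : List V) :
    ∃ l, Runs Q (merge as bs) l (2 * (as.length + bs.length)) ∧ l.Perm (as ++ bs) ∧
      ((∀ a ∈ as, ∀ b ∈ bs, a < b ∨ b < a) → as.Pairwise (· < ·) → bs.Pairwise (· < ·) →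
        l.Pairwise (· < ·)) := by
  induction hn : as.length + bs.length generalizing as bs with
  | zero =>
    obtain rfl : as = [] := List.length_eq_zero_iff.1 (by omega)
    rw [merge]
    exact ⟨bs, runs_pure _ _ _, .refl _, fun _ _ h => h⟩
  | succ n ih =>
    cases as with
    | nil => rw [merge]; exact ⟨bs, runs_pure _ _ _, .refl _, fun _ _ h => h⟩
    | cons a as =>
      cases bs with
      | nil => rw [merge]; exact ⟨a :: as, runs_pure _ _ _, by simp, fun _ h _ => h⟩
      | cons b bs =>
        rw [merge]
        simp only [List.length_cons] at hn
        by_cases hab : Q a b = true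
        · obtain ⟨l, hl, hp, hs⟩ := ih as (b :: bs) (by simp only [List.length_cons]; omega)
          refine ⟨a :: l, ((runs_ticks Q 1).bind ((runs_ask Q a b).bind (M := 2 * n) ?_)).mono
            (by omega), hp.cons a, fun hc ha hb => ?_⟩
          · rw [if_pos hab]
            exact Runs.bind (b := a :: l) (M := 0) hl (runs_pure _ _ _)
          · have hlt := (hQ a b).1 hab
            rw [List.pairwise_cons] at ha
            refine List.pairwise_cons.2 ⟨fun x hx => ?_,
              hs (fun x hx y hy => hc x (List.mem_cons_of_mem _ hx) y hy) ha.2 hb⟩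
            rcases List.mem_append.1 (hp.mem_iff.1 hx) with hx | hx
            · exact ha.1 x hx
            · rcases List.mem_cons.1 hx with rfl | hx
              · exact hlt
              · exact hlt.trans ((List.pairwise_cons.1 hb).1 x hx)
        · obtain ⟨l, hl, hp, hs⟩ := ih (a :: as) bs (by simp only [List.length_cons]; omega)
          refine ⟨b :: l, ((runs_ticks Q 1).bind ((runs_ask Q a b).bind (M := 2 * n) ?_)).mono
            (by omega), (hp.cons b).trans (List.perm_middle.symm), fun hc ha hb => ?_⟩
          · rw [if_neg hab]
            exact Runs.bind (b := b :: l) (M := 0) hl (runs_pure _ _ _)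
          · have hlt : b < a := (hc a (by simp) b (by simp)).resolve_left
              fun h => hab ((hQ a b).2 h)
            rw [List.pairwise_cons] at hb
            refine List.pairwise_cons.2 ⟨fun x hx => ?_,
              hs (fun x hx y hy => hc x hx y (List.mem_cons_of_mem _ hy)) ha hb.2⟩
            rcases List.mem_append.1 (hp.mem_iff.1 hx) with hx | hx
            · rcases List.mem_cons.1 hx with rfl | hx
              · exact hlt
              · exact hlt.trans ((List.pairwise_cons.1 ha).1 x hx)
            · exact hb.1 x hx

/-- Merge sort takes time at most `3 k |l|` on a list of length at most `2 ^ k`, and sorts it if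
its elements are comparable. -/
theorem exists_runs_sortNodes (hQ : ∀ i j, Q i j = true ↔ i < j) (k : ℕ) :
    ∀ l : List V, l.length ≤ 2 ^ k →
    ∃ l', Runs Q (sortNodes l) l' (3 * k * l.length) ∧ l'.Perm l ∧
      (l.Pairwise (fun a b => a < b ∨ b < a) → l'.Pairwise (· < ·)) := by
  induction k with
  | zero =>
    intro l hl
    match l, hl with
    | [], _ => rw [sortNodes]; exact ⟨[], runs_pure _ _ _, .refl _, fun _ => .nil⟩
    | [a], _ => rw [sortNodes]; exact ⟨[a], runs_pure _ _ _, .refl _, fun _ => by simp⟩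
    | a :: b :: l, hl => simp at hl
  | succ k ih =>
    intro l hl
    match l, hl with
    | [], _ => rw [sortNodes]; exact ⟨[], runs_pure _ _ _, .refl _, fun _ => .nil⟩
    | [a], _ => rw [sortNodes]; exact ⟨[a], runs_pure _ _ _, .refl _, fun _ => by simp⟩
    | a :: b :: l, hl =>
      rw [sortNodes]
      set l₀ := a :: b :: l with hl₀
      have hlen : l₀.length = l.length + 2 := rfl
      rw [hlen, pow_succ] at hl
      obtain ⟨l₁, h₁, p₁, s₁⟩ := ih (l₀.take ((l.length + 2) / 2)) (by
        rw [List.length_take]; omega)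
      obtain ⟨l₂, h₂, p₂, s₂⟩ := ih (l₀.drop ((l.length + 2) / 2)) (by
        rw [List.length_drop]; omega)
      obtain ⟨l₃, h₃, p₃, s₃⟩ := exists_runs_merge hQ l₁ l₂
      have hsum : (l₀.take ((l.length + 2) / 2)).length + (l₀.drop ((l.length + 2) / 2)).length =
          l.length + 2 := by rw [List.length_take, List.length_drop]; omega
      refine ⟨l₃, ((runs_ticks Q _).bind (h₁.bind (h₂.bind h₃))).mono ?_, ?_, fun hc => ?_⟩
      · have h1 := Nat.mul_add (3 * k) (l₀.take ((l.length + 2) / 2)).length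
          (l₀.drop ((l.length + 2) / 2)).length
        have h2 : 3 * (k + 1) * (l.length + 2) = 3 * k * (l.length + 2) + 3 * (l.length + 2) := by
          ring
        rw [hsum] at h1
        rw [p₁.length_eq, p₂.length_eq, hsum, hlen]
        omega
      · exact (p₃.trans (p₁.append p₂)).trans (by rw [List.take_append_drop])
      · rw [← List.take_append_drop ((l.length + 2) / 2) l₀, List.pairwise_append] at hc
        exact s₃ (fun x hx y hy => hc.2.2 x (p₁.mem_iff.1 hx) y (p₂.mem_iff.1 hy)) (s₁ hc.1)
          (s₂ hc.2.1)

theorem not_query_self (hQ : ∀ i j, Q i j = true ↔ i < j) (a : V) : Q a a = false := by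
  rw [Bool.eq_false_iff]
  exact fun h => lt_irrefl a ((hQ a a).1 h)

theorem runs_nodesBetween [DecidableEq V] (hQ : ∀ i j, Q i j = true ↔ i < j) (a b : V) (vs : List V) :
    Runs Q (nodesBetween a b vs) (vs.filter fun k => Q a k && Q k b) (3 * vs.length) := by
  induction vs with
  | nil => rw [nodesBetween]; exact runs_pure _ _ _
  | cons k ks ih =>
    rw [nodesBetween]
    refine ((runs_ticks Q 1).bind (M := 3 * ks.length + 2) ?_).mono
      (by simp only [List.length_cons]; omega)
    by_cases h : k = a ∨ k = b
    · rw [if_pos h, List.filter_cons_of_neg]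
      · exact ih.mono (by omega)
      · rcases h with rfl | rfl <;> simp [not_query_self hQ]
    · rw [if_neg h]
      refine ((runs_ask Q a k).bind ((runs_ask Q k b).bind (ih.bind (M := 0) ?_))).mono (by omega)
      rw [List.filter_cons]
      split_ifs <;> exact runs_pure _ _ _

theorem runs_ancestors [DecidableEq V] (hQ : ∀ i j, Q i j = true ↔ i < j) (i : V) (vs : List V) :
    Runs Q (ancestors i vs) (vs.filter fun k => Q k i) (2 * vs.length) := by
  induction vs with
  | nil => rw [ancestors]; exact runs_pure _ _ _
  | cons k ks ih =>
    rw [ancestors]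
    refine ((runs_ticks Q 1).bind (M := 2 * ks.length + 1) ?_).mono
      (by simp only [List.length_cons]; omega)
    by_cases h : k = i
    · rw [if_pos h, List.filter_cons_of_neg]
      · exact ih.mono (by omega)
      · simp [h, not_query_self hQ]
    · rw [if_neg h]
      refine ((runs_ask Q k i).bind (ih.bind (M := 0) ?_)).mono (by omega)
      rw [List.filter_cons]
      split_ifs <;> exact runs_pure _ _ _

/-- In a sorted list the last ancestor of `j` is the greatest one. -/
theorem exists_runs_lastAncestor (hQ : ∀ i j, Q i j = true ↔ i < j) (j : V) (l : List V) :
    ∀ best : Option V, l.Pairwise (· < ·) →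
    ∃ r, Runs Q (lastAncestor j best l) r (2 * l.length) ∧
      ((∃ m ∈ l, m < j ∧ r = some m ∧ ∀ x ∈ l, x < j → x ≤ m) ∨
        ((∀ x ∈ l, ¬ x < j) ∧ r = best)) := by
  induction l with
  | nil =>
    intro best _
    rw [lastAncestor]
    exact ⟨best, runs_pure _ _ _, Or.inr ⟨by simp, rfl⟩⟩
  | cons k ks ih =>
    intro best hs
    rw [List.pairwise_cons] at hs
    rw [lastAncestor]
    obtain ⟨r, hr, h⟩ := ih (if Q k j then some k else best) hs.2
    refine ⟨r, ((runs_ticks Q 1).bind ((runs_ask Q k j).bind hr)).mono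
      (by simp only [List.length_cons]; omega), ?_⟩
    rcases h with ⟨m, hm, hmj, rfl, hmax⟩ | ⟨hno, rfl⟩
    · refine Or.inl ⟨m, List.mem_cons_of_mem _ hm, hmj, rfl, fun x hx hxj => ?_⟩
      rcases List.mem_cons.1 hx with rfl | hx
      · exact (hs.1 m hm).le
      · exact hmax x hx hxj
    · by_cases hkj : k < j
      · rw [if_pos ((hQ k j).2 hkj)]
        refine Or.inl ⟨k, by simp, hkj, rfl, fun x hx hxj => ?_⟩
        rcases List.mem_cons.1 hx with rfl | hx
        · exact le_rfl
        · exact absurd hxj (hno x hx)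
      · rw [if_neg (fun h => hkj ((hQ k j).1 h))]
        refine Or.inr ⟨fun x hx => ?_, rfl⟩
        rcases List.mem_cons.1 hx with rfl | hx
        · exact hkj
        · exact hno x hx

/-- A list without repetitions of elements below a given one consists of comparable elements. -/
theorem pairwise_comparable (hV : IsTreeOrder V) {b : V} {l : List V} (hl : l.Nodup)
    (h : ∀ x ∈ l, x < b) : l.Pairwise (fun a b => a < b ∨ b < a) := by
  refine List.Pairwise.imp_of_mem (fun {x y} hx hy hxy => ?_) hl
  rcases hV.chain (h x hx).le (h y hy).le with h | h
  · exact Or.inl (lt_of_le_of_ne h hxy)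
  · exact Or.inr (lt_of_le_of_ne h (Ne.symm hxy))

theorem exists_runs_interior [DecidableEq V] (hV : IsTreeOrder V) (hQ : ∀ i j, Q i j = true ↔ i < j) {L : ℕ}
    {vs : List V} (hnd : vs.Nodup) (hL : vs.length ≤ 2 ^ L) (a b : V) :
    ∃ l, Runs Q (interior vs a b) l (3 * vs.length + 3 * L * vs.length) ∧
      l.Pairwise (· < ·) ∧ ∀ x, x ∈ l ↔ x ∈ vs ∧ a < x ∧ x < b := by
  have hmem : ∀ x, x ∈ vs.filter (fun k => Q a k && Q k b) ↔ x ∈ vs ∧ a < x ∧ x < b := by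
    intro x; simp [List.mem_filter, hQ]
  have hlen : (vs.filter fun k => Q a k && Q k b).length ≤ vs.length := List.length_filter_le _ _
  obtain ⟨l, hl, hp, hs⟩ := exists_runs_sortNodes hQ L (vs.filter fun k => Q a k && Q k b)
    (hlen.trans hL)
  refine ⟨l, (runs_nodesBetween hQ a b vs).bind (hl.mono (Nat.mul_le_mul_left _ hlen)),
    hs (pairwise_comparable hV (b := b) (hnd.filter _) fun x hx => ((hmem x).1 hx).2.2),
    fun x => ?_⟩
  rw [hp.mem_iff, hmem]

theorem exists_runs_findLowestCommonAncestor [DecidableEq V] (hV : IsTreeOrder V)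
    (hQ : ∀ i j, Q i j = true ↔ i < j) {L : ℕ} {vs : List V} (hnd : vs.Nodup)
    (hL : vs.length ≤ 2 ^ L) {i j : V} (hc : ∃ r ∈ vs, r < i ∧ r < j) :
    ∃ m ∈ vs, Runs Q (findLowestCommonAncestor vs i j) (some m)
      (4 * vs.length + 3 * L * vs.length) ∧ m < i ∧ m < j ∧
        ∀ x ∈ vs, x < i → x < j → x ≤ m := by
  have hmem : ∀ x, x ∈ vs.filter (fun k => Q k i) ↔ x ∈ vs ∧ x < i := by
    intro x; simp [List.mem_filter, hQ]
  have hlen : (vs.filter fun k => Q k i).length ≤ vs.length := List.length_filter_le _ _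
  obtain ⟨l, hl, hp, hs⟩ := exists_runs_sortNodes hQ L (vs.filter fun k => Q k i) (hlen.trans hL)
  have hs' := hs (pairwise_comparable hV (b := i) (hnd.filter _) fun x hx => ((hmem x).1 hx).2)
  obtain ⟨r, hr, h⟩ := exists_runs_lastAncestor hQ j l none hs'
  have hmem' : ∀ x, x ∈ l ↔ x ∈ vs ∧ x < i := fun x => by rw [hp.mem_iff, hmem]
  rcases h with ⟨m, hm, hmj, rfl, hmax⟩ | ⟨hno, _⟩
  · refine ⟨m, ((hmem' m).1 hm).1, ?_, ((hmem' m).1 hm).2, hmj,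
      fun x hx hxi hxj => hmax x ((hmem' x).2 ⟨hx, hxi⟩) hxj⟩
    have := ((runs_ancestors hQ i vs).bind hl).bind hr
    refine this.mono ?_
    rw [hp.length_eq]
    have := Nat.mul_le_mul_left (3 * L) hlen
    omega
  · obtain ⟨r, hr, hri, hrj⟩ := hc
    exact absurd hrj (hno r ((hmem' r).2 ⟨hr, hri⟩))

end Subroutines

/-! ### Multidirectional paths and bags -/

section Fork

variable {V : Type}

/-- The vertex at a position of the multidirectional path `up.reverse ++ m :: down`. -/
def forkNode (m : V) (up down : List V) (t : ℕ) : V :=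
  if t < up.length then up.getD (up.length - 1 - t) m else (m :: down).getD (t - up.length) m

theorem map_forkNode (m : V) (up down : List V) :
    up.reverse ++ m :: down =
      (List.range (up.length + 1 + down.length)).map (forkNode m up down) := by
  refine List.ext_getElem (by simp; omega) fun t h1 h2 => ?_
  simp only [List.getElem_map, List.getElem_range, forkNode]
  simp only [List.length_map, List.length_range] at h2
  split_ifs with h
  · rw [List.getElem_append_left (by simpa using h), List.getElem_reverse,
      List.getD_eq_getElem _ _ (by omega)]
  · rw [List.getElem_append_right (by simpa using h),
      List.getD_eq_getElem _ _ (by simp only [List.length_cons]; omega)]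
    simp

theorem forkNode_of_lt {m : V} {up down : List V} {t : ℕ} (h : t < up.length) :
    forkNode m up down t = up[up.length - 1 - t] := by
  rw [forkNode, if_pos h, List.getD_eq_getElem]

theorem forkNode_length (m : V) (up down : List V) : forkNode m up down up.length = m := by
  simp [forkNode]

theorem forkNode_of_gt {m : V} {up down : List V} {t : ℕ} (h : up.length ≤ t)
    (ht : t < up.length + down.length) :
    forkNode m up down (t + 1) = down[t - up.length] := by
  rw [forkNode, if_neg (by omega), Nat.sub_add_comm h, List.getD_cons_succ, List.getD_eq_getElem]

theorem mem_path_iff (m : V) (up down : List V) (x : V) :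
    x ∈ up.reverse ++ m :: down ↔
      ∃ t < up.length + 1 + down.length, forkNode m up down t = x := by
  rw [map_forkNode]; simp

end Fork

section Paths

variable {V : Type} [PartialOrder V] {Q : V → V → Bool}

/-- The list `up.reverse ++ m :: down` is the multidirectional path from `p` to `q`, and `m` is
the lowest common ancestor: `m :: up` and `m :: down` are the directed paths from `m` to `p` and
to `q`. -/
structure IsFork (m p q : V) (up down : List V) : Prop where
  sorted_up : (m :: up).Pairwise (· < ·)
  mem_up : ∀ x, x ∈ m :: up ↔ m ≤ x ∧ x ≤ p
  sorted_down : (m :: down).Pairwise (· < ·)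
  mem_down : ∀ x, x ∈ m :: down ↔ m ≤ x ∧ x ≤ q
  not_both : ∀ a ∈ up, ∀ b ∈ down, ∀ k, a ≤ k → ¬ b ≤ k

theorem pairwise_path {m i : V} {l : List V} (hmi : m < i) (hl : l.Pairwise (· < ·))
    (hlm : ∀ x ∈ l, m < x ∧ x < i) : (m :: (l ++ [i])).Pairwise (· < ·) := by
  rw [List.pairwise_cons, List.pairwise_append]
  refine ⟨fun x hx => ?_, hl, by simp, fun x hx y hy => ?_⟩
  · rcases List.mem_append.1 hx with hx | hx
    · exact (hlm x hx).1
    · rw [List.mem_singleton.1 hx]; exact hmi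
  · rw [List.mem_singleton.1 hy]; exact (hlm x hx).2

theorem mem_path {m i : V} {l : List V} (hmi : m < i) (hlm : ∀ x, x ∈ l ↔ m < x ∧ x < i) (x : V) :
    x ∈ m :: (l ++ [i]) ↔ m ≤ x ∧ x ≤ i := by
  simp only [List.mem_cons, List.mem_append, hlm, List.not_mem_nil, or_false]
  constructor
  · rintro (rfl | ⟨h1, h2⟩ | rfl)
    · exact ⟨le_rfl, hmi.le⟩
    · exact ⟨h1.le, h2.le⟩
    · exact ⟨hmi.le, le_rfl⟩
  · rintro ⟨h1, h2⟩
    rcases h1.eq_or_lt with h1 | h1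
    · exact Or.inl h1.symm
    · rcases h2.eq_or_lt with h2 | h2
      · exact Or.inr (Or.inr h2)
      · exact Or.inr (Or.inl ⟨h1, h2⟩)

theorem exists_runs_reconstructPath [DecidableEq V] (hV : IsTreeOrder V) (hQ : ∀ i j, Q i j = true ↔ i < j)
    {L : ℕ} {vs : List V} (hnd : vs.Nodup) (hL : vs.length ≤ 2 ^ L) (hW : IsSubtree vs.toFinset)
    {i j : V} (hi : i ∈ vs) (hj : j ∈ vs) :
    ∃ m p q up down, Runs Q (reconstructPath vs i j) (up.reverse ++ m :: down, up.length)
        (11 * vs.length + 9 * L * vs.length + 2) ∧ IsFork m p q up down ∧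
      ((p = i ∧ q = j) ∨ (p = j ∧ q = i)) ∧ m ≤ p ∧ m ≤ q ∧ m ∈ vs := by
  have hconv : ∀ {a b k : V}, a ∈ vs → b ∈ vs → a < k → k < b → k ∈ vs := by
    intro a b k ha hb hak hkb
    exact List.mem_toFinset.1 (hW.convex (List.mem_toFinset.2 ha) (List.mem_toFinset.2 hb)
      hak.le hkb.le)
  have hint : ∀ {a b : V}, a ∈ vs → b ∈ vs →
      ∃ l, Runs Q (interior vs a b) l (3 * vs.length + 3 * L * vs.length) ∧
      l.Pairwise (· < ·) ∧ ∀ x, x ∈ l ↔ a < x ∧ x < b := by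
    intro a b ha hb
    obtain ⟨l, h1, h2, h3⟩ := exists_runs_interior hV hQ hnd hL a b
    exact ⟨l, h1, h2, fun x => ⟨fun h => ((h3 x).1 h).2,
      fun h => (h3 x).2 ⟨hconv ha hb h.1 h.2, h⟩⟩⟩
  have hsingle : ∀ a x : V, x ∈ [a] ↔ a ≤ x ∧ x ≤ a := by
    intro a x
    rw [List.mem_singleton]
    exact ⟨fun h => h ▸ ⟨le_rfl, le_rfl⟩, fun h => le_antisymm h.2 h.1⟩
  have hle : 9 * L * vs.length = 3 * L * vs.length + 3 * L * vs.length + 3 * L * vs.length := by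
    ring
  unfold reconstructPath
  by_cases hij : i = j
  · subst hij
    refine ⟨i, i, i, [], [], ((runs_ticks Q _).bind (M := 0) ?_).mono (by omega),
      ⟨by simp, hsingle i, by simp, hsingle i, by simp⟩, Or.inl ⟨rfl, rfl⟩, le_rfl, le_rfl, hi⟩
    rw [if_pos rfl]
    exact runs_pure _ _ _
  by_cases hlt : i < j
  · obtain ⟨l, h1, h2, h3⟩ := hint hi hj
    refine ⟨i, i, j, [], l ++ [j], ((runs_ticks Q _).bind
      (M := 1 + (3 * vs.length + 3 * L * vs.length)) ?_).mono (by omega),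
      ⟨by simp, hsingle i, pairwise_path hlt h2 fun x hx => (h3 x).1 hx, mem_path hlt h3, by simp⟩,
      Or.inl ⟨rfl, rfl⟩, le_rfl, hlt.le, hi⟩
    rw [if_neg hij]
    refine (runs_ask Q i j).bind ?_
    rw [if_pos ((hQ i j).2 hlt)]
    exact h1.bind (M := 0) (runs_pure _ _ _)
  by_cases hgt : j < i
  · obtain ⟨l, h1, h2, h3⟩ := hint hj hi
    refine ⟨j, j, i, [], l ++ [i], ((runs_ticks Q _).bind
      (M := 1 + (1 + (3 * vs.length + 3 * L * vs.length))) ?_).mono (by omega),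
      ⟨by simp, hsingle j, pairwise_path hgt h2 fun x hx => (h3 x).1 hx, mem_path hgt h3, by simp⟩,
      Or.inr ⟨rfl, rfl⟩, le_rfl, hgt.le, hj⟩
    rw [if_neg hij]
    refine (runs_ask Q i j).bind ?_
    rw [if_neg fun h => hlt ((hQ i j).1 h)]
    refine (runs_ask Q j i).bind ?_
    rw [if_pos ((hQ j i).2 hgt)]
    exact h1.bind (M := 0) (runs_pure _ _ _)
  · have hroot : ∃ r ∈ vs, r < i ∧ r < j := by
      obtain ⟨r, hr, hle⟩ := hW.root
      have hri := hle i (List.mem_toFinset.2 hi)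
      have hrj := hle j (List.mem_toFinset.2 hj)
      refine ⟨r, List.mem_toFinset.1 hr, lt_of_le_of_ne hri ?_, lt_of_le_of_ne hrj ?_⟩
      · rintro rfl; exact hlt (lt_of_le_of_ne hrj hij)
      · rintro rfl; exact hgt (lt_of_le_of_ne hri (Ne.symm hij))
    obtain ⟨m, hm, hmr, hmi, hmj, hmax⟩ := exists_runs_findLowestCommonAncestor hV hQ hnd hL hroot
    obtain ⟨l, h1, h2, h3⟩ := hint hm hi
    obtain ⟨l', h1', h2', h3'⟩ := hint hm hj
    refine ⟨m, i, j, l ++ [i], l' ++ [j], ((runs_ticks Q _).bind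
      (M := 1 + (1 + ((4 * vs.length + 3 * L * vs.length) + ((3 * vs.length + 3 * L * vs.length) +
        (3 * vs.length + 3 * L * vs.length))))) ?_).mono (by omega),
      ⟨pairwise_path hmi h2 fun x hx => (h3 x).1 hx, mem_path hmi h3,
        pairwise_path hmj h2' fun x hx => (h3' x).1 hx, mem_path hmj h3', ?_⟩,
      Or.inl ⟨rfl, rfl⟩, hmi.le, hmj.le, hm⟩
    · rw [if_neg hij]
      refine (runs_ask Q i j).bind ?_
      rw [if_neg fun h => hlt ((hQ i j).1 h)]
      refine (runs_ask Q j i).bind ?_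
      rw [if_neg fun h => hgt ((hQ j i).1 h)]
      refine hmr.bind (h1.bind (h1'.bind (M := 0) ?_))
      have : (i :: l.reverse ++ m :: l' ++ [j], l.length + 1) =
          ((l ++ [i]).reverse ++ m :: (l' ++ [j]), (l ++ [i]).length) := by simp
      rw [this]
      exact runs_pure _ _ _
    · -- a common upper bound would make the two elements comparable, so that one of them is a
      -- common ancestor of `i` and `j` strictly below `m`
      have key : ∀ x, m < x → x ≤ i → x ≤ j → False := by
        intro x hmx hxi hxj
        rcases hxi.eq_or_lt with rfl | hxi
        · exact hlt (lt_of_le_of_ne hxj hij)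
        · rcases hxj.eq_or_lt with rfl | hxj
          · exact hgt hxi
          · exact (hmax x (hconv hm hi hmx hxi) hxi hxj).not_gt hmx
      have hup : ∀ {i : V} {l : List V}, m < i → (∀ x, x ∈ l ↔ m < x ∧ x < i) →
          ∀ x ∈ l ++ [i], m < x ∧ x ≤ i := by
        intro i l hmi h3 x hx
        rcases List.mem_append.1 hx with hx | hx
        · exact ⟨((h3 x).1 hx).1, ((h3 x).1 hx).2.le⟩
        · rw [List.mem_singleton.1 hx]; exact ⟨hmi, le_rfl⟩
      intro a ha b hb k hak hbk
      have ha' := hup hmi h3 a ha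
      have hb' := hup hmj h3' b hb
      rcases hV.chain hak hbk with h | h
      · exact key a ha'.1 ha'.2 (h.trans hb'.2)
      · exact key b hb'.1 (h.trans ha'.2) hb'.2

theorem getElem_lt_getElem_iff {l : List V} (hl : l.Pairwise (· < ·)) {s t : ℕ}
    (hs : s < l.length) (ht : t < l.length) : l[s] < l[t] ↔ s < t := by
  rw [List.pairwise_iff_getElem] at hl
  constructor
  · intro h
    by_contra! hts
    rcases hts.eq_or_lt with rfl | hts
    · exact lt_irrefl _ h
    · exact lt_asymm h (hl t s ht hs hts)
  · exact hl s t hs ht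

theorem getElem_le_getElem_iff {l : List V} (hl : l.Pairwise (· < ·)) {s t : ℕ}
    (hs : s < l.length) (ht : t < l.length) : l[s] ≤ l[t] ↔ s ≤ t := by
  constructor
  · intro h
    by_contra! hts
    exact ((getElem_lt_getElem_iff hl ht hs).2 hts).not_ge h
  · intro h
    rcases h.eq_or_lt with rfl | h
    · exact le_rfl
    · exact ((getElem_lt_getElem_iff hl hs ht).2 h).le

/-- A sorted list of all elements of an interval is a saturated chain. -/
theorem covBy_getElem {l : List V} (hl : l.Pairwise (· < ·)) {m p : V}
    (hmem : ∀ x, x ∈ l ↔ m ≤ x ∧ x ≤ p) {s : ℕ} (hs : s + 1 < l.length) : l[s] ⋖ l[s + 1] := by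
  refine ⟨(getElem_lt_getElem_iff hl (by omega) hs).2 (by omega), fun z hz1 hz2 => ?_⟩
  have h1 := (hmem _).1 (List.getElem_mem (by omega : s < l.length))
  have h2 := (hmem _).1 (List.getElem_mem hs)
  obtain ⟨t, ht, rfl⟩ := List.getElem_of_mem ((hmem z).2 ⟨h1.1.trans hz1.le, hz2.le.trans h2.2⟩)
  rw [getElem_lt_getElem_iff hl] at hz1 hz2
  omega

namespace IsFork

variable {m p q : V} {up down : List V}

theorem lt_up (h : IsFork m p q up down) {x : V} (hx : x ∈ up) : m < x :=
  (List.pairwise_cons.1 h.sorted_up).1 x hx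

theorem lt_down (h : IsFork m p q up down) {x : V} (hx : x ∈ down) : m < x :=
  (List.pairwise_cons.1 h.sorted_down).1 x hx

theorem covBy_of_lt (h : IsFork m p q up down) {t : ℕ} (ht : t < up.length) :
    forkNode m up down (t + 1) ⋖ forkNode m up down t := by
  have := covBy_getElem h.sorted_up h.mem_up (s := up.length - 1 - t)
    (by simp only [List.length_cons]; omega)
  rw [List.getElem_cons_succ, ← forkNode_of_lt (m := m) (down := down) ht] at this
  convert this
  rcases Nat.lt_or_ge (t + 1) up.length with h1 | h1
  · rw [forkNode_of_lt h1]
    have : up.length - 1 - t = (up.length - 1 - (t + 1)) + 1 := by omega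
    simp only [this, List.getElem_cons_succ]
  · have h2 : t + 1 = up.length := by omega
    have h3 : up.length - 1 - t = 0 := by omega
    simp only [h2, h3, forkNode_length, List.getElem_cons_zero]

theorem covBy_of_ge (h : IsFork m p q up down) {t : ℕ} (ht : up.length ≤ t)
    (ht' : t < up.length + down.length) :
    forkNode m up down t ⋖ forkNode m up down (t + 1) := by
  have := covBy_getElem h.sorted_down h.mem_down (s := t - up.length)
    (by simp only [List.length_cons]; omega)
  rw [List.getElem_cons_succ, ← forkNode_of_gt (m := m) ht ht'] at this
  convert this
  rcases ht.eq_or_lt with rfl | h1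
  · simp only [forkNode_length, Nat.sub_self, List.getElem_cons_zero]
  · obtain ⟨t, rfl⟩ : ∃ s, t = s + 1 := ⟨t - 1, by omega⟩
    rw [forkNode_of_gt (by omega) (by omega)]
    have : t + 1 - up.length = (t - up.length) + 1 := by omega
    simp only [this, List.getElem_cons_succ]

theorem le_of_mem (h : IsFork m p q up down) {t : ℕ} (ht : t < up.length + 1 + down.length) :
    m ≤ forkNode m up down t ∧ (forkNode m up down t ≤ p ∨ forkNode m up down t ≤ q) := by
  rcases Nat.lt_or_ge t up.length with h1 | h1
  · rw [forkNode_of_lt h1]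
    have := (h.mem_up _).1 (List.mem_cons_of_mem _ (List.getElem_mem
      (by omega : up.length - 1 - t < up.length)))
    exact ⟨this.1, Or.inl this.2⟩
  · rcases h1.eq_or_lt with rfl | h1
    · rw [forkNode_length]
      exact ⟨le_rfl, Or.inl ((h.mem_up m).1 (by simp)).2⟩
    · obtain ⟨t, rfl⟩ : ∃ s, t = s + 1 := ⟨t - 1, by omega⟩
      rw [forkNode_of_gt (by omega) (by omega)]
      have := (h.mem_down _).1 (List.mem_cons_of_mem _ (List.getElem_mem
        (by omega : t - up.length < down.length)))
      exact ⟨this.1, Or.inr this.2⟩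

end IsFork

/-- Binary search in a sorted list finds the last element below `k`. -/
theorem exists_runs_bagSearch (hQ : ∀ i j, Q i j = true ↔ i < j) {path : List V}
    (hpath : path.Pairwise (· < ·)) (k : V) (L : ℕ) :
    ∀ l r, l < r → r ≤ path.length → r - l ≤ 2 ^ L →
    (∀ t (ht : t < path.length), 1 ≤ t → t ≤ l → path[t] < k) →
    (∀ t (ht : t < path.length), r ≤ t → ¬ path[t] < k) →
    ∃ p, Runs Q (bagSearch path k l r) p (2 * L) ∧ p < path.length ∧
      ∀ t (ht : t < path.length), 1 ≤ t → (path[t] < k ↔ t ≤ p) := by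
  have hbase : ∀ (L l r : ℕ), l < r → r ≤ path.length → ¬ l + 1 < r →
      (∀ t (ht : t < path.length), 1 ≤ t → t ≤ l → path[t] < k) →
      (∀ t (ht : t < path.length), r ≤ t → ¬ path[t] < k) →
      ∃ p, Runs Q (bagSearch path k l r) p (2 * L) ∧ p < path.length ∧
        ∀ t (ht : t < path.length), 1 ≤ t → (path[t] < k ↔ t ≤ p) := by
    intro L l r hlr hr hlr' hl hr'
    rw [bagSearch, if_neg hlr']
    refine ⟨l, runs_pure _ _ _, by omega, fun t ht h1 => ⟨fun h => ?_, fun h => hl t ht h1 h⟩⟩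
    by_contra! h2
    exact hr' t ht (by omega) h
  induction L with
  | zero =>
    intro l r hlr hr hsize hl hr'
    rw [pow_zero] at hsize
    exact hbase 0 l r hlr hr (by omega) hl hr'
  | succ L ih =>
    intro l r hlr hr hsize hl hr'
    by_cases hlr' : l + 1 < r
    · have hmid : (l + r) / 2 < path.length := by omega
      rw [bagSearch, if_pos hlr', List.getElem?_eq_getElem hmid]
      rw [pow_succ] at hsize
      by_cases hup : path[(l + r) / 2] < k
      · obtain ⟨p, hp, h⟩ := ih ((l + r) / 2) r (by omega) hr (by omega)
          (fun t ht h1 h2 => ((getElem_le_getElem_iff hpath ht hmid).2 h2).trans_lt hup) hr'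
        refine ⟨p, ((runs_ticks Q 1).bind ((runs_ask Q _ k).bind (M := 2 * L) ?_)).mono (by omega),
          h⟩
        rw [if_pos ((hQ _ _).2 hup)]
        exact hp
      · obtain ⟨p, hp, h⟩ := ih l ((l + r) / 2) (by omega) (by omega) (by omega) hl
          (fun t ht h2 h => hup (((getElem_le_getElem_iff hpath hmid ht).2 h2).trans_lt h))
        refine ⟨p, ((runs_ticks Q 1).bind ((runs_ask Q _ k).bind (M := 2 * L) ?_)).mono (by omega),
          h⟩
        rw [if_neg fun h => hup ((hQ _ _).1 h)]
        exact hp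
    · exact hbase (L + 1) l r hlr hr hlr' hl hr'

variable [DecidableLE V]

/-- The elements of a sorted list that are below `k` form a prefix. -/
theorem getElem_le_iff_lt_countP {l : List V} (hl : l.Pairwise (· < ·)) (k : V) :
    ∀ t (ht : t < l.length), l[t] ≤ k ↔ t < l.countP (· ≤ k) := by
  induction l with
  | nil => intro t ht; simp at ht
  | cons x l ih =>
    rw [List.pairwise_cons] at hl
    intro t ht
    by_cases hx : x ≤ k
    · rw [List.countP_cons_of_pos (by simpa using hx)]
      cases t with
      | zero => simpa using hx
      | succ t => rw [List.getElem_cons_succ, ih hl.2]; omega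
    · have h0 : (x :: l).countP (· ≤ k) = 0 := by
        rw [List.countP_eq_zero]
        intro y hy
        rcases List.mem_cons.1 hy with rfl | hy
        · simpa using hx
        · simpa using fun h => hx ((hl.1 y hy).le.trans h)
      rw [h0]
      refine iff_of_false (fun h => ?_) (by omega)
      cases t with
      | zero => exact hx h
      | succ t => exact hx ((hl.1 _ (List.getElem_mem _)).le.trans h)

theorem countP_eq_of_forall {l : List V} (hl : l.Pairwise (· < ·)) {k : V} {p : ℕ}
    (hp : p ≤ l.length) (h : ∀ t (ht : t < l.length), l[t] ≤ k ↔ t < p) :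
    l.countP (· ≤ k) = p := by
  have hle : l.countP (· ≤ k) ≤ l.length := List.countP_le_length
  rcases lt_trichotomy (l.countP (· ≤ k)) p with hlt | heq | hgt
  · have := (getElem_le_iff_lt_countP hl k _ (by omega)).1 ((h _ (by omega)).2 hlt)
    omega
  · exact heq
  · have := (h _ (by omega)).1 ((getElem_le_iff_lt_countP hl k _ (by omega)).2 hgt)
    omega

/-- The position found is the number of proper descendants of `m` on the path that are below `k`;
in particular it is `0` if there is none, whether or not `m` itself is below `k`. -/
theorem runs_findBag (hQ : ∀ i j, Q i j = true ↔ i < j) {m : V} {up : List V}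
    (h : (m :: up).Pairwise (· < ·)) {k : V} (hk : k ∉ up) {L : ℕ}
    (hL : (m :: up).length ≤ 2 ^ L) :
    Runs Q (findBag (m :: up) k) (up.countP (· ≤ k)) (2 * L) := by
  obtain ⟨p, hp, hlt, hiff⟩ := exists_runs_bagSearch hQ h k L 0 (m :: up).length (by simp) le_rfl
    (by simpa using hL) (fun t _ h1 h2 => by omega) (fun t ht h => by omega)
  have : up.countP (· ≤ k) = p := by
    simp only [List.length_cons] at hlt
    refine countP_eq_of_forall (List.pairwise_cons.1 h).2 (by omega) fun t ht => ?_
    have := hiff (t + 1) (by simp only [List.length_cons]; omega) (by omega)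
    rw [List.getElem_cons_succ] at this
    rw [← Nat.succ_le_iff, ← this]
    exact ⟨fun h => lt_of_le_of_ne h fun e => hk (e ▸ List.getElem_mem _), le_of_lt⟩
  rw [this]
  exact hp

/-- The position in the multidirectional path `up.reverse ++ m :: down` of the vertex to whose
bag `k` belongs. -/
def bagPos (up down : List V) (k : V) : ℕ :=
  if up.countP (· ≤ k) = 0 then up.length + down.countP (· ≤ k)
  else up.length - up.countP (· ≤ k)

namespace IsFork

variable {m p q : V} {up down : List V}

/-- The first `t + 1` bags on the way up to `m` contain exactly the vertices below the node at
position `t`. -/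
theorem bagPos_lt_iff_of_lt (h : IsFork m p q up down) {t : ℕ} (ht : t < up.length) (k : V) :
    bagPos up down k < t + 1 ↔ forkNode m up down t ≤ k := by
  rw [forkNode_of_lt ht, getElem_le_iff_lt_countP (List.pairwise_cons.1 h.sorted_up).2, bagPos]
  have : up.countP (· ≤ k) ≤ up.length := List.countP_le_length
  split_ifs <;> omega

/-- From `m` on, the first `t + 1` bags contain exactly the vertices that are not below the next
node. -/
theorem bagPos_lt_iff_of_ge (h : IsFork m p q up down) {t : ℕ} (ht : up.length ≤ t)
    (ht' : t < up.length + down.length) (k : V) :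
    bagPos up down k < t + 1 ↔ ¬ forkNode m up down (t + 1) ≤ k := by
  have hle : up.countP (· ≤ k) ≤ up.length := List.countP_le_length
  rw [forkNode_of_gt ht ht', bagPos]
  split_ifs with h0
  · rw [getElem_le_iff_lt_countP (List.pairwise_cons.1 h.sorted_down).2]
    omega
  · refine iff_of_true (by omega) ?_
    have : up[0] ≤ k := by
      rw [getElem_le_iff_lt_countP (List.pairwise_cons.1 h.sorted_up).2 k 0 (by omega)]
      omega
    exact h.not_both _ (List.getElem_mem _) _ (List.getElem_mem _) k this

theorem bagPos_forkNode (h : IsFork m p q up down) {t : ℕ}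
    (ht : t < up.length + 1 + down.length) : bagPos up down (forkNode m up down t) = t := by
  have hsu := (List.pairwise_cons.1 h.sorted_up).2
  have hsd := (List.pairwise_cons.1 h.sorted_down).2
  rcases lt_trichotomy t up.length with hlt | rfl | hgt
  · have : up.countP (· ≤ forkNode m up down t) = up.length - t := by
      rw [forkNode_of_lt hlt]
      refine countP_eq_of_forall hsu (by omega) fun s hs => ?_
      rw [getElem_le_getElem_iff hsu]
      omega
    rw [bagPos, this, if_neg (by omega)]
    omega
  · rw [forkNode_length, bagPos]
    have h1 : up.countP (· ≤ m) = 0 := by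
      rw [List.countP_eq_zero]
      intro x hx
      simpa using (h.lt_up hx).not_ge
    have h2 : down.countP (· ≤ m) = 0 := by
      rw [List.countP_eq_zero]
      intro x hx
      simpa using (h.lt_down hx).not_ge
    rw [h1, h2, if_pos rfl, add_zero]
  · obtain ⟨t, rfl⟩ : ∃ s, t = s + 1 := ⟨t - 1, by omega⟩
    rw [forkNode_of_gt (by omega) (by omega)]
    have h1 : up.countP (· ≤ down[t - up.length]) = 0 := by
      rw [List.countP_eq_zero]
      intro x hx
      simpa using fun hle => h.not_both x hx _ (List.getElem_mem _) _ hle le_rfl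
    have h2 : down.countP (· ≤ down[t - up.length]) = t - up.length + 1 := by
      refine countP_eq_of_forall hsd (by omega) fun s hs => ?_
      rw [getElem_le_getElem_iff hsd]
      omega
    rw [bagPos, h1, h2, if_pos rfl]
    omega

end IsFork

end Paths

/-! ### One round of the algorithm -/

section Round

section

variable {V : Type} {Q : V → V → Bool}

/-- The search finds the first edge of the path with an even cumulative bag size `S`, if there
is one. The path and the bag sizes are listed as values of functions. -/
theorem exists_runs_findSeparator (n d c : ℕ) (g : ℕ → V) (f S : ℕ → ℕ)
    (hS : ∀ t, S (t + 1) = S t + f t) (len : ℕ) :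
    ∀ r, ∃ res, Runs Q (findSeparator n d c r (S r) ((List.range' r len).map g)
        ((List.range' r len).map f)) res len ∧
      (∀ e, res = some e → ∃ t, t + 1 < r + len ∧ n ≤ d * S (t + 1) + 1 ∧
        d * S (t + 1) + n ≤ d * n + 1 ∧ e = if t < c then (g (t + 1), g t) else (g t, g (t + 1))) ∧
      ∀ t, r ≤ t → t + 1 < r + len → n ≤ d * S (t + 1) + 1 → d * S (t + 1) + n ≤ d * n + 1 →
        res ≠ none := by
  induction len with
  | zero =>
    intro r
    refine ⟨none, ?_, by simp, fun t h1 h2 => by omega⟩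
    rw [List.range'_zero, List.map_nil, List.map_nil, findSeparator]
    · exact runs_pure _ _ _
    · simp
  | succ len ih =>
    intro r
    cases len with
    | zero =>
      refine ⟨none, ?_, by simp, fun t h1 h2 => by omega⟩
      rw [List.range'_one, List.map_singleton, List.map_singleton, findSeparator]
      · exact runs_pure _ _ _
      · simp
    | succ len =>
      obtain ⟨res, hres, h1, h2⟩ := ih (r + 1)
      rw [List.range'_succ] at hres ⊢
      rw [List.range'_succ]
      rw [List.map_cons, List.map_cons] at hres
      rw [List.map_cons, List.map_cons, List.map_cons, List.map_cons, findSeparator, ← hS]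
      by_cases hc : n ≤ d * S (r + 1) + 1 ∧ d * S (r + 1) + n ≤ d * n + 1
      · refine ⟨some (if r < c then (g (r + 1), g r) else (g r, g (r + 1))),
          ((runs_ticks Q 1).bind (M := 0) ?_).mono (by omega), ?_, by simp⟩
        · rw [if_pos hc]
          exact runs_pure _ _ _
        · intro e he
          exact ⟨r, by omega, hc.1, hc.2, (Option.some.inj he).symm⟩
      · refine ⟨res, ((runs_ticks Q 1).bind (M := len + 1) ?_).mono (by omega), ?_, ?_⟩
        · rw [if_neg hc]
          exact hres
        · intro e he
          obtain ⟨t, ht, h⟩ := h1 e he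
          exact ⟨t, by omega, h⟩
        · intro t hrt ht hn1 hn2
          rcases hrt.eq_or_lt with rfl | hrt
          · exact absurd ⟨hn1, hn2⟩ hc
          · exact h2 t hrt (by omega) hn1 hn2

/-- The part of a round after the two nodes `i` and `j` have been drawn. -/
def roundAt [DecidableEq V] (d : ℕ) (vs : List V) (i j : V) : Prog V (Option (V × V)) := do
  let (path, c) ← reconstructPath vs i j
  Prog.ticks (3 * path.length)
  let size ← countBags path (path.take (c + 1)).reverse (path.drop c) c vs
    (List.replicate path.length 1)
  findSeparator vs.length d c 0 0 path size

theorem round_eq [DecidableEq V] (d : ℕ) (a b : V) (l : List V) :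
    round d a b l = (Prog.pick (l.length + 1) >>= fun x => Prog.pick (l.length + 1) >>= fun y =>
      (roundAt d (a :: b :: l) ((a :: b :: l).get x) ((a :: b :: l).get y) :
        Prog V (Option (V × V)))) := rfl

theorem countP_eq_card_filter [DecidableEq V] {vs : List V} (hnd : vs.Nodup) (P : V → Prop)
    [DecidablePred P] : vs.countP (fun k => P k) = (vs.toFinset.filter P).card := by
  rw [List.countP_eq_length_filter, ← List.toFinset_card_of_nodup (hnd.filter _),
    List.toFinset_filter]
  simp

end

variable {V : Type} [PartialOrder V] {Q : V → V → Bool}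

/-- Bag sizes are counted correctly; the sizes are listed as the values of a function. -/
theorem runs_countBags [DecidableEq V] [DecidableLE V] (hQ : ∀ i j, Q i j = true ↔ i < j)
    {m p q : V} {up down : List V} (h : IsFork m p q up down) {L : ℕ}
    (hu : (m :: up).length ≤ 2 ^ L) (hd : (m :: down).length ≤ 2 ^ L) (P : ℕ) (ks : List V) :
    ∀ f : ℕ → ℕ,
    Runs Q (countBags (up.reverse ++ m :: down) (m :: up) (m :: down) up.length ks
      ((List.range P).map f))
      ((List.range P).map fun t => f t +
        ks.countP fun k => k ∉ up.reverse ++ m :: down ∧ bagPos up down k = t)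
      (ks.length * (2 + 4 * L)) := by
  induction ks with
  | nil => intro f; rw [countBags]; simpa using runs_pure _ _ _
  | cons k ks ih =>
    intro f
    rw [countBags]
    refine ((runs_ticks Q 2).bind (M := ks.length * (2 + 4 * L) + 4 * L) ?_).mono
      (by
        have := Nat.add_one_mul ks.length (2 + 4 * L)
        simp only [List.length_cons]
        omega)
    by_cases hk : k ∈ up.reverse ++ m :: down
    · rw [if_pos hk]
      have := ih f
      simp only [List.countP_cons, hk, not_true_eq_false, false_and, decide_false,
        Bool.false_eq_true, if_false, add_zero]
      exact this.mono (by omega)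
    · rw [if_neg hk]
      have hku : k ∉ up := fun hx => hk (by simp [hx])
      have hkd : k ∉ down := fun hx => hk (by simp [hx])
      refine ((runs_findBag hQ h.sorted_up hku hu).bind ((runs_findBag hQ h.sorted_down hkd hd).bind
        (M := ks.length * (2 + 4 * L)) ?_)).mono (by omega)
      have hpos : (if up.countP (· ≤ k) = 0 then up.length + down.countP (· ≤ k)
        else up.length - up.countP (· ≤ k)) = bagPos up down k := rfl
      simp only [hpos]
      have hmod : ((List.range P).map f).modify (bagPos up down k) (· + 1) =
          (List.range P).map fun t => f t + if bagPos up down k = t then 1 else 0 := by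
        refine List.ext_getElem (by simp) fun t h1 h2 => ?_
        simp only [List.getElem_modify, List.getElem_map, List.getElem_range]
        split_ifs <;> rfl
      rw [hmod]
      have hc : ∀ t, f t + (k :: ks).countP
          (fun k => k ∉ up.reverse ++ m :: down ∧ bagPos up down k = t) =
          (f t + if bagPos up down k = t then 1 else 0) +
            ks.countP (fun k => k ∉ up.reverse ++ m :: down ∧ bagPos up down k = t) := by
        intro t
        rw [List.countP_cons]
        simp only [hk, not_false_eq_true, true_and, decide_eq_true_eq]
        omega
      simp only [hc]
      exact ih fun t => f t + if bagPos up down k = t then 1 else 0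

theorem length_le_of_sorted {l vs : List V} (hl : l.Pairwise (· < ·))
    (h : ∀ x ∈ l, x ∈ vs) : l.length ≤ vs.length := by
  have hnd : l.Nodup := hl.imp ne_of_lt
  exact (hnd.subperm h).length_le

variable [DecidableLE V]

namespace IsFork

variable {m p q : V} {up down : List V}

/-- Each node of the path lies in its own bag. -/
theorem countP_bagPos [DecidableEq V] (h : IsFork m p q up down) {vs : List V} (hnd : vs.Nodup)
    (hmem : ∀ x ∈ up.reverse ++ m :: down, x ∈ vs) {t : ℕ}
    (ht : t < up.length + 1 + down.length) :
    vs.countP (fun k => bagPos up down k = t) =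
      1 + vs.countP fun k => k ∉ up.reverse ++ m :: down ∧ bagPos up down k = t := by
  have h1 : vs.countP (fun k => k ∈ up.reverse ++ m :: down ∧ bagPos up down k = t) = 1 := by
    have hx : forkNode m up down t ∈ vs := hmem _ ((mem_path_iff m up down _).2 ⟨t, ht, rfl⟩)
    rw [← List.count_eq_one_of_mem hnd hx, List.count]
    refine List.countP_congr fun k _ => ?_
    simp only [decide_eq_true_eq, beq_iff_eq]
    constructor
    · rintro ⟨hk, rfl⟩
      obtain ⟨s, hs, rfl⟩ := (mem_path_iff m up down k).1 hk
      rw [h.bagPos_forkNode hs]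
    · rintro rfl
      exact ⟨(mem_path_iff m up down _).2 ⟨t, ht, rfl⟩, h.bagPos_forkNode ht⟩
  rw [← h1, List.countP_eq_countP_filter_add vs (fun k => decide (bagPos up down k = t))
    (fun k => decide (k ∈ up.reverse ++ m :: down)), List.countP_filter, List.countP_filter]
  congr 1
  · exact List.countP_congr fun k _ => by simp [and_comm]
  · exact List.countP_congr fun k _ => by simp [and_comm]

theorem countP_lt_succ (up down : List V) (vs : List V) (t : ℕ) :
    vs.countP (fun k => bagPos up down k < t + 1) =
      vs.countP (fun k => bagPos up down k < t) + vs.countP (fun k => bagPos up down k = t) := by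
  induction vs with
  | nil => rfl
  | cons k ks ih =>
    simp only [List.countP_cons, decide_eq_true_eq]
    rw [ih]
    split_ifs <;> omega

end IsFork

/-- The round finds an even separator whenever the path between the drawn nodes contains one, and
its time is of order `w log w`. -/
theorem exists_runs_roundAt [DecidableEq V] (hV : IsTreeOrder V)
    (hQ : ∀ i j, Q i j = true ↔ i < j) (d : ℕ) {L : ℕ} {vs : List V} (hnd : vs.Nodup)
    (h2 : 2 ≤ vs.length) (hL : vs.length ≤ 2 ^ L) (hW : IsSubtree vs.toFinset)
    {i j : V} (hi : i ∈ vs) (hj : j ∈ vs) :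
    ∃ res, Runs Q (roundAt d vs i j) res (35 * L * vs.length) ∧
      (∀ e, res = some e → IsEvenCut d vs.toFinset e) ∧
      ((i, j) ∈ goodPairs d vs.toFinset → res ≠ none) := by
  obtain ⟨m, p, q, up, down, hrun, hf, hpq, hmp, hmq, hm⟩ :=
    exists_runs_reconstructPath hV hQ hnd hL hW hi hj
  have hpvs : p ∈ vs := by rcases hpq with ⟨rfl, rfl⟩ | ⟨rfl, rfl⟩ <;> assumption
  have hqvs : q ∈ vs := by rcases hpq with ⟨rfl, rfl⟩ | ⟨rfl, rfl⟩ <;> assumption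
  have hmem_of : ∀ x, m ≤ x → x ≤ p ∨ x ≤ q → x ∈ vs := by
    intro x hmx hx
    rw [← List.mem_toFinset] at hm hpvs hqvs ⊢
    rcases hx with hx | hx
    · exact hW.convex hm hpvs hmx hx
    · exact hW.convex hm hqvs hmx hx
  set P := up.length + 1 + down.length with hP
  have hnode : ∀ {t}, t < P → forkNode m up down t ∈ vs := fun ht =>
    hmem_of _ (hf.le_of_mem ht).1 (hf.le_of_mem ht).2
  have hmem : ∀ x ∈ up.reverse ++ m :: down, x ∈ vs := by
    intro x hx
    obtain ⟨t, ht, rfl⟩ := (mem_path_iff m up down x).1 hx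
    exact hnode ht
  have hulen : (m :: up).length ≤ vs.length := length_le_of_sorted hf.sorted_up
    fun x hx => hmem_of x ((hf.mem_up x).1 hx).1 (Or.inl ((hf.mem_up x).1 hx).2)
  have hdlen : (m :: down).length ≤ vs.length := length_le_of_sorted hf.sorted_down
    fun x hx => hmem_of x ((hf.mem_down x).1 hx).1 (Or.inr ((hf.mem_down x).1 hx).2)
  have hplen : (up.reverse ++ m :: down).length = P := by simp [hP]; omega
  -- the cumulative bag sizes, and the edges of the path
  set S : ℕ → ℕ := fun t => vs.countP fun k => bagPos up down k < t with hS
  set f : ℕ → ℕ := fun t => vs.countP fun k => bagPos up down k = t with hfdef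
  have hcount := runs_countBags hQ hf (hulen.trans hL) (hdlen.trans hL) P vs fun _ => 1
  have hsizes : ((List.range P).map fun t => 1 +
      vs.countP fun k => k ∉ up.reverse ++ m :: down ∧ bagPos up down k = t) =
      (List.range P).map f := by
    refine List.map_congr_left fun t ht => ?_
    rw [hfdef]
    exact (hf.countP_bagPos hnd hmem (List.mem_range.1 ht)).symm
  rw [hsizes] at hcount
  obtain ⟨res, hres, hsome, hnone⟩ := exists_runs_findSeparator (Q := Q) vs.length d up.length
    (forkNode m up down) f S (IsFork.countP_lt_succ up down vs) P 0
  have hS0 : S 0 = 0 := by simp [hS]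
  rw [hS0, ← List.range_eq_range', ← map_forkNode] at hres
  have hcard : vs.toFinset.card = vs.length := List.toFinset_card_of_nodup hnd
  have hSlt : ∀ t, t < up.length →
      S (t + 1) = (below vs.toFinset (forkNode m up down t)).card := by
    intro t ht
    rw [hS, below, ← countP_eq_card_filter hnd]
    exact List.countP_congr fun k _ => by simp [hf.bagPos_lt_iff_of_lt ht k]
  have hSge : ∀ t, up.length ≤ t → t < up.length + down.length →
      S (t + 1) = (above vs.toFinset (forkNode m up down (t + 1))).card := by
    intro t ht ht'
    rw [hS, above, ← countP_eq_card_filter hnd]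
    exact List.countP_congr fun k _ => by simp [hf.bagPos_lt_iff_of_ge ht ht' k]
  have heven : ∀ x y : ℕ, x + y = vs.length → (vs.length ≤ d * y + 1 ↔
      d * x + vs.length ≤ d * vs.length + 1) := by
    intro x y hxy
    rw [← hxy, Nat.mul_add]
    omega
  refine ⟨res, ?_, ?_, ?_⟩
  · unfold roundAt
    have hLpos : 1 ≤ L := by
      rcases Nat.eq_zero_or_pos L with rfl | h
      · simp at hL; omega
      · exact h
    have hrep : List.replicate P 1 = (List.range P).map fun _ => 1 := by simp
    have htake : ((up.reverse ++ m :: down).take (up.length + 1)).reverse = m :: up := by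
      rw [← List.length_reverse, List.take_length_add_append]; simp
    have hdrop : (up.reverse ++ m :: down).drop up.length = m :: down := by
      rw [← List.length_reverse, List.drop_left]
    refine (hrun.bind ((runs_ticks Q _).bind (Runs.bind (a := (List.range P).map f)
      (M := P) (N := vs.length * (2 + 4 * L)) ?_ hres))).mono ?_
    · rw [hplen, htake, hdrop, hrep]
      exact hcount
    · rw [hplen]
      simp only [List.length_cons] at hulen hdlen
      have hPle : P ≤ 2 * vs.length := by omega
      have h1 : vs.length ≤ L * vs.length := Nat.le_mul_of_pos_left _ hLpos
      have h3 : vs.length * (2 + 4 * L) = 2 * vs.length + 4 * (L * vs.length) := by ring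
      have h4 : 9 * L * vs.length = 9 * (L * vs.length) := by ring
      have h5 : 35 * L * vs.length = 35 * (L * vs.length) := by ring
      omega
  · intro e he
    obtain ⟨t, ht, h1, h2', rfl⟩ := hsome e he
    rw [zero_add] at ht
    by_cases htc : t < up.length
    · have hsum := card_below_add_card_above vs.toFinset (forkNode m up down t)
      rw [if_pos htc]
      rw [hSlt t htc] at h1 h2'
      refine ⟨List.mem_toFinset.2 (hnode ht), List.mem_toFinset.2 (hnode (by omega)),
        hf.covBy_of_lt htc, by rwa [hcard], ?_⟩
      rw [hcard] at hsum ⊢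
      exact (heven _ _ hsum).2 h2'
    · have hsum := card_below_add_card_above vs.toFinset (forkNode m up down (t + 1))
      rw [if_neg htc]
      rw [hSge t (by omega) (by omega)] at h1 h2'
      refine ⟨List.mem_toFinset.2 (hnode (by omega)), List.mem_toFinset.2 (hnode ht),
        hf.covBy_of_ge (by omega) (by omega), ?_, by rwa [hcard]⟩
      rw [hcard] at hsum ⊢
      exact (heven _ _ ((add_comm _ _).trans hsum)).2 h2'
  · intro hgood
    obtain ⟨_, ⟨u, v⟩, he, hsep⟩ := mem_goodPairs.1 hgood
    have hsum := card_below_add_card_above vs.toFinset v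
    have hb := he.card_le_below
    have ha := he.card_le_above
    simp only at hb ha hsep
    rw [hcard] at hsum hb ha
    have hsep' : ¬ (v ≤ p ↔ v ≤ q) := by
      rcases hpq with ⟨rfl, rfl⟩ | ⟨rfl, rfl⟩
      · exact hsep
      · exact fun h => hsep h.symm
    by_cases hvp : v ≤ p
    · have hvq : ¬ v ≤ q := fun h => hsep' (iff_of_true hvp h)
      have hmv : m < v := by
        rcases hV.chain hvp hmp with h | h
        · exact absurd (h.trans hmq) hvq
        · exact lt_of_le_of_ne h fun e => hvq (e ▸ hmq)
      have hv : v ∈ up := ((List.mem_cons.1 ((hf.mem_up v).2 ⟨hmv.le, hvp⟩)).resolve_left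
        hmv.ne')
      obtain ⟨s, hs, rfl⟩ := List.getElem_of_mem hv
      have hlt : up.length - 1 - s < up.length := by omega
      have hnodev : forkNode m up down (up.length - 1 - s) = up[s] := by
        rw [forkNode_of_lt hlt]
        congr 1
        omega
      refine hnone (up.length - 1 - s) (Nat.zero_le _) (by omega) ?_ ?_
      · rw [hSlt _ hlt, hnodev]; exact hb
      · rw [hSlt _ hlt, hnodev]
        exact (heven _ _ hsum).1 ha
    · have hvq : v ≤ q := by
        by_contra h
        exact hsep' (iff_of_false hvp h)
      have hmv : m < v := by
        rcases hV.chain hvq hmq with h | h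
        · exact absurd (h.trans hmp) hvp
        · exact lt_of_le_of_ne h fun e => hvp (e ▸ hmp)
      have hv : v ∈ down := ((List.mem_cons.1 ((hf.mem_down v).2 ⟨hmv.le, hvq⟩)).resolve_left
        hmv.ne')
      obtain ⟨s, hs, rfl⟩ := List.getElem_of_mem hv
      have hnodev : forkNode m up down (up.length + s + 1) = down[s] := by
        rw [forkNode_of_gt (by omega) (by omega)]
        congr 1
        omega
      refine hnone (up.length + s) (Nat.zero_le _) (by omega) ?_ ?_
      · rw [hSge _ (by omega) (by omega), hnodev]; exact ha
      · rw [hSge _ (by omega) (by omega), hnodev]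
        exact (heven _ _ ((add_comm _ _).trans hsum)).1 hb

end Round

/-! ### The recursion -/

section Reconstruct

variable {V : Type} [DecidableEq V] {Q : V → V → Bool}

/-- The part of the algorithm that follows a round with result `sep`. -/
def afterRound (d budget : ℕ) (vs : List V) (sep : Option (V × V)) :
    Prog V (Finset (V × V)) :=
  match sep with
  | none => reconstruct d budget vs
  | some (i, j) => do
    let (vs₁, vs₂) ← splitNodes j vs
    let e₁ ← reconstruct d budget vs₁
    let e₂ ← reconstruct d budget (j :: vs₂)
    Prog.ticks vs.length
    pure (insert (i, j) (e₁ ∪ e₂))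

theorem reconstruct_succ (d budget : ℕ) (a b : V) (l : List V) :
    reconstruct d (budget + 1) (a :: b :: l) =
      (round d a b l >>= afterRound d budget (a :: b :: l)) := rfl

/-- A larger budget only removes aborts. -/
theorem refines_reconstruct_succ (d budget : ℕ) :
    ∀ vs : List V, Refines (reconstruct d budget vs) (reconstruct d (budget + 1) vs) := by
  induction budget with
  | zero => intro vs; exact .abort _
  | succ budget ih =>
    intro vs
    match vs with
    | [] => exact .refl _
    | [_] => exact .refl _
    | a :: b :: l =>
      rw [reconstruct_succ, reconstruct_succ]
      refine (Refines.refl _).bind fun sep => ?_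
      match sep with
      | none => exact ih _
      | some (i, j) =>
        exact (Refines.refl _).bind fun _ => (ih _).bind fun _ => (ih _).bind fun _ => .refl _

theorem nodup_splitNodes_snd {vs : List V} (hnd : vs.Nodup) (j : V) :
    (j :: vs.filter fun k => k ≠ j ∧ Q j k = true).Nodup :=
  List.nodup_cons.2 ⟨by simp [List.mem_filter], hnd.filter _⟩

variable [PartialOrder V] [DecidableLE V]

theorem toFinset_splitNodes_fst (hQ : ∀ i j, Q i j = true ↔ i < j) (j : V) (vs : List V) :
    (vs.filter fun k => k ≠ j ∧ Q j k = false).toFinset = above vs.toFinset j := by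
  ext k
  simp only [List.mem_toFinset, List.mem_filter, decide_eq_true_eq, mem_above, ← Bool.not_eq_true,
    hQ, lt_iff_le_and_ne]
  refine and_congr_right fun _ => ⟨fun h hle => h.2 ⟨hle, h.1.symm⟩, fun h => ⟨?_, fun h' => h h'.1⟩⟩
  rintro rfl
  exact h le_rfl

theorem toFinset_splitNodes_snd (hQ : ∀ i j, Q i j = true ↔ i < j) {j : V} {vs : List V}
    (hj : j ∈ vs) :
    (j :: vs.filter fun k => k ≠ j ∧ Q j k = true).toFinset = below vs.toFinset j := by
  ext k
  simp only [List.mem_toFinset, List.mem_cons, List.mem_filter, decide_eq_true_eq, mem_below, hQ]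
  constructor
  · rintro (rfl | ⟨hk, _, hjk⟩)
    · exact ⟨hj, le_rfl⟩
    · exact ⟨hk, hjk.le⟩
  · rintro ⟨hk, hjk⟩
    rcases hjk.eq_or_lt with rfl | hlt
    · exact Or.inl rfl
    · exact Or.inr ⟨hk, hlt.ne', hlt⟩

theorem sat_round (hV : IsTreeOrder V) (hQ : ∀ i j, Q i j = true ↔ i < j) (d : ℕ) {a b : V}
    {l : List V} (hnd : (a :: b :: l).Nodup) (hW : IsSubtree (a :: b :: l).toFinset) :
    Sat Q (fun sep => ∀ e, sep = some e → IsEvenCut d (a :: b :: l).toFinset e) (round d a b l) := by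
  rw [round_eq]
  refine (sat_pick _ _).bind fun x _ => (sat_pick _ _).bind fun y _ => ?_
  obtain ⟨res, hres, h, _⟩ := exists_runs_roundAt hV hQ d hnd (by simp)
    (Nat.lt_two_pow_self (n := (a :: b :: l).length)).le hW (List.get_mem (a :: b :: l) x)
    (List.get_mem (a :: b :: l) y)
  exact hres.sat h

/-- Every output of the algorithm is the set of edges inside the given vertex set. -/
theorem sat_reconstruct (hV : IsTreeOrder V) (hQ : ∀ i j, Q i j = true ↔ i < j) (d budget : ℕ) :
    ∀ vs : List V, vs.Nodup → IsSubtree vs.toFinset →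
      Sat Q (· = edgesIn vs.toFinset) (reconstruct d budget vs) := by
  induction budget with
  | zero => intro vs _ _; trivial
  | succ budget ih =>
    intro vs hnd hW
    match vs, hnd, hW with
    | [], _, _ => exact (edgesIn_of_card_le_one (by simp)).symm
    | [_], _, _ => exact (edgesIn_of_card_le_one (by simp)).symm
    | a :: b :: l, hnd, hW =>
      rw [reconstruct_succ]
      refine (sat_round hV hQ d hnd hW).bind fun sep hsep => ?_
      match sep with
      | none => exact ih _ hnd hW
      | some (i, j) =>
        have he := hsep _ rfl
        have hi : i ∈ (a :: b :: l).toFinset := he.fst_mem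
        have hj : j ∈ (a :: b :: l).toFinset := he.snd_mem
        have hij : i ⋖ j := he.covBy
        have h1 := toFinset_splitNodes_fst hQ j (a :: b :: l)
        have h2 := toFinset_splitNodes_snd hQ (List.mem_toFinset.1 hj)
        refine Sat.bind (P := (· = _)) ((runs_splitNodes j _).sat rfl) fun p hp => ?_
        subst hp
        refine (ih _ (hnd.filter _) (by rw [h1]; exact hW.above hi hij)).bind fun e₁ he₁ => ?_
        refine (ih _ (nodup_splitNodes_snd hnd j) (by rw [h2]; exact hW.below hj)).bind
          fun e₂ he₂ => ?_
        refine ((runs_ticks Q _).sat (P := fun _ => True) trivial).bind fun _ _ => ?_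
        change insert (i, j) (e₁ ∪ e₂) = _
        rw [he₁, he₂, h1, h2, edgesIn_eq_insert hV hi hj hij]

/-- The pairs of positions in a list that hold a good pair are as many as the good pairs. -/
theorem card_goodPairs_mul_le (d : ℕ) (vs : List V) (M : ℝ≥0∞) :
    (goodPairs d vs.toFinset).card * M ≤
      ∑ x : Fin vs.length, ∑ y : Fin vs.length,
        if (vs.get x, vs.get y) ∈ goodPairs d vs.toFinset then M else 0 := by
  classical
  rw [← Fintype.sum_prod_type' (f := fun x y : Fin vs.length =>
    if (vs.get x, vs.get y) ∈ goodPairs d vs.toFinset then M else 0), ← Finset.sum_filter,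
    Finset.sum_const, nsmul_eq_mul]
  refine mul_le_mul_left ?_ M
  refine Nat.cast_le.2 (Finset.card_le_card_of_surjOn (fun p => (vs.get p.1, vs.get p.2)) ?_)
  rintro ⟨i, j⟩ hij
  obtain ⟨⟨hi, hj⟩, _⟩ := mem_goodPairs.1 hij
  obtain ⟨x, rfl⟩ := List.get_of_mem (List.mem_toFinset.1 hi)
  obtain ⟨y, rfl⟩ := List.get_of_mem (List.mem_toFinset.1 hj)
  exact ⟨(x, y), by simpa using hij, rfl⟩

/-- The expected time after a round that has found an even separator. -/
theorem expTime_afterRound_le (hQ : ∀ i j, Q i j = true ↔ i < j) (A : ℝ≥0∞) (d budget : ℕ)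
    {vs : List V} {i j : V} (hj : j ∈ vs) {F : Finset V → ℝ≥0∞}
    (h₁ : ∀ vs' : List V, vs'.Nodup → vs'.toFinset = above vs.toFinset j →
      expTime Q A (reconstruct d budget vs') (fun _ => 0) ≤ F (above vs.toFinset j))
    (h₂ : ∀ vs' : List V, vs'.Nodup → vs'.toFinset = below vs.toFinset j →
      expTime Q A (reconstruct d budget vs') (fun _ => 0) ≤ F (below vs.toFinset j))
    (hnd : vs.Nodup) :
    expTime Q A (afterRound d budget vs (some (i, j))) (fun _ => 0) ≤
      F (below vs.toFinset j) + F (above vs.toFinset j) + 3 * vs.length := by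
  have hconst : ∀ (p : Prog V (Finset (V × V))) (c : ℝ≥0∞),
      expTime Q A p (fun _ => c) ≤ expTime Q A p (fun _ => 0) + c := by
    intro p c
    simpa using expTime_add_const_le Q A p (fun _ => 0) c
  change expTime Q A (splitNodes j vs >>= fun p => reconstruct d budget p.1 >>= fun e₁ =>
    reconstruct d budget (j :: p.2) >>= fun e₂ => Prog.ticks vs.length >>= fun _ =>
    (pure (insert (i, j) (e₁ ∪ e₂)) : Prog V (Finset (V × V)))) (fun _ => 0) ≤ _
  rw [expTime_bind]
  refine (expTime_le_of_runs (runs_splitNodes j vs) A _).trans ?_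
  rw [expTime_bind]
  have hlast : ∀ e₁ e₂ : Finset (V × V), expTime Q A (Prog.ticks vs.length >>= fun _ =>
      (pure (insert (i, j) (e₁ ∪ e₂)) : Prog V (Finset (V × V)))) (fun _ => 0) ≤ vs.length := by
    intro e₁ e₂
    have := expTime_le_of_runs (Runs.bind (runs_ticks Q vs.length)
      (g := fun _ => pure (insert (i, j) (e₁ ∪ e₂))) (runs_pure Q _ 0)) A (fun _ => 0)
    simpa using this
  have h2 := h₂ _ (nodup_splitNodes_snd (Q := Q) hnd j) (toFinset_splitNodes_snd hQ hj)
  have h1 := h₁ _ (hnd.filter _) (toFinset_splitNodes_fst hQ j vs)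
  have hsecond : ∀ e₁ : Finset (V × V), expTime Q A (reconstruct d budget
      (j :: vs.filter fun k => k ≠ j ∧ Q j k = true) >>= fun e₂ => Prog.ticks vs.length >>= fun _ =>
      (pure (insert (i, j) (e₁ ∪ e₂)) : Prog V (Finset (V × V)))) (fun _ => 0) ≤
      F (below vs.toFinset j) + vs.length := by
    intro e₁
    rw [expTime_bind]
    exact ((expTime_mono Q A _ (hlast e₁)).trans (hconst _ _)).trans (add_le_add_left h2 _)
  refine (add_le_add_left ((expTime_mono Q A _ hsecond).trans (hconst _ _)) _).trans ?_
  refine (add_le_add_left (add_le_add_left h1 _) _).trans (le_of_eq ?_)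
  push_cast
  ring

/-- The expected time of the algorithm, where an aborted run is charged its budget, is bounded by
the cost of the worst cuts. Per vertex and unit of `L`, a round takes time `35`, its draws and the
charge for one unit of budget take at most `2`, and the work after a cut takes at most `3`. -/
theorem expTime_reconstruct_le (hV : IsTreeOrder V) (hQ : ∀ i j, Q i j = true ↔ i < j) (d L : ℕ)
    (budget : ℕ) :
    ∀ vs : List V, vs.Nodup → vs.length ≤ 2 ^ L → IsSubtree vs.toFinset →
      expTime Q budget (reconstruct d budget vs) (fun _ => 0) ≤
        40 * L * cutCost d vs.toFinset := by
  induction budget with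
  | zero => intro vs _ _ _; simp [reconstruct, expTime]
  | succ budget ih =>
    intro vs hnd hL hW
    match vs, hnd, hL, hW with
    | [], _, _, _ => exact zero_le
    | [_], _, _, _ => exact zero_le
    | a :: b :: l, hnd, hL, hW =>
      rw [reconstruct_succ]
      set vs := a :: b :: l with hvs
      have hlen : vs.length = l.length + 1 + 1 := rfl
      have hcard : vs.toFinset.card = vs.length := List.toFinset_card_of_nodup hnd
      have hLpos : 1 ≤ L := by
        rcases Nat.eq_zero_or_pos L with rfl | h
        · rw [hlen] at hL; simp at hL
        · exact h
      set W := vs.toFinset with hWdef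
      set w : ℝ≥0∞ := (vs.length : ℝ≥0∞) with hw
      have hw0 : w ≠ 0 := by rw [hw, hlen]; simp
      have hwt : w ≠ ⊤ := ENNReal.natCast_ne_top _
      set g : ℝ≥0∞ := ((goodPairs d W).card : ℝ≥0∞) with hg
      set G : ℝ≥0∞ := 40 * L * cutCost d W with hG
      have h2 : 2 ≤ W.card := by rw [hcard, hlen]; omega
      rcases eq_or_ne g 0 with hg0 | hg0
      · -- without good pairs `cutCost` is infinite
        have : cutCost d W = ⊤ := by
          rw [cutCost, if_pos h2, ← hg, hg0, ENNReal.div_zero, top_add]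
          rw [hcard]
          exact pow_ne_zero 3 hw0
        rw [hG, this, ENNReal.mul_top]
        · exact le_top
        · simp; omega
      have hgt : g ≠ ⊤ := ENNReal.natCast_ne_top _
      have hLle : ∀ vs' : List V, vs'.Nodup → vs'.toFinset ⊆ W → vs'.length ≤ 2 ^ L := by
        intro vs' hnd' hsub
        rw [← List.toFinset_card_of_nodup hnd']
        exact (Finset.card_le_card hsub).trans (hcard.trans_le hL)
      -- the value of the two kinds of outcomes of a round
      set h : Option (V × V) → ℝ≥0∞ := fun sep =>
        expTime Q budget (afterRound d budget vs sep) (fun _ => 0) with hh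
      have hnone : h none ≤ G := ih vs hnd hL hW
      have hgw : g ≤ w ^ 2 := by
        have := card_goodPairs_le d W
        rw [hcard] at this
        rw [hg, hw]
        exact_mod_cast this
      have hwg : w ≤ w ^ 3 / g := by
        rw [ENNReal.le_div_iff_mul_le (Or.inl hg0) (Or.inl hgt)]
        calc w * g ≤ w * w ^ 2 := mul_le_mul_right hgw w
          _ = w ^ 3 := by ring
      have hsome : ∀ e, IsEvenCut d W e → h (some e) + 37 * L * (w ^ 3 / g) ≤ G := by
        rintro ⟨i, j⟩ he
        have hi : i ∈ W := he.fst_mem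
        have hj : j ∈ W := he.snd_mem
        have hij : i ⋖ j := he.covBy
        have h1 : h (some (i, j)) ≤ 40 * L * cutCost d (below W j) +
            40 * L * cutCost d (above W j) + 3 * w := by
          refine expTime_afterRound_le hQ budget d budget (F := fun W => 40 * L * cutCost d W)
            (List.mem_toFinset.1 hj) ?_ ?_ hnd
          · intro vs' hnd' hvs'
            rw [← hvs']
            exact ih vs' hnd' (hLle vs' hnd' (by rw [hvs']; exact above_subset _ _))
              (by rw [hvs']; exact hW.above hi hij)
          · intro vs' hnd' hvs'
            rw [← hvs']
            exact ih vs' hnd' (hLle vs' hnd' (by rw [hvs']; exact below_subset _ _))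
              (by rw [hvs']; exact hW.below hj)
        have h3 := cutCost_add_le h2 he
        rw [hcard, ← hg, ← hw] at h3
        have hL1 : (1 : ℝ≥0∞) ≤ L := by exact_mod_cast hLpos
        calc h (some (i, j)) + 37 * L * (w ^ 3 / g)
            ≤ (40 * L * cutCost d (below W j) + 40 * L * cutCost d (above W j) +
              3 * (L * (w ^ 3 / g))) + 37 * L * (w ^ 3 / g) := by
              refine add_le_add_left (h1.trans (add_le_add_right (mul_le_mul_right ?_ 3) _)) _
              exact hwg.trans (le_mul_of_one_le_left zero_le hL1)
          _ = 40 * L * (w ^ 3 / g + (cutCost d (below W j) + cutCost d (above W j))) := by ring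
          _ ≤ G := mul_le_mul_right h3 _
      have hval : ∀ x y : Fin vs.length, expTime Q budget (roundAt d vs (vs.get x) (vs.get y)) h +
          (if (vs.get x, vs.get y) ∈ goodPairs d W then 37 * L * (w ^ 3 / g) else 0) ≤
          G + (35 * L * vs.length : ℕ) := by
        intro x y
        obtain ⟨res, hres, hcut, hgood⟩ := exists_runs_roundAt hV hQ d hnd (by omega) hL hW
          (List.get_mem _ x) (List.get_mem _ y)
        refine (add_le_add_left (expTime_le_of_runs hres budget h) _).trans ?_
        rw [add_right_comm]
        refine add_le_add_left ?_ _
        cases res with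
        | none =>
          rw [if_neg fun h => hgood h rfl, add_zero]
          exact hnone
        | some e =>
          refine le_trans (add_le_add_right ?_ _) (hsome e (hcut e rfl))
          split_ifs
          · exact le_rfl
          · exact zero_le
      -- averaging over the drawn nodes
      have havg : (∑ x : Fin vs.length, (∑ y : Fin vs.length,
          expTime Q budget (roundAt d vs (vs.get x) (vs.get y)) h) / w) / w + 37 * L * w ≤
          G + (35 * L * vs.length : ℕ) := by
        have hsum : ∑ x : Fin vs.length, ∑ y : Fin vs.length,
            (expTime Q budget (roundAt d vs (vs.get x) (vs.get y)) h +
            (if (vs.get x, vs.get y) ∈ goodPairs d W then 37 * L * (w ^ 3 / g) else 0)) ≤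
            ∑ x : Fin vs.length, ∑ y : Fin vs.length, (G + (35 * L * vs.length : ℕ)) :=
          Finset.sum_le_sum fun x _ => Finset.sum_le_sum fun y _ => hval x y
        simp only [Finset.sum_add_distrib, Finset.sum_const, Finset.card_univ, Fintype.card_fin,
          nsmul_eq_mul] at hsum
        rw [← hw] at hsum
        have hge := (add_le_add_right (card_goodPairs_mul_le d vs (37 * L * (w ^ 3 / g))) _).trans
          hsum
        rw [← hWdef, ← hg] at hge
        have hgm : g * (37 * L * (w ^ 3 / g)) = 37 * L * w * w * w := by
          calc g * (37 * L * (w ^ 3 / g)) = 37 * L * (g * (w ^ 3 / g)) := by ring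
            _ = 37 * L * w ^ 3 := by rw [ENNReal.mul_div_cancel hg0 hgt]
            _ = _ := by ring
        rw [hgm] at hge
        simp only [div_eq_mul_inv]
        rw [← Finset.sum_mul]
        have hinv : w * w⁻¹ = 1 := ENNReal.mul_inv_cancel hw0 hwt
        have hge' := mul_le_mul_left (mul_le_mul_left hge w⁻¹) w⁻¹
        calc _ = ((∑ x : Fin vs.length, ∑ y : Fin vs.length,
              expTime Q budget (roundAt d vs (vs.get x) (vs.get y)) h) +
              37 * L * w * w * w) * w⁻¹ * w⁻¹ := by
              rw [add_mul, add_mul]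
              congr 1
              rw [mul_assoc (37 * L * w * w), hinv, mul_one, mul_assoc (37 * L * w), hinv, mul_one]
          _ ≤ _ := hge'
          _ = (w * w⁻¹) * (w * w⁻¹) * (G + (35 * L * vs.length : ℕ)) := by ring
          _ = _ := by rw [hinv, one_mul, one_mul]
      rw [Nat.cast_add_one]
      refine (expTime_abort_succ_le Q budget _ _).trans ?_
      rw [expTime_bind, round_eq, expTime_bind, expTime_pick]
      simp only [expTime_bind, expTime_pick]
      rw [sum_add_const_div]
      change (∑ x : Fin vs.length, (∑ y : Fin vs.length,
          expTime Q budget (roundAt d vs (vs.get x) (vs.get y)) h) / w) / w + 1 + 1 + 1 ≤ G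
      have hN : ((35 * L * vs.length : ℕ) : ℝ≥0∞) + (1 + 1 + 1) ≤ 37 * L * w := by
        have : 35 * L * vs.length + (1 + 1 + 1) ≤ 37 * L * vs.length := by
          have h1 : 1 * 2 ≤ L * vs.length := Nat.mul_le_mul hLpos (by omega)
          have h3 : 35 * L * vs.length = 35 * (L * vs.length) := by ring
          have h4 : 37 * L * vs.length = 37 * (L * vs.length) := by ring
          omega
        rw [hw]
        exact_mod_cast this
      have hfin : ((35 * L * vs.length : ℕ) : ℝ≥0∞) ≠ ⊤ := ENNReal.natCast_ne_top _
      refine (ENNReal.add_le_add_iff_right hfin).1 (le_trans ?_ havg)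
      refine le_trans (le_of_eq ?_) (add_le_add_right hN _)
      ring

end Reconstruct

/-! ### Output and expected time of the algorithm -/

theorem isSubtree_of_forall_mem {V : Type} [PartialOrder V] (hV : IsTreeOrder V) {W : Finset V}
    (hW : ∀ x, x ∈ W) : IsSubtree W where
  root := hV.root.imp fun _ hr => ⟨hW _, fun x _ => hr x⟩
  convex := fun _ _ _ _ => hW _

section Main

variable {V : Type} [Fintype V] [DecidableEq V] {T : Digraph V}

theorem sat_reconstruct_edgeSet (hT : IsRootedTree T) (d budget : ℕ) {vs : List V}
    (hnd : vs.Nodup) (hvs : ∀ x, x ∈ vs) :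
    Sat (pathQuery T) (· = edgeSet T) (reconstruct d budget vs) := by
  let _ := hT.partialOrder
  let _ : DecidableLE V := Classical.decRel _
  have h := sat_reconstruct hT.isTreeOrder (Q := pathQuery T)
    (fun i j => by rw [hT.lt_iff]; simp [pathQuery]) d budget vs hnd
    (isSubtree_of_forall_mem hT.isTreeOrder fun x => List.mem_toFinset.2 (hvs x))
  have he : edgesIn vs.toFinset = edgeSet T := by
    ext e
    simp only [mem_edgesIn, edgeSet, Finset.mem_filter, Finset.mem_univ, List.mem_toFinset, hvs,
      true_and, and_self]
    exact hT.covBy_iff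
  rwa [he] at h

theorem expTime_reconstruct_le_mul_log (hT : IsRootedTree T) {d : ℕ} (hd : ∀ v, degree T v ≤ d)
    (budget : ℕ) {vs : List V} (hnd : vs.Nodup) (hvs : ∀ x, x ∈ vs) {L : ℕ}
    (hL : vs.length ≤ 2 ^ L) :
    expTime (pathQuery T) budget (reconstruct d budget vs) (fun _ => 0) ≤
      40 * L * ENNReal.ofReal (3000 * d * (vs.length * Real.log vs.length)) := by
  let _ := hT.partialOrder
  let _ : DecidableLE V := Classical.decRel _
  have hW : IsSubtree vs.toFinset :=
    isSubtree_of_forall_mem hT.isTreeOrder fun x => List.mem_toFinset.2 (hvs x)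
  have h1 := expTime_reconstruct_le hT.isTreeOrder (Q := pathQuery T)
    (fun i j => by rw [hT.lt_iff]; simp [pathQuery]) d L budget vs hnd hL hW
  have h2 := cutCost_le_mul_log hT.isTreeOrder (fun v => (hT.card_nbrs_le v).trans (hd v))
    vs.toFinset hW
  rw [List.toFinset_card_of_nodup hnd] at h2
  exact h1.trans (mul_le_mul_right h2 _)

theorem clog_two_le_mul_log {n : ℕ} (hn : 1 ≤ n) : (Nat.clog 2 n : ℝ) ≤ 3 * Real.log n := by
  rcases hn.eq_or_lt with rfl | hn
  · simp
  have h1 : 2 ^ (Nat.clog 2 n).pred < n := Nat.pow_pred_clog_lt_self one_lt_two hn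
  have h2 : 0 < Nat.clog 2 n := Nat.clog_pos one_lt_two hn
  have h3 : ((Nat.clog 2 n).pred : ℝ) * Real.log 2 ≤ Real.log n := by
    rw [← Real.log_pow]
    exact Real.log_le_log (by positivity) (by exact_mod_cast h1.le)
  have h4 : Real.log 2 ≤ Real.log n := Real.log_le_log two_pos (by exact_mod_cast hn)
  have h5 : ((Nat.clog 2 n).pred : ℝ) + 1 = Nat.clog 2 n := by
    exact_mod_cast Nat.succ_pred_eq_of_pos h2
  have h6 := Real.log_two_gt_d9
  rw [← h5]
  nlinarith

end Main

end TreeReconstruction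

theorem mainTheorem1 :
    ∃ C : ℝ, 0 < C ∧ ∀ (n d : ℕ) (T : Digraph (Fin n)),
      IsRootedTree T → (∀ v, degree T v ≤ d) →
        (reconstructionLaw d T).toOuterMeasure {o | ∃ c, o = some (edgeSet T, c)} = 1 ∧
        ∀ cost ∈ ({Cost.queries, Cost.time} : Set (Cost → ℕ)),
          expectedCost (reconstructionLaw d T) cost
              ≤ ENNReal.ofReal (C * (d * n * Real.log n ^ 2)) ∧
          ∀ δ : ℝ, 0 < δ → δ < 1 →
            ENNReal.ofReal (1 - δ) ≤ (reconstructionLaw d T).toOuterMeasure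
              (costAtMost cost (C * (1 / δ * (d * n * Real.log n ^ 2)))) := by
  -- the constant is the product of `40` (time per unit of `cutCost` and of `⌈log₂ n⌉`), `3` (which
  -- bounds `⌈log₂ n⌉ / log n`) and `3000` (from the bound on `cutCost`)
  refine ⟨360000, by norm_num, fun n d T hT hd => ?_⟩
  have hn : 1 ≤ n := by
    obtain ⟨r, _⟩ := hT
    exact Nat.one_le_iff_ne_zero.2 fun h => by subst h; exact r.elim0
  set M : ℝ := 360000 * (d * n * Real.log n ^ 2) with hM
  have hlog : 0 ≤ Real.log n := Real.log_natCast_nonneg n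
  have hM0 : 0 ≤ M := by positivity
  set p : ℕ → PMF (Option (Finset (Fin n × Fin n) × Cost)) := fun budget =>
    (reconstruct d budget (List.finRange n)).run (pathQuery T) with hp
  have hmono : ∀ b, Monotone fun m => p m (some b) := fun b =>
    monotone_nat_of_le_succ fun m => (refines_reconstruct_succ d m _).run_le _ b
  have hexp : ∀ m : ℕ, p m none * m + ∑' x, p m (some x) * x.2.time ≤ ENNReal.ofReal M := by
    intro m
    have h1 := Prog.tsum_run_le_expTime (pathQuery T) m (reconstruct d m (List.finRange n))
      (fun _ => 0)
    rw [tsum_option] at h1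
    simp only [Prog.outcomeValue, zero_add] at h1
    refine h1.trans ((expTime_reconstruct_le_mul_log hT hd m (List.nodup_finRange n)
      List.mem_finRange (L := Nat.clog 2 n) ?_).trans ?_)
    · rw [List.length_finRange]
      exact Nat.le_pow_clog one_lt_two n
    · rw [List.length_finRange, ← ENNReal.ofReal_natCast (Nat.clog 2 n),
        ← ENNReal.ofReal_ofNat 40, ← ENNReal.ofReal_mul (by norm_num),
        ← ENNReal.ofReal_mul (by positivity)]
      refine ENNReal.ofReal_le_ofReal ?_
      have h2 := mul_le_mul_of_nonneg_right (clog_two_le_mul_log hn)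
        (by positivity : 0 ≤ 120000 * ((d : ℝ) * (n * Real.log n)))
      rw [hM]
      linarith
  obtain ⟨hnone, htime⟩ := expectedCost_limitLaw_le hmono ENNReal.ofReal_ne_top hexp
  have hsupp : ∀ y, limitLaw p (some y) ≠ 0 → y.1 = edgeSet T ∧ y.2.queries ≤ y.2.time := by
    intro y hy
    rw [limitLaw_some hmono, ne_eq, ENNReal.iSup_eq_zero, not_forall] at hy
    obtain ⟨m, hm⟩ := hy
    exact (sat_reconstruct_edgeSet hT d m (List.nodup_finRange n) List.mem_finRange).support _
      ((PMF.mem_support_iff _ _).2 hm) y rfl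
  have hcost : ∀ cost ∈ ({Cost.queries, Cost.time} : Set (Cost → ℕ)),
      expectedCost (reconstructionLaw d T) cost ≤ ENNReal.ofReal M := by
    rintro cost (rfl | rfl)
    · refine le_trans (ENNReal.tsum_le_tsum fun o => ?_) htime
      by_cases ho : limitLaw p o = 0
      · change limitLaw p o * _ ≤ limitLaw p o * _
        rw [ho, zero_mul, zero_mul]
      · refine mul_le_mul_right ?_ _
        cases o with
        | none => exact le_rfl
        | some y => exact Nat.cast_le.2 (hsupp y ho).2
    · exact htime
  refine ⟨?_, fun cost hc => ⟨hcost cost hc, fun δ hδ _ => ?_⟩⟩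
  · rw [PMF.toOuterMeasure_apply_eq_one_iff]
    intro o ho
    rw [PMF.mem_support_iff] at ho
    cases o with
    | none => exact absurd hnone ho
    | some y => exact ⟨y.2, by rw [← (hsupp y ho).1]⟩
  · have := le_toOuterMeasure_costAtMost _ cost hM0 hδ (hcost cost hc)
    rwa [hM, mul_left_comm] at this
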